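/- Let $2<q\le\infty$. Let $V_0=\mathbb R^{\infty,q}$ be the real vector space with basis $E=\{e_i\mid i<0\}\cup\{e_i\mid 0<i\le q\}$ ($i\in\mathbb Z$; no last element if $q=\infty$), with the symmetric bilinear form $b(e_i,e_j)=\delta_{ij}$ for $i<0$ and $b(e_i,e_j)=-\delta_{ij}$ for $i>0$, and put $(V_0)_+=\mathrm{Span}\{e_i\mid i<0\}$, $(V_0)_-=\mathrm{Span}\{e_i\mid i>0\}$. Let $G=SL(\infty+q;\mathbb R)=\varinjlim SL(T;\mathbb R)$ ($T\subset E$ finite), with the direct limit topology, let $G_0=SO(\infty,q)$ be the identity component of the group of $b$-isometries in $G$, and let $K_0=SO(\infty)\times SO(q)\subset G_0$ be the identity component of the group of $b$-isometries in $G$ that preserve $(V_0)_+$ and $(V_0)_-$. A subspace is compatible with a basis if it is spanned by a part of that basis; it is weakly compatible with $E$ if it is compatible with a basis $L$ of $V_0$ with $E\setminus L$ finite. Subspaces $F,F'$ are $E$-commensurable if both are weakly compatible with $E$ and there is a finite dimensional $U$ with $F\subset F'+U$, $F'\subset F+U$ and $\dim(F\cap U)=\dim(F'\cap U)$. Let $\mathfrak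 X$ be the real Grassmann manifold of all flags $\mathcal F^{(1)}=(0,F^{(1)},V_0)$ with $F^{(1)}$ $E$-commensurable to $(V_0)_-$, a homogeneous space of $G$ with its quotient topology. Let $\mathcal B^+_E$ be the set of all maximal positive definite subspaces $W\subset V_0$ that are weakly compatible with $E$ and for which $W\cap (V_0)_+$ has finite codimension in $W$ and in $(V_0)_+$; let $\mathcal B^-_E$ be the set of all maximal negative definite subspaces $W$ that are weakly compatible with $E$ and for which $W\cap(V_0)_-$ has finite codimension in $W$ and in $(V_0)_-$. For an open $G_0$-orbit $D\subset\mathfrak X$ and a base point $F^{(1)}\in D$ with $F^{(1)}=(F^{(1)}\cap (V_0)_+)\oplus(F^{(1)}\cap (V_0)_-)$ let $Y=K_0(F^{(1)})$ be the base cycle, and let the cycle space $\mathcal M_D$ be the connected component of $Y$ in $\{gY\mid g\in G,\ gY\subset D\}\subset G/G_Y$, where $G_Y=\{g\in G\mid gY=Y\}$. All these spaces carry the smooth structures that they have as parts of homogeneous spaces $G/H=\varinjlim SL(T;\mathbb R)/(H\cap SL(T;\mathbb R))$. Then: 1. $\mathcal B^+_E$ is the set of all positive definite $G$-translates of $(V_0)_+$,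 and $\mathcal B^-_E$ is the set of all negative definite $G$-translates of $(V_0)_-$. 2. $\mathcal B^+_E$ and $\mathcal B^-_E$ are diffeomorphic. 3. Let $D$ be an open $G_0$-orbit on $\mathfrak X$. Then $D$ contains a base point that is compatible with $E$. For every base point $F^{(1)}\in D$ as above, $F^{(1)}$ is positive definite, negative definite or indefinite, and * if $F^{(1)}$ is positive definite, then $\mathcal M_D$ is diffeomorphic to $\mathcal B^+_E$; * if $F^{(1)}$ is negative definite, then $\mathcal M_D$ is diffeomorphic to $\mathcal B^-_E$; * if $F^{(1)}$ is indefinite, then $\mathcal M_D$ is diffeomorphic to $\mathcal B^+_E\times\mathcal B^-_E$. -/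

import Mathlib

open Module
open scoped ContDiff

namespace RealCycle

noncomputable section

/-! ### The space with its basis and its form -/

/-- Indices of the basis `E = {…, e₋₂, e₋₁, e₁, e₂, …, e_q}` (no last element if `q = ∞`):
`Sum.inl n` stands for `e₋₍ₙ₊₁₎` and `Sum.inr n`, `n < q`, stands for `eₙ₊₁`. -/
abbrev Idx (q : ℕ∞) : Type := ℕ ⊕ {n : ℕ // (n : ℕ∞) < q}

/-- The real vector space `V₀ = ℝ^{∞,q}` of finite real linear combinations of `E`. -/
def V (q : ℕ∞) : Type := Idx q →₀ ℝ

instance instAddCommGroupV (q : ℕ∞) : AddCommGroup (V q) :=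
  inferInstanceAs (AddCommGroup (Idx q →₀ ℝ))

instance instModuleV (q : ℕ∞) : Module ℝ (V q) := inferInstanceAs (Module ℝ (Idx q →₀ ℝ))

/-- The basis `E` of `V₀`. -/
def E (q : ℕ∞) : Basis (Idx q) ℝ (V q) := Finsupp.basisSingleOne

/-- The basis vector with index `i`. -/
def e {q : ℕ∞} (i : Idx q) : V q := E q i

/-- The square `b(eᵢ, eᵢ)`: `+1` on the negative indices and `-1` on the positive ones. -/
def sgn {q : ℕ∞} : Idx q → ℝ := Sum.elim (fun _ => 1) (fun _ => -1)

/-- The symmetric bilinear form `b` with `b(eᵢ, eⱼ) = 0` for `i ≠ j`, `b(eᵢ, eᵢ) = ±1`, that is,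
`b(x, y) = ∑ i, b(eᵢ, eᵢ) xᵢ yᵢ`. -/
def form {q : ℕ∞} (x y : V q) : ℝ := ((E q).repr x).sum fun i a => sgn i * a * (E q).repr y i

/-- `(V₀)₊`, the span of the `eᵢ` with `i < 0`. -/
def Vplus (q : ℕ∞) : Submodule ℝ (V q) := Submodule.span ℝ (Set.range fun n => e (Sum.inl n))

/-- `(V₀)₋`, the span of the `eᵢ` with `i > 0`. -/
def Vminus (q : ℕ∞) : Submodule ℝ (V q) := Submodule.span ℝ (Set.range fun n => e (Sum.inr n))

def PosDef {q : ℕ∞} (W : Submodule ℝ (V q)) : Prop := ∀ x ∈ W, x ≠ 0 → 0 < form x x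

def NegDef {q : ℕ∞} (W : Submodule ℝ (V q)) : Prop := ∀ x ∈ W, x ≠ 0 → form x x < 0

def Indefinite {q : ℕ∞} (W : Submodule ℝ (V q)) : Prop :=
  (∃ x ∈ W, 0 < form x x) ∧ ∃ y ∈ W, form y y < 0

/-! ### The group `G = SL(∞ + q; ℝ)` as a direct limit -/

/-- The endomorphism of `V₀` that has matrix `M` on the span of the `eᵢ`, `i ∈ T`, and fixes
all the other basis vectors. -/
def extend {q : ℕ∞} (T : Finset (Idx q)) (M : Matrix T T ℝ) : End ℝ (V q) :=
  (E q).constr ℝ fun j => if h : j ∈ T then ∑ i : T, M i ⟨j, h⟩ • e (i : Idx q) else e j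

theorem extend_e {q : ℕ∞} (T : Finset (Idx q)) (M : Matrix T T ℝ) (j : Idx q) :
    extend T M (e j) = if h : j ∈ T then ∑ i : T, M i ⟨j, h⟩ • e (i : Idx q) else e j :=
  (E q).constr_basis ℝ _ j

theorem extend_one {q : ℕ∞} (T : Finset (Idx q)) : extend T (1 : Matrix T T ℝ) = 1 := by
  refine (E q).ext fun j => ?_
  change extend T 1 (e j) = e j
  rw [extend_e]
  split_ifs with h
  · simp [Matrix.one_apply]
  · rfl

theorem extend_mul {q : ℕ∞} (T : Finset (Idx q)) (M N : Matrix T T ℝ) :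
    extend T (M * N) = extend T M * extend T N := by
  refine (E q).ext fun j => ?_
  change extend T (M * N) (e j) = extend T M (extend T N (e j))
  rw [extend_e, extend_e]
  split_ifs with h
  · simp only [map_sum, map_smul, extend_e, Subtype.coe_eta, Finset.coe_mem, dite_true,
      Matrix.mul_apply, Finset.sum_smul, Finset.smul_sum, smul_smul]
    rw [Finset.sum_comm]
    exact Finset.sum_congr rfl fun _ _ => Finset.sum_congr rfl fun _ _ => by rw [mul_comm]
  · simp [extend_e, h]

/-- The inclusion of `SL(T; ℝ)`, `T` a finite set of indices, in the linear group of `V₀`. -/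
def stageHom {q : ℕ∞} (T : Finset (Idx q)) :
    Matrix.SpecialLinearGroup T ℝ →* LinearMap.GeneralLinearGroup ℝ (V q) :=
  MonoidHom.toHomUnits
    { toFun := fun M => extend T (M : Matrix T T ℝ)
      map_one' := extend_one T
      map_mul' := fun M N => extend_mul T M N }

/-- `SL(∞ + q; ℝ)`, the union of the groups `SL(T; ℝ)` (a directed family of subgroups). -/
def SL (q : ℕ∞) : Subgroup (LinearMap.GeneralLinearGroup ℝ (V q)) := ⨆ T, (stageHom T).range

/-- The inclusion of `SL(T; ℝ)` in `SL(∞ + q; ℝ)`. -/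
def stage {q : ℕ∞} (T : Finset (Idx q)) (M : Matrix.SpecialLinearGroup T ℝ) : SL q :=
  ⟨stageHom T M, Subgroup.mem_iSup_of_mem T ⟨M, rfl⟩⟩

/-- The direct limit topology: a set is open if and only if its preimage in every `SL(T; ℝ)`
is open. -/
instance instTopologicalSpaceSL (q : ℕ∞) : TopologicalSpace (SL q) :=
  ⨆ T : Finset (Idx q), TopologicalSpace.coinduced (stage T) inferInstance

/-- An element of `G` as a linear map. -/
def toLin {q : ℕ∞} (g : SL q) : V q →ₗ[ℝ] V q := (g : LinearMap.GeneralLinearGroup ℝ (V q)).val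

/-- The translate `g W` of a subspace `W`. -/
def translate {q : ℕ∞} (g : SL q) (W : Submodule ℝ (V q)) : Submodule ℝ (V q) := W.map (toLin g)

/-- The element `g` preserves the form `b`. -/
def IsIsometry {q : ℕ∞} (g : SL q) : Prop :=
  ∀ x y : V q, form (toLin g x) (toLin g y) = form x y

/-- `G₀ = SO(∞, q)`, by convention the topological identity component of the isometry group. -/
def SO (q : ℕ∞) : Set (SL q) := connectedComponentIn {g | IsIsometry g} 1

/-- `K₀ = SO(∞) × SO(q)`, the maximal lim-compact subgroup of `G₀` that belongs to the
decomposition `V₀ = (V₀)₊ ⊕ (V₀)₋`: the identity component of the group of isometries that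
preserve both summands. -/
def K (q : ℕ∞) : Set (SL q) :=
  connectedComponentIn
    {g | IsIsometry g ∧ translate g (Vplus q) = Vplus q ∧ translate g (Vminus q) = Vminus q} 1

/-! ### The real flag manifold of flags `(0, F, V₀)` -/

/-- The subspace `F` (that is, the flag `(0, F, V₀)`) is compatible with the basis `L`. -/
def CompatibleWith {q : ℕ∞} (L : Set (V q)) (F : Submodule ℝ (V q)) : Prop :=
  ∃ S ⊆ L, F = Submodule.span ℝ S

/-- `F` is compatible with `E`. -/
def Compatible {q : ℕ∞} (F : Submodule ℝ (V q)) : Prop := CompatibleWith (Set.range e) F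

/-- `F` is weakly compatible with `E`: it is compatible with a basis `L` of `V₀` that contains
all but finitely many elements of `E`. -/
def WeaklyCompatible {q : ℕ∞} (F : Submodule ℝ (V q)) : Prop :=
  ∃ L : Set (V q), LinearIndepOn ℝ id L ∧ Submodule.span ℝ L = ⊤ ∧
    (Set.range (e (q := q)) \ L).Finite ∧ CompatibleWith L F

/-- The flags `(0, F, V₀)` and `(0, F', V₀)` are `E`-commensurable. (On the members `0` and `V₀`
the conditions hold trivially.) -/
def Commensurable {q : ℕ∞} (F F' : Submodule ℝ (V q)) : Prop :=
  WeaklyCompatible F ∧ WeaklyCompatible F' ∧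
    ∃ U : Submodule ℝ (V q), FiniteDimensional ℝ U ∧ F ≤ F' ⊔ U ∧ F' ≤ F ⊔ U ∧
      finrank ℝ ↥(F ⊓ U) = finrank ℝ ↥(F' ⊓ U)

/-- The real Grassmann manifold `𝔛`: all `F` such that `(0, F, V₀)` is `E`-commensurable to
`(0, (V₀)₋, V₀)`. -/
def Grass (q : ℕ∞) : Set (Submodule ℝ (V q)) := {F | Commensurable F (Vminus q)}

/-- The topology of the homogeneous space `𝔛 = G (V₀)₋`: a subset of `𝔛` is open if and only
if its preimage under the orbit map `g ↦ g (V₀)₋` is open in `G`. -/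
@[reducible]
def grassTopology (q : ℕ∞) : TopologicalSpace (Submodule ℝ (V q)) :=
  TopologicalSpace.coinduced (fun g : SL q => translate g (Vminus q)) inferInstance

/-- `D` is an open `G₀`-orbit on `𝔛`. -/
def IsOpenOrbit {q : ℕ∞} (D : Set (Submodule ℝ (V q))) : Prop :=
  (∃ F ∈ Grass q, D = {F' | ∃ g ∈ SO q, F' = translate g F}) ∧ @IsOpen _ (grassTopology q) D

/-- `F` fits the decomposition `V₀ = (V₀)₊ ⊕ (V₀)₋`. -/
def FitsSplitting {q : ℕ∞} (F : Submodule ℝ (V q)) : Prop :=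
  F = (F ⊓ Vplus q) ⊔ (F ⊓ Vminus q)

/-! ### Cycles and the cycle space -/

/-- The base cycle `K₀(F)`. -/
def baseCycle {q : ℕ∞} (F : Submodule ℝ (V q)) : Set (Submodule ℝ (V q)) :=
  {F' | ∃ k ∈ K q, F' = translate k F}

/-- The translate `g Y` of a cycle `Y`. -/
def translateCycle {q : ℕ∞} (Y : Set (Submodule ℝ (V q))) (g : SL q) :
    Set (Submodule ℝ (V q)) := translate g '' Y

/-- `𝓜'_D`, the set of all `G`-translates of `Y` that are contained in `D`. -/
def allCycles {q : ℕ∞} (D Y : Set (Submodule ℝ (V q))) : Set (Set (Submodule ℝ (V q))) :=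
  {Z | (∃ g : SL q, Z = translateCycle Y g) ∧ Z ⊆ D}

/-- The quotient topology on the set `G / G_Y` of all `G`-translates of `Y`. -/
@[reducible]
def cycleTopology {q : ℕ∞} (Y : Set (Submodule ℝ (V q))) :
    TopologicalSpace (Set (Submodule ℝ (V q))) :=
  TopologicalSpace.coinduced (translateCycle Y) inferInstance

/-- The cycle space `𝓜_D`: the topological component of `Y` in `𝓜'_D`. -/
def cycleSpace {q : ℕ∞} (D Y : Set (Submodule ℝ (V q))) : Set (Set (Submodule ℝ (V q))) :=
  @connectedComponentIn _ (cycleTopology Y) (allCycles D Y) Y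

/-! ### The real bounded symmetric domains -/

/-- `A ∩ B` has finite codimension in `A`. -/
def FiniteCodimIn {q : ℕ∞} (A B : Submodule ℝ (V q)) : Prop :=
  FiniteDimensional ℝ (↥A ⧸ (A ⊓ B).submoduleOf A)

/-- The positive bounded symmetric domain `𝓑⁺`: the maximal positive definite subspaces `W`,
weakly compatible with `E`, such that `W ∩ (V₀)₊` has finite codimension in `W` and in
`(V₀)₊`. -/
def Bplus (q : ℕ∞) : Set (Submodule ℝ (V q)) :=
  {W | Maximal PosDef W ∧ WeaklyCompatible W ∧
    FiniteCodimIn W (Vplus q) ∧ FiniteCodimIn (Vplus q) W}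

/-- The negative bounded symmetric domain `𝓑⁻`. -/
def Bminus (q : ℕ∞) : Set (Submodule ℝ (V q)) :=
  {W | Maximal NegDef W ∧ WeaklyCompatible W ∧
    FiniteCodimIn W (Vminus q) ∧ FiniteCodimIn (Vminus q) W}

/-! ### Smooth structures

`G` is the direct limit of the Lie groups `SL(T; ℝ)`, and a homogeneous space `G / H` is the
direct limit of the manifolds `SL(T; ℝ) / (H ∩ SL(T; ℝ))`. Such a limit of finite dimensional
manifolds is described by its smooth maps from open subsets of the spaces `ℝⁿ`, which are the
maps that are locally smooth maps to one of the steps, and hence lift locally to smooth maps to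
some `SL(T; ℝ)`. A map between two such spaces is smooth if and only if it respects them. -/

/-- Let `a : G → X` be the orbit map of a point of a set `X` on which `G` acts. A map `p` with
values in `X` is smooth on `u` if, locally on `u`, it is constant or of the form `x ↦ a (M x)`
for a smooth map `M` to some `SL(T; ℝ)`. (On the orbit, the second case includes the first.) -/
def SmoothOn {q : ℕ∞} {X : Type} (a : SL q → X) {n : ℕ} (p : EuclideanSpace ℝ (Fin n) → X)
    (u : Set (EuclideanSpace ℝ (Fin n))) : Prop :=
  ∀ x ∈ u, ∃ w, IsOpen w ∧ x ∈ w ∧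
    ((∃ c, ∀ y ∈ w, p y = c) ∨
      ∃ (T : Finset (Idx q)) (M : EuclideanSpace ℝ (Fin n) → Matrix.SpecialLinearGroup T ℝ),
        (∀ i j, ContDiffOn ℝ ∞ (fun y => (M y : Matrix T T ℝ) i j) w) ∧
          ∀ y ∈ w, p y = a (stage T (M y)))

/-- The smooth structure of a subset `S` of an orbit with orbit map `a`. -/
@[reducible]
def orbitDiffeology {q : ℕ∞} {X : Type} (a : SL q → X) (S : Set X) : DiffeologicalSpace S :=
  DiffeologicalSpace.ofCorePlotsOn
    { isPlotOn := fun {_ u} _ p => SmoothOn a (fun x => (p x : X)) u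
      isPlotOn_congr := by
        intro n u hu p r h
        suffices H : ∀ p r : EuclideanSpace ℝ (Fin n) → S, Set.EqOn p r u →
            SmoothOn a (fun x => (p x : X)) u → SmoothOn a (fun x => (r x : X)) u from
          ⟨H p r h, H r p h.symm⟩
        intro p r h hp x hx
        obtain ⟨w, hw, hxw, hc⟩ := hp x hx
        refine ⟨w ∩ u, hw.inter hu, ⟨hxw, hx⟩, ?_⟩
        rcases hc with ⟨c, hc⟩ | ⟨T, M, hM, hc⟩
        · exact Or.inl ⟨c, fun y hy => (congrArg Subtype.val (h hy.2)).symm.trans (hc y hy.1)⟩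
        · exact Or.inr ⟨T, M, fun i j => (hM i j).mono Set.inter_subset_left,
            fun y hy => (congrArg Subtype.val (h hy.2)).symm.trans (hc y hy.1)⟩
      isPlot_const := fun c _ _ =>
        ⟨Set.univ, isOpen_univ, Set.mem_univ _, Or.inl ⟨c, fun _ _ => rfl⟩⟩
      isPlotOn_reparam := by
        intro n m u v hu hv p f h hp hf x hx
        obtain ⟨w, hw, hxw, hc⟩ := hp (f x) (h hx)
        refine ⟨v ∩ f ⁻¹' w, hf.continuousOn.isOpen_inter_preimage hv hw, ⟨hx, hxw⟩, ?_⟩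
        rcases hc with ⟨c, hc⟩ | ⟨T, M, hM, hc⟩
        · exact Or.inl ⟨c, fun y hy => hc _ hy.2⟩
        · exact Or.inr ⟨T, fun y => M (f y), fun i j =>
            (hM i j).comp (hf.mono Set.inter_subset_left) fun y hy => hy.2,
            fun y hy => hc _ hy.2⟩
      locality := by
        intro n u hu p hp x hx
        obtain ⟨v, _, hxv, h⟩ := hp x hx
        exact h x hxv }

/-- `𝓑⁺` as a domain in the orbit `G (V₀)₊`. -/
instance instDiffeologicalSpaceBplus (q : ℕ∞) : DiffeologicalSpace (Bplus q) :=
  orbitDiffeology (fun g => translate g (Vplus q)) (Bplus q)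

/-- `𝓑⁻` as a domain in the orbit `G (V₀)₋`. -/
instance instDiffeologicalSpaceBminus (q : ℕ∞) : DiffeologicalSpace (Bminus q) :=
  orbitDiffeology (fun g => translate g (Vminus q)) (Bminus q)

/-- `𝓜_D` as a domain in `G / G_Y`. -/
instance instDiffeologicalSpaceCycleSpace {q : ℕ∞} (D Y : Set (Submodule ℝ (V q))) :
    DiffeologicalSpace (cycleSpace D Y) :=
  orbitDiffeology (translateCycle Y) (cycleSpace D Y)

/-- The smooth structure of a product: a map to it is smooth if both components are. -/
instance instDiffeologicalSpaceProd {X Y : Type} [DiffeologicalSpace X] [DiffeologicalSpace Y] :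
    DiffeologicalSpace (X × Y) where
  plots _ := {p | Diffeology.IsPlot (fun x => (p x).1) ∧ Diffeology.IsPlot fun x => (p x).2}
  constant_plots _ := ⟨Diffeology.isPlot_const, Diffeology.isPlot_const⟩
  plot_reparam hp hf :=
    ⟨Diffeology.isPlot_reparam hp.1 hf, Diffeology.isPlot_reparam hp.2 hf⟩
  locality h := by
    constructor
    · refine DiffeologicalSpace.locality fun x => ?_
      obtain ⟨u, hu, hx, H⟩ := h x
      exact ⟨u, hu, hx, fun hf hs => (H hf hs).1⟩
    · refine DiffeologicalSpace.locality fun x => ?_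
      obtain ⟨u, hu, hx, H⟩ := h x
      exact ⟨u, hu, hx, fun hf hs => (H hf hs).2⟩

/-- There is a diffeomorphism between `X` and `Y`. -/
def Diffeomorphic (X Y : Type) [DiffeologicalSpace X] [DiffeologicalSpace Y] : Prop :=
  ∃ f : X ≃ Y, Diffeology.DSmooth f ∧ Diffeology.DSmooth f.symm

end

end RealCycle

/-! Write V₊, V₋ for the two summands and k for the dimension of the positive part of a base point.
Every element of G differs from the identity only on finitely many basis vectors, so a translate of
V₊ or V₋ is a coordinate subspace outside a finite index set T (`Adapted`), and linear algebra takes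
place in the finite dimensional span of T. An injective map supported in T acts on coordinate
subspaces like an element of G, because one column can be rescaled to make the determinant 1
(`exists_SL_of_injective`).

The description of the two domains is a dimension count: a maximal definite subspace that is
standard outside T must have inside T the dimension of the corresponding coordinate subspace, since
otherwise an orthogonal vector of the right sign could be adjoined (`maximal_finrank_eq`,
`domain_iff`). The diffeomorphism between the domains is W ↦ W⊥; it lifts to M ↦ (M*)⁻¹ on each
SL(T), which is polynomial in the entries (`coadj`).

An open orbit consists of nondegenerate subspaces: on the line from a representing matrix to the
identity the Gram determinant is a nonzero polynomial, so degenerate points have nondegenerate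
neighbours, and openness puts such a neighbour in the same orbit (`nondeg_of_isOpen`). Rotations and
boosts in coordinate planes, a form of Gram–Schmidt, then move a nondegenerate translate of V₋ to a
coordinate subspace. Hence D consists of the translates of V₋ whose positive part has dimension k
(`IsOpenOrbit.mem_iff`), and the base cycle Y of those that moreover fit the splitting
(`mem_baseCycle_iff`).

These descriptions determine which gY lie in D and which g stabilize Y. If the base point is
positive definite, the members of Y cover V₊, so gY ⊆ D means that gV₊ is positive definite, and gY
depends only on gV₊. If it is negative definite, Y is the single point V₋. If it is indefinite, gY ⊆
D means that gV₊ is positive and gV₋ negative definite, and gY determines and is determined by this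
pair (`translateCycle_subset_iff`, `translateCycle_eq_iff_fix`). One argument uses that V₊ is
infinite dimensional, so k positive basis vectors can be found that g fixes; another uses the
adjoint of g.

In each case g ↦ gY and the orbit map of the model domain have the same fibres and the same preimage
of the domain, so the same local lifts to SL(T) give smoothness both ways (`diffeomorphic_orbit`).
All cycles in D lie in one component because a definite subspace is a graph, and shrinking the graph
linearly to zero keeps it definite (`CDef.segment`, `exists_path`). For the product, smooth lifts of
the two factors are merged column by column (`exists_common_lift`). -/

namespace RealCycle

noncomputable section

variable {q : ℕ∞}

/-! ### Coordinates, coordinate subspaces and the form -/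

/-- The `i`-th coordinate. -/
def co (i : Idx q) : V q →ₗ[ℝ] ℝ := (E q).coord i

theorem co_apply (i : Idx q) (x : V q) : co i x = (E q).repr x i := rfl

theorem co_e (i j : Idx q) : co i (e j) = if i = j then 1 else 0 := by
  rw [co_apply, e, Basis.repr_self, Finsupp.single_apply]
  simp only [eq_comm]

@[simp] theorem co_e_self (i : Idx q) : co i (e i) = 1 := by simp [co_e]

theorem co_e_ne {i j : Idx q} (h : i ≠ j) : co i (e j) = 0 := by simp [co_e, h]

theorem ext_co {x y : V q} (h : ∀ i, co i x = co i y) : x = y :=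
  (E q).repr.injective (Finsupp.ext h)

theorem e_ne_zero (i : Idx q) : e i ≠ 0 := (E q).ne_zero i

theorem hom_ext {M : Type*} [AddCommGroup M] [Module ℝ M] {f g : V q →ₗ[ℝ] M}
    (h : ∀ i, f (e i) = g (e i)) : f = g := (E q).ext h

/-- The span of the basis vectors with index in `s`. -/
def Vs (s : Set (Idx q)) : Submodule ℝ (V q) := Submodule.span ℝ (e '' s)

theorem mem_Vs {s : Set (Idx q)} {x : V q} : x ∈ Vs s ↔ ∀ i ∉ s, co i x = 0 := by
  have : e (q := q) = E q := rfl
  rw [Vs, this, Basis.mem_span_image]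
  simp only [Set.subset_def, Finset.mem_coe, Finsupp.mem_support_iff, co_apply]
  exact forall_congr' fun i => by tauto

theorem e_mem_Vs {s : Set (Idx q)} {i : Idx q} : e i ∈ Vs s ↔ i ∈ s := by
  rw [mem_Vs]
  constructor
  · intro h
    by_contra hi
    simpa using h i hi
  · intro h j hj
    exact co_e_ne fun hij => hj (hij ▸ h)

theorem Vs_mono {s t : Set (Idx q)} (h : s ⊆ t) : Vs s ≤ Vs t :=
  Submodule.span_mono (Set.image_mono h)

theorem Vs_le {s : Set (Idx q)} {W : Submodule ℝ (V q)} : Vs s ≤ W ↔ ∀ i ∈ s, e i ∈ W := by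
  rw [Vs, Submodule.span_le, Set.image_subset_iff]; rfl

theorem Vs_univ : Vs (Set.univ : Set (Idx q)) = ⊤ :=
  eq_top_iff.2 fun _ _ => mem_Vs.2 fun i hi => absurd (Set.mem_univ i) hi

theorem Vs_empty : Vs (∅ : Set (Idx q)) = ⊥ := by simp [Vs]

theorem Vs_union (s t : Set (Idx q)) : Vs (s ∪ t) = Vs s ⊔ Vs t := by
  rw [Vs, Set.image_union, Submodule.span_union]; rfl

theorem Vs_inter (s t : Set (Idx q)) : Vs (s ∩ t) = Vs s ⊓ Vs t := by
  ext x
  simp only [Submodule.mem_inf, mem_Vs, Set.mem_inter_iff, not_and_or]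
  exact ⟨fun h => ⟨fun i hi => h i (Or.inl hi), fun i hi => h i (Or.inr hi)⟩,
    fun h i hi => hi.elim (h.1 i) (h.2 i)⟩

theorem Vs_sup_compl (s : Set (Idx q)) : Vs s ⊔ Vs sᶜ = ⊤ := by
  rw [← Vs_union, Set.union_compl_self, Vs_univ]

/-- The form as a bilinear map. -/
def B : V q →ₗ[ℝ] V q →ₗ[ℝ] ℝ := (E q).constr ℝ fun i => sgn i • co i

theorem B_e_left (i : Idx q) (y : V q) : B (e i) y = sgn i * co i y := by
  have : B (e i) = sgn i • co i := (E q).constr_basis ℝ _ i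
  rw [this]; rfl

theorem form_eq (x y : V q) : form x y = B x y := by
  rw [B, Basis.constr_apply, form, LinearMap.finsupp_sum_apply]
  refine Finsupp.sum_congr fun i _ => ?_
  simp only [LinearMap.smul_apply, smul_eq_mul, co_apply]
  ring

theorem B_comm (x y : V q) : B x y = B y x := by
  have : B = (B (q := q)).flip := by
    refine hom_ext fun i => hom_ext fun j => ?_
    rw [LinearMap.flip_apply, B_e_left, B_e_left, co_e, co_e]
    by_cases h : i = j
    · subst h; rfl
    · simp [h, Ne.symm h]
  rw [← LinearMap.flip_apply, ← this]

theorem B_e_right (i : Idx q) (x : V q) : B x (e i) = sgn i * co i x := by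
  rw [B_comm, B_e_left]

theorem sgn_eq (i : Idx q) : sgn i = 1 ∨ sgn i = -1 := by
  rcases i with i | i
  · exact Or.inl rfl
  · exact Or.inr rfl

theorem sgn_ne_zero (i : Idx q) : sgn i ≠ 0 := by rcases sgn_eq i with h | h <;> simp [h]

theorem sgn_mul_self (i : Idx q) : sgn i * sgn i = 1 := by
  rcases sgn_eq i with h | h <;> simp [h]

theorem B_eq_zero_of_disjoint {s t : Set (Idx q)} (h : Disjoint s t) {x y : V q} (hx : x ∈ Vs s)
    (hy : y ∈ Vs t) : B x y = 0 := by
  have : Vs s ≤ LinearMap.ker (B.flip y) := Vs_le.2 fun i hi => by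
    rw [LinearMap.mem_ker, LinearMap.flip_apply, B_e_left,
      mem_Vs.1 hy i fun hit => Set.disjoint_left.1 h hi hit, mul_zero]
  exact this hx

theorem exists_finset_mem (x : V q) : ∃ T : Finset (Idx q), x ∈ Vs (T : Set (Idx q)) :=
  ⟨((E q).repr x).support, mem_Vs.2 fun i hi => by simpa [co_apply] using hi⟩

theorem B_self_eq {T : Finset (Idx q)} {x : V q} (hx : x ∈ Vs (T : Set (Idx q))) (y : V q) :
    B x y = ∑ i ∈ T, sgn i * (co i x * co i y) := by
  have hx' : x = ∑ i ∈ T, co i x • e i := by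
    refine ext_co fun j => ?_
    simp only [map_sum, map_smul, smul_eq_mul, co_e]
    by_cases hj : j ∈ T
    · simp [hj]
    · simp [hj, mem_Vs.1 hx j hj]
  conv_lhs => rw [hx']
  simp only [map_sum, map_smul, LinearMap.sum_apply, LinearMap.smul_apply, smul_eq_mul, B_e_left]
  exact Finset.sum_congr rfl fun i _ => by ring

/-- The indices of the basis vectors of square `c`. -/
def ID (c : ℝ) : Set (Idx q) := {i | sgn i = c}

theorem mem_ID {c : ℝ} {i : Idx q} : i ∈ ID c ↔ sgn i = c := Iff.rfl

theorem ID_compl {c : ℝ} (hc : c = 1 ∨ c = -1) : (ID c : Set (Idx q))ᶜ = ID (-c) := by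
  ext i
  simp only [Set.mem_compl_iff, mem_ID]
  rcases sgn_eq i with h | h <;> rcases hc with rfl | rfl <;> rw [h] <;> norm_num

theorem Vplus_eq : Vplus q = Vs (ID 1) := by
  refine congrArg _ (Set.ext fun x => ⟨?_, ?_⟩)
  · rintro ⟨n, rfl⟩
    exact ⟨_, rfl, rfl⟩
  · rintro ⟨i | i, hi, rfl⟩
    · exact ⟨i, rfl⟩
    · exact absurd (show (-1 : ℝ) = 1 from hi) (by norm_num)

theorem Vminus_eq : Vminus q = Vs (ID (-1)) := by
  refine congrArg _ (Set.ext fun x => ⟨?_, ?_⟩)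
  · rintro ⟨n, rfl⟩
    exact ⟨_, rfl, rfl⟩
  · rintro ⟨i | i, hi, rfl⟩
    · exact absurd (show (1 : ℝ) = -1 from hi) (by norm_num)
    · exact ⟨i, rfl⟩

/-- `c · b` is positive definite on `W`. -/
def CDef (c : ℝ) (W : Submodule ℝ (V q)) : Prop := ∀ x ∈ W, x ≠ 0 → 0 < c * B x x

theorem posDef_iff {W : Submodule ℝ (V q)} : PosDef W ↔ CDef 1 W := by
  simp [PosDef, CDef, form_eq]

theorem negDef_iff {W : Submodule ℝ (V q)} : NegDef W ↔ CDef (-1) W := by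
  simp [NegDef, CDef, form_eq]

theorem CDef.mono {c : ℝ} {W W' : Submodule ℝ (V q)} (h : CDef c W) (hW : W' ≤ W) : CDef c W' :=
  fun x hx => h x (hW hx)

theorem CDef.eq_zero {c : ℝ} {W : Submodule ℝ (V q)} (h : CDef c W) {x : V q} (hx : x ∈ W)
    (hb : c * B x x ≤ 0) : x = 0 := by
  by_contra h0
  exact absurd (h x hx h0) (not_lt.2 hb)

theorem CDef.nonneg {c : ℝ} {W : Submodule ℝ (V q)} (h : CDef c W) {x : V q} (hx : x ∈ W) :
    0 ≤ c * B x x := by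
  by_cases h0 : x = 0
  · simp [h0]
  · exact (h x hx h0).le

theorem cdef_Vs {c : ℝ} (hc : c = 1 ∨ c = -1) : CDef c (Vs (ID c : Set (Idx q))) := by
  intro x hx hx0
  obtain ⟨T, hT⟩ := exists_finset_mem x
  rw [B_self_eq hT, Finset.mul_sum]
  have key : ∀ i ∈ T, c * (sgn i * (co i x * co i x)) = co i x ^ 2 := by
    intro i _
    by_cases hi : i ∈ ID c
    · rw [mem_ID.1 hi]
      rcases hc with rfl | rfl <;> ring
    · rw [mem_Vs.1 hx i hi]; ring
  rw [Finset.sum_congr rfl key]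
  refine Finset.sum_pos' (fun i _ => sq_nonneg _) ?_
  by_contra! hcon
  refine hx0 (ext_co fun i => ?_)
  rw [map_zero]
  by_cases hi : i ∈ T
  · exact pow_eq_zero_iff (two_ne_zero) |>.1 (le_antisymm (hcon i hi) (sq_nonneg _))
  · exact mem_Vs.1 hT i hi

/-! ### Translates -/

theorem toLin_mul (g h : SL q) : toLin (g * h) = toLin g ∘ₗ toLin h := rfl

theorem toLin_mul_apply (g h : SL q) (x : V q) : toLin (g * h) x = toLin g (toLin h x) := rfl

theorem toLin_one : toLin (1 : SL q) = LinearMap.id := rfl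

@[simp] theorem toLin_inv_apply (g : SL q) (x : V q) : toLin g⁻¹ (toLin g x) = x := by
  rw [← toLin_mul_apply, inv_mul_cancel]; rfl

@[simp] theorem toLin_apply_inv (g : SL q) (x : V q) : toLin g (toLin g⁻¹ x) = x := by
  rw [← toLin_mul_apply, mul_inv_cancel]; rfl

theorem toLin_injective (g : SL q) : Function.Injective (toLin g) :=
  Function.LeftInverse.injective (toLin_inv_apply g)

theorem translate_mul (g h : SL q) (W : Submodule ℝ (V q)) :
    translate (g * h) W = translate g (translate h W) := by
  rw [translate, toLin_mul, Submodule.map_comp]; rfl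

@[simp] theorem translate_one (W : Submodule ℝ (V q)) : translate 1 W = W := by
  rw [translate, toLin_one, Submodule.map_id]

@[simp] theorem translate_inv_translate (g : SL q) (W : Submodule ℝ (V q)) :
    translate g⁻¹ (translate g W) = W := by
  rw [← translate_mul, inv_mul_cancel, translate_one]

@[simp] theorem translate_translate_inv (g : SL q) (W : Submodule ℝ (V q)) :
    translate g (translate g⁻¹ W) = W := by
  rw [← translate_mul, mul_inv_cancel, translate_one]

theorem mem_translate {g : SL q} {W : Submodule ℝ (V q)} {x : V q} :
    x ∈ translate g W ↔ toLin g⁻¹ x ∈ W := by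
  constructor
  · rintro ⟨y, hy, rfl⟩
    simpa using hy
  · intro h
    exact ⟨_, h, by simp⟩

theorem apply_mem_translate {g : SL q} {W : Submodule ℝ (V q)} {x : V q} :
    toLin g x ∈ translate g W ↔ x ∈ W := by simp [mem_translate]

theorem translate_mono {g : SL q} {W W' : Submodule ℝ (V q)} (h : W ≤ W') :
    translate g W ≤ translate g W' := Submodule.map_mono h

theorem translate_sup (g : SL q) (W W' : Submodule ℝ (V q)) :
    translate g (W ⊔ W') = translate g W ⊔ translate g W' := Submodule.map_sup _ _ _

theorem translate_inf (g : SL q) (W W' : Submodule ℝ (V q)) :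
    translate g (W ⊓ W') = translate g W ⊓ translate g W' := by
  ext x; simp [mem_translate]

theorem finrank_translate (g : SL q) (W : Submodule ℝ (V q)) :
    finrank ℝ (translate g W) = finrank ℝ W :=
  (Submodule.equivMapOfInjective (toLin g) (toLin_injective g) W).finrank_eq.symm

/-! ### The stages of the direct limit -/

/-- `f` fixes the basis vectors with index outside `T` and preserves the span of the others. -/
def SuppIn (T : Set (Idx q)) (f : V q →ₗ[ℝ] V q) : Prop :=
  (∀ j ∉ T, f (e j) = e j) ∧ ∀ j ∈ T, f (e j) ∈ Vs T

theorem SuppIn.id (T : Set (Idx q)) : SuppIn T (LinearMap.id : V q →ₗ[ℝ] V q) :=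
  ⟨fun _ _ => rfl, fun _ hj => e_mem_Vs.2 hj⟩

theorem SuppIn.map_mem {T : Set (Idx q)} {f : V q →ₗ[ℝ] V q} (h : SuppIn T f) {x : V q}
    (hx : x ∈ Vs T) : f x ∈ Vs T := by
  have : Vs T ≤ (Vs T).comap f := Vs_le.2 h.2
  exact this hx

theorem SuppIn.map_eq {T : Set (Idx q)} {f : V q →ₗ[ℝ] V q} (h : SuppIn T f) {x : V q}
    (hx : x ∈ Vs Tᶜ) : f x = x := by
  have : Vs Tᶜ ≤ LinearMap.ker (f - LinearMap.id) := Vs_le.2 fun i hi => by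
    simp [h.1 i hi]
  simpa [sub_eq_zero] using this hx

/-- This makes the coordinates outside T invariants of f, as `SuppIn.co_eq` records. -/
theorem SuppIn.sub_mem {T : Set (Idx q)} {f : V q →ₗ[ℝ] V q} (h : SuppIn T f) (x : V q) :
    f x - x ∈ Vs T := by
  have : (⊤ : Submodule ℝ (V q)) ≤ (Vs T).comap (f - LinearMap.id) := by
    rw [← Vs_univ, Vs_le]
    intro i _
    by_cases hi : i ∈ T
    · exact Submodule.sub_mem _ (h.2 i hi) (e_mem_Vs.2 hi)
    · simp [h.1 i hi]
  exact this Submodule.mem_top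

theorem SuppIn.co_eq {T : Set (Idx q)} {f : V q →ₗ[ℝ] V q} (h : SuppIn T f) {i : Idx q}
    (hi : i ∉ T) (x : V q) : co i (f x) = co i x := by
  have := mem_Vs.1 (h.sub_mem x) i hi
  rwa [map_sub, sub_eq_zero] at this

theorem SuppIn.mono {T T' : Set (Idx q)} {f : V q →ₗ[ℝ] V q} (h : SuppIn T f) (hT : T ⊆ T') :
    SuppIn T' f := by
  refine ⟨fun j hj => h.1 j fun hj' => hj (hT hj'), fun j hj => ?_⟩
  by_cases hj' : j ∈ T
  · exact Vs_mono hT (h.2 j hj')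
  · rw [h.1 j hj']; exact e_mem_Vs.2 hj

theorem SuppIn.comp {T : Set (Idx q)} {f g : V q →ₗ[ℝ] V q} (hf : SuppIn T f) (hg : SuppIn T g) :
    SuppIn T (f ∘ₗ g) :=
  ⟨fun j hj => by rw [LinearMap.comp_apply, hg.1 j hj, hf.1 j hj],
    fun _ hj => hf.map_mem (hg.2 _ hj)⟩

theorem extend_apply_mem (T : Finset (Idx q)) (N : Matrix T T ℝ) {j : Idx q} (hj : j ∈ T) :
    extend T N (e j) = ∑ i : T, N i ⟨j, hj⟩ • e (i : Idx q) := by rw [extend_e, dif_pos hj]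

theorem co_extend (T : Finset (Idx q)) (N : Matrix T T ℝ) (i j : T) :
    co (i : Idx q) (extend T N (e (j : Idx q))) = N i j := by
  rw [extend_apply_mem T N j.2, map_sum, Finset.sum_eq_single i]
  · simp
  · intro k _ hk
    rw [map_smul, co_e_ne fun h => hk (Subtype.ext h).symm, smul_zero]
  · simp

theorem suppIn_extend (T : Finset (Idx q)) (N : Matrix T T ℝ) :
    SuppIn (T : Set (Idx q)) (extend T N) :=
  ⟨fun j hj => by rw [extend_e, dif_neg (by simpa using hj)],
    fun j hj => by
      rw [extend_apply_mem T N hj]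
      exact Submodule.sum_mem _ fun i _ => Submodule.smul_mem _ _ (e_mem_Vs.2 i.2)⟩

/-- The matrix of an endomorphism in the coordinates with index in `T`. -/
def matOf (T : Finset (Idx q)) (f : V q →ₗ[ℝ] V q) : Matrix T T ℝ :=
  Matrix.of fun i j => co (i : Idx q) (f (e (j : Idx q)))

theorem extend_matOf {T : Finset (Idx q)} {f : V q →ₗ[ℝ] V q}
    (hf : SuppIn (T : Set (Idx q)) f) : extend T (matOf T f) = f := by
  refine hom_ext fun j => ?_
  by_cases hj : j ∈ T
  · refine ext_co fun i => ?_
    by_cases hi : i ∈ T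
    · exact co_extend T (matOf T f) ⟨i, hi⟩ ⟨j, hj⟩
    · rw [mem_Vs.1 ((suppIn_extend T _).2 j hj) i hi, mem_Vs.1 (hf.2 j hj) i hi]
  · rw [(suppIn_extend T _).1 j hj, hf.1 j hj]

theorem matOf_extend (T : Finset (Idx q)) (N : Matrix T T ℝ) : matOf T (extend T N) = N := by
  ext i j
  exact co_extend T N i j

theorem det_ne_zero_of_injective {T : Finset (Idx q)} {N : Matrix T T ℝ}
    (h : Function.Injective (extend T N)) : N.det ≠ 0 := by
  intro hdet
  obtain ⟨v, hv, hv0⟩ := Matrix.exists_mulVec_eq_zero_iff.2 hdet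
  apply hv
  have hx : extend T N (∑ j : T, v j • e (j : Idx q)) = extend T N 0 := by
    rw [map_zero]
    refine ext_co fun i => ?_
    simp only [map_sum, map_smul, map_zero, smul_eq_mul]
    by_cases hi : i ∈ T
    · have := congrFun hv0 ⟨i, hi⟩
      rw [Matrix.mulVec, dotProduct] at this
      refine Eq.trans ?_ this
      exact Finset.sum_congr rfl fun j _ => by rw [← co_extend T N ⟨i, hi⟩ j, mul_comm]
    · refine Finset.sum_eq_zero fun j _ => ?_
      rw [mem_Vs.1 ((suppIn_extend T N).2 j j.2) i hi, mul_zero]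
  have h0 := h hx
  funext k
  have := congrArg (co (k : Idx q)) h0
  rw [map_sum, Finset.sum_eq_single k] at this
  · simpa using this
  · intro j _ hj
    rw [map_smul, co_e_ne fun h => hj (Subtype.ext h).symm, smul_zero]
  · simp

theorem toLin_stage (T : Finset (Idx q)) (M : Matrix.SpecialLinearGroup T ℝ) :
    toLin (stage T M) = extend T (M : Matrix T T ℝ) := rfl

theorem stage_mul (T : Finset (Idx q)) (M N : Matrix.SpecialLinearGroup T ℝ) :
    stage T (M * N) = stage T M * stage T N :=
  Subtype.ext (map_mul (stageHom T) M N)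

theorem stage_one (T : Finset (Idx q)) : stage T 1 = 1 := Subtype.ext (map_one (stageHom T))

theorem stage_inv (T : Finset (Idx q)) (M : Matrix.SpecialLinearGroup T ℝ) :
    stage T M⁻¹ = (stage T M)⁻¹ := Subtype.ext (map_inv (stageHom T) M)

/-- The inclusion of the matrices of size `T` in those of size `T'`. -/
def raiseMat {T T' : Finset (Idx q)} (M : Matrix T T ℝ) : Matrix T' T' ℝ :=
  Matrix.of fun i j => if h : (i : Idx q) ∈ T ∧ (j : Idx q) ∈ T then M ⟨i, h.1⟩ ⟨j, h.2⟩ else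
    if i = j then 1 else 0

/-- Sorting the indices by membership in T makes the larger matrix block triangular with diagonal
blocks M and 1. -/
theorem det_raiseMat {T T' : Finset (Idx q)} (hT : T ⊆ T') (M : Matrix T T ℝ) :
    (raiseMat M : Matrix T' T' ℝ).det = M.det := by
  rw [Matrix.twoBlockTriangular_det _ fun i : T' => (i : Idx q) ∈ T]
  · have h2 : (raiseMat M : Matrix T' T' ℝ).toSquareBlockProp
        (fun i : T' => ¬ (i : Idx q) ∈ T) = 1 := by
      ext ⟨i, hi⟩ ⟨j, hj⟩
      simp [Matrix.toSquareBlockProp, raiseMat, hi, Matrix.one_apply]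
    rw [h2, Matrix.det_one, mul_one]
    let φ : T ≃ {i : T' // (i : Idx q) ∈ T} :=
      { toFun := fun i => ⟨⟨i, hT i.2⟩, i.2⟩
        invFun := fun i => ⟨i.1, i.2⟩
        left_inv := fun _ => rfl
        right_inv := fun _ => rfl }
    rw [← Matrix.det_submatrix_equiv_self φ]
    congr 1
    ext i j
    simp [Matrix.toSquareBlockProp, raiseMat, φ]
  · intro i hi j hj
    have hij : i ≠ j := fun h => hi (h ▸ hj)
    simp [raiseMat, hi, hij]

/-- The inclusion of `SL(T; ℝ)` in `SL(T'; ℝ)` for `T ⊆ T'`. -/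
def raise {T T' : Finset (Idx q)} (hT : T ⊆ T') (M : Matrix.SpecialLinearGroup T ℝ) :
    Matrix.SpecialLinearGroup T' ℝ :=
  ⟨raiseMat (M : Matrix T T ℝ), (det_raiseMat hT _).trans M.2⟩

theorem raise_apply {T T' : Finset (Idx q)} (hT : T ⊆ T') (M : Matrix.SpecialLinearGroup T ℝ)
    (i j : T') : (raise hT M : Matrix T' T' ℝ) i j =
      if h : (i : Idx q) ∈ T ∧ (j : Idx q) ∈ T then (M : Matrix T T ℝ) ⟨i, h.1⟩ ⟨j, h.2⟩ else
        if i = j then 1 else 0 := rfl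

theorem extend_raiseMat {T T' : Finset (Idx q)} (hT : T ⊆ T') (M : Matrix T T ℝ) :
    extend T' (raiseMat M) = extend T M := by
  rw [← extend_matOf ((suppIn_extend T M).mono (Finset.coe_subset.2 hT))]
  congr 1
  ext i j
  simp only [matOf, Matrix.of_apply, raiseMat]
  split_ifs with h hij
  · exact (co_extend T M ⟨i, h.1⟩ ⟨j, h.2⟩).symm
  · subst hij
    rw [(suppIn_extend T M).1 _ fun hi => h ⟨hi, hi⟩]
    simp
  · have hij' : (i : Idx q) ≠ j := fun h => hij (Subtype.ext h)
    by_cases hj : (j : Idx q) ∈ T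
    · rw [mem_Vs.1 ((suppIn_extend T M).2 _ hj) i fun hi => h ⟨hi, hj⟩]
    · rw [(suppIn_extend T M).1 _ hj, co_e_ne hij']

theorem stage_raise {T T' : Finset (Idx q)} (hT : T ⊆ T') (M : Matrix.SpecialLinearGroup T ℝ) :
    stage T' (raise hT M) = stage T M :=
  Subtype.ext (Units.ext (extend_raiseMat hT (M : Matrix T T ℝ)))

/-- The images of SL(T) and SL(T') both lie in that of SL(T ∪ T'), so the supremum of subgroups is a
union. -/
theorem exists_stage (g : SL q) : ∃ T M, g = stage T M := by
  have hdir : Directed (· ≤ ·) fun T : Finset (Idx q) => (stageHom T).range := by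
    intro T T'
    refine ⟨T ∪ T', ?_, ?_⟩
    · rintro _ ⟨M, rfl⟩
      exact ⟨raise Finset.subset_union_left M,
        congrArg Subtype.val (stage_raise Finset.subset_union_left M)⟩
    · rintro _ ⟨M, rfl⟩
      exact ⟨raise Finset.subset_union_right M,
        congrArg Subtype.val (stage_raise Finset.subset_union_right M)⟩
  obtain ⟨T, M, hM⟩ := (Subgroup.mem_iSup_of_directed hdir).1 g.2
  exact ⟨T, M, Subtype.ext hM.symm⟩

theorem exists_stage_of_superset (g : SL q) :
    ∃ T : Finset (Idx q), ∀ T', T ⊆ T' → ∃ M, g = stage T' M := by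
  obtain ⟨T, M, rfl⟩ := exists_stage g
  exact ⟨T, fun T' hT => ⟨raise hT M, (stage_raise hT M).symm⟩⟩

theorem suppIn_stage (T : Finset (Idx q)) (M : Matrix.SpecialLinearGroup T ℝ) :
    SuppIn (T : Set (Idx q)) (toLin (stage T M)) := suppIn_extend T _

theorem SuppIn.inv {T : Set (Idx q)} {g : SL q} (h : SuppIn T (toLin g)) :
    SuppIn T (toLin g⁻¹) := by
  refine ⟨fun j hj => ?_, fun j hj => mem_Vs.2 fun i hi => ?_⟩
  · conv_lhs => rw [← h.1 j hj]
    simp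
  · rw [← h.co_eq hi, toLin_apply_inv]
    exact mem_Vs.1 (e_mem_Vs.2 hj) i hi

theorem exists_suppIn (g : SL q) : ∃ T : Finset (Idx q), SuppIn (T : Set (Idx q)) (toLin g) := by
  obtain ⟨T, M, rfl⟩ := exists_stage g
  exact ⟨T, suppIn_stage T M⟩

/-! ### The direct limit topology -/

theorem continuous_stage (T : Finset (Idx q)) : Continuous (stage T) :=
  continuous_iff_coinduced_le.2
    (le_iSup (fun T : Finset (Idx q) => TopologicalSpace.coinduced (stage T) inferInstance) T)

theorem continuous_SL_of_stage {Z : Type*} [TopologicalSpace Z] {f : SL q → Z}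
    (h : ∀ T, Continuous fun M => f (stage T M)) : Continuous f :=
  continuous_iSup_dom.2 fun T => continuous_coinduced_dom.2 (h T)

theorem continuousOn_SL_iff {Z : Type*} [TopologicalSpace Z] {T : Finset (Idx q)} {w : Set Z}
    {f : Z → Matrix.SpecialLinearGroup T ℝ} :
    ContinuousOn f w ↔ ∀ i j, ContinuousOn (fun z => (f z : Matrix T T ℝ) i j) w := by
  have h : ContinuousOn f w ↔ ContinuousOn (fun z => (f z : Matrix T T ℝ)) w :=
    Topology.IsInducing.continuousOn_iff
      (⟨rfl⟩ : Topology.IsInducing (Subtype.val : Matrix.SpecialLinearGroup T ℝ → Matrix T T ℝ))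
  exact h.trans (continuousOn_pi.trans (forall_congr' fun i => continuousOn_pi))

theorem continuous_raise {T T' : Finset (Idx q)} (hT : T ⊆ T') : Continuous (raise hT) := by
  rw [← continuousOn_univ, continuousOn_SL_iff]
  intro i j
  rw [continuousOn_univ]
  by_cases h : (i : Idx q) ∈ T ∧ (j : Idx q) ∈ T
  · simp only [raise_apply, dif_pos h]
    exact (continuous_apply _).comp ((continuous_apply _).comp continuous_subtype_val)
  · simp only [raise_apply, dif_neg h]
    exact continuous_const

/-- In a stage large enough to contain g, this is multiplication by a fixed matrix. Left
translations suffice below; joint continuity of the multiplication of G never enters. -/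
theorem continuous_mul_left_SL (g : SL q) : Continuous fun h : SL q => g * h := by
  obtain ⟨T₀, hT₀⟩ := exists_stage_of_superset g
  refine continuous_SL_of_stage fun T => ?_
  obtain ⟨N, rfl⟩ := hT₀ (T₀ ∪ T) Finset.subset_union_left
  simp only [← stage_raise (Finset.subset_union_right : T ⊆ T₀ ∪ T), ← stage_mul]
  exact (continuous_stage _).comp (continuous_const.mul (continuous_raise _))

/-! ### Identity components -/

/-- The identity component of a set of elements. -/
def idComp (H : Set (SL q)) : Set (SL q) := connectedComponentIn H 1

theorem idComp_subset (H : Set (SL q)) : idComp H ⊆ H := connectedComponentIn_subset _ _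

/-- A set of elements that is a subgroup. -/
def IsSub (H : Set (SL q)) : Prop :=
  1 ∈ H ∧ (∀ g ∈ H, g⁻¹ ∈ H) ∧ ∀ g ∈ H, ∀ h ∈ H, g * h ∈ H

theorem one_mem_idComp {H : Set (SL q)} (hH : IsSub H) : 1 ∈ idComp H :=
  mem_connectedComponentIn hH.1

/-- Left translation by g⁻¹ carries the component to a connected subset of H that contains g⁻¹g = 1.
Closure under inverses and products both follow from this one property. -/
theorem inv_mul_mem_idComp {H : Set (SL q)} (hH : IsSub H) {g h : SL q} (hg : g ∈ idComp H)
    (hh : h ∈ idComp H) : g⁻¹ * h ∈ idComp H := by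
  have hpre : IsPreconnected ((fun x => g⁻¹ * x) '' idComp H) :=
    isPreconnected_connectedComponentIn.image _ (continuous_mul_left_SL g⁻¹).continuousOn
  refine hpre.subset_connectedComponentIn ⟨g, hg, inv_mul_cancel g⟩ ?_ ⟨h, hh, rfl⟩
  rintro _ ⟨x, hx, rfl⟩
  exact hH.2.2 _ (hH.2.1 _ (idComp_subset H hg)) _ (idComp_subset H hx)

theorem isSub_idComp {H : Set (SL q)} (hH : IsSub H) : IsSub (idComp H) := by
  have hinv : ∀ g ∈ idComp H, g⁻¹ ∈ idComp H := fun g hg => by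
    simpa using inv_mul_mem_idComp hH hg (one_mem_idComp hH)
  refine ⟨one_mem_idComp hH, hinv, fun g hg h hh => ?_⟩
  simpa using inv_mul_mem_idComp hH (hinv g hg) hh

theorem mem_idComp_of_path {H : Set (SL q)} {T : Finset (Idx q)}
    {γ : ℝ → Matrix.SpecialLinearGroup T ℝ} (hγ : Continuous γ) (h0 : γ 0 = 1)
    (hH : ∀ t, stage T (γ t) ∈ H) (t : ℝ) : stage T (γ t) ∈ idComp H := by
  have hpre : IsPreconnected (Set.range fun t => stage T (γ t)) :=
    isPreconnected_range ((continuous_stage T).comp hγ)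
  refine hpre.subset_connectedComponentIn ⟨0, ?_⟩ ?_ ⟨t, rfl⟩
  · simp only [h0, stage_one]
  · rintro _ ⟨t, rfl⟩
    exact hH t

theorem isIsometry_iff {g : SL q} : IsIsometry g ↔ ∀ x y, B (toLin g x) (toLin g y) = B x y := by
  simp only [IsIsometry, form_eq]

theorem isSub_isometry : IsSub {g : SL q | IsIsometry g} := by
  refine ⟨fun _ _ => rfl, fun g hg x y => ?_, fun g hg h hh x y => ?_⟩
  · rw [← hg, toLin_apply_inv, toLin_apply_inv]
  · rw [toLin_mul_apply, toLin_mul_apply, hg, hh]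

theorem isSub_isometry_fix : IsSub {g : SL q | IsIsometry g ∧
    translate g (Vplus q) = Vplus q ∧ translate g (Vminus q) = Vminus q} := by
  refine ⟨⟨isSub_isometry.1, translate_one _, translate_one _⟩, ?_, ?_⟩
  · rintro g ⟨h1, h2, h3⟩
    refine ⟨isSub_isometry.2.1 g h1, ?_, ?_⟩
    · conv_lhs => rw [← h2]
      simp
    · conv_lhs => rw [← h3]
      simp
  · rintro g ⟨h1, h2, h3⟩ h ⟨k1, k2, k3⟩
    exact ⟨isSub_isometry.2.2 g h1 h k1, by rw [translate_mul, k2, h2],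
      by rw [translate_mul, k3, h3]⟩

theorem isSub_SO : IsSub (SO q) := isSub_idComp isSub_isometry

theorem isSub_K : IsSub (K q) := isSub_idComp isSub_isometry_fix

theorem K_subset_SO : K q ⊆ SO q := connectedComponentIn_mono 1 fun _ h => h.1

theorem SO_isometry {g : SL q} (hg : g ∈ SO q) (x y : V q) :
    B (toLin g x) (toLin g y) = B x y :=
  isIsometry_iff.1 (idComp_subset _ hg) x y

theorem K_fix {g : SL q} (hg : g ∈ K q) {c : ℝ} (hc : c = 1 ∨ c = -1) :
    translate g (Vs (ID c)) = Vs (ID c) := by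
  have h := idComp_subset _ hg
  rcases hc with rfl | rfl
  · rw [← Vplus_eq]; exact h.2.1
  · rw [← Vminus_eq]; exact h.2.2

/-! ### Invertible matrices and elements of `G` -/

theorem det_rescale {T : Finset (Idx q)} (i₀ : T) {N : Matrix T T ℝ} (h : N.det ≠ 0) :
    (N.updateCol i₀ ((N.det)⁻¹ • fun i => N i i₀)).det = 1 := by
  have : (N.updateCol i₀ fun i => N i i₀) = N := Matrix.updateCol_eq_self N i₀
  rw [Matrix.det_updateCol_smul, this, inv_mul_cancel₀ h]

open Classical in
/-- Rescale one column of an invertible matrix such that the determinant becomes `1`. -/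
def normalize {T : Finset (Idx q)} (i₀ : T) (N : Matrix T T ℝ) : Matrix.SpecialLinearGroup T ℝ :=
  if h : N.det ≠ 0 then ⟨N.updateCol i₀ ((N.det)⁻¹ • fun i => N i i₀), det_rescale i₀ h⟩ else 1

theorem normalize_eq {T : Finset (Idx q)} (i₀ : T) {N : Matrix T T ℝ} (h : N.det ≠ 0) :
    normalize i₀ N = ⟨N.updateCol i₀ ((N.det)⁻¹ • fun i => N i i₀), det_rescale i₀ h⟩ :=
  dif_pos h

theorem normalize_apply {T : Finset (Idx q)} (i₀ : T) {N : Matrix T T ℝ} (h : N.det ≠ 0)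
    (i j : T) : (normalize i₀ N : Matrix T T ℝ) i j =
      if j = i₀ then (N.det)⁻¹ * N i i₀ else N i j := by
  have h' : (normalize i₀ N : Matrix T T ℝ) = N.updateCol i₀ ((N.det)⁻¹ • fun i => N i i₀) :=
    congrArg Subtype.val (normalize_eq i₀ h)
  rw [h', Matrix.updateCol_apply]
  rfl

theorem normalize_of_det_eq_one {T : Finset (Idx q)} (i₀ : T)
    (M : Matrix.SpecialLinearGroup T ℝ) : normalize i₀ (M : Matrix T T ℝ) = M := by
  have h : (M : Matrix T T ℝ).det = 1 := M.2
  ext i j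
  rw [normalize_apply i₀ (by rw [h]; exact one_ne_zero), h]
  split_ifs with hj
  · rw [hj, inv_one, one_mul]
  · rfl

theorem toLin_normalize_e {T : Finset (Idx q)} (i₀ : T) {N : Matrix T T ℝ} (h : N.det ≠ 0)
    (j : Idx q) : ∃ c : ℝ, c ≠ 0 ∧
      toLin (stage T (normalize i₀ N)) (e j) = c • extend T N (e j) := by
  by_cases hj : j ∈ T
  · rw [toLin_stage, extend_apply_mem _ _ hj, extend_apply_mem _ _ hj]
    simp only [normalize_apply i₀ h]
    by_cases hj' : (⟨j, hj⟩ : T) = i₀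
    · refine ⟨(N.det)⁻¹, inv_ne_zero h, ?_⟩
      simp only [Finset.smul_sum, smul_smul, hj', if_true]
    · exact ⟨1, one_ne_zero, by simp only [if_neg hj', one_smul]⟩
  · exact ⟨1, one_ne_zero, by
      rw [toLin_stage, (suppIn_extend T _).1 j hj, (suppIn_extend T N).1 j hj, one_smul]⟩

/-- Normalizing only multiplies the images of basis vectors by nonzero scalars, which does not
affect their spans. So the determinant condition costs nothing as long as only coordinate subspaces
are moved. -/
theorem translate_normalize {T : Finset (Idx q)} (i₀ : T) {N : Matrix T T ℝ} (h : N.det ≠ 0)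
    (s : Set (Idx q)) :
    translate (stage T (normalize i₀ N)) (Vs s) = (Vs s).map (extend T N) := by
  apply le_antisymm
  · rw [translate, Submodule.map_le_iff_le_comap, Vs_le]
    intro j hj
    obtain ⟨c, -, hc'⟩ := toLin_normalize_e i₀ h j
    rw [Submodule.mem_comap, hc']
    exact Submodule.smul_mem _ _ ⟨_, e_mem_Vs.2 hj, rfl⟩
  · rw [Submodule.map_le_iff_le_comap, Vs_le]
    intro j hj
    obtain ⟨c, hc, hc'⟩ := toLin_normalize_e i₀ h j
    refine ⟨c⁻¹ • e j, Submodule.smul_mem _ _ (e_mem_Vs.2 hj), ?_⟩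
    rw [map_smul, hc', smul_smul, inv_mul_cancel₀ hc, one_smul]

theorem exists_SL_of_injective {T : Finset (Idx q)} {f : V q →ₗ[ℝ] V q}
    (hf : SuppIn (T : Set (Idx q)) f) (hinj : Function.Injective f) :
    ∃ g : SL q, ∀ s, translate g (Vs s) = (Vs s).map f := by
  -- An index is added so that there is a column to rescale even when T is empty.
  have hf' : SuppIn ((insert (Sum.inl 0) T : Finset (Idx q)) : Set (Idx q)) f :=
    hf.mono (by simp)
  rw [← extend_matOf hf'] at hinj
  have hdet := det_ne_zero_of_injective hinj
  refine ⟨stage _ (normalize ⟨Sum.inl 0, Finset.mem_insert_self _ T⟩ (matOf _ f)), fun s => ?_⟩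
  rw [translate_normalize _ hdet, extend_matOf hf']

/-! ### Continuity and smoothness of determinants, normalization and stage inclusions. -/

theorem continuousOn_det {Z : Type*} [TopologicalSpace Z] {T : Finset (Idx q)} {w : Set Z}
    {N : Z → Matrix T T ℝ} (hN : ∀ i j, ContinuousOn (fun z => N z i j) w) :
    ContinuousOn (fun z => (N z).det) w := by
  simp only [Matrix.det_apply']
  exact continuousOn_finsetSum _ fun σ _ => continuousOn_const.mul
    (continuousOn_finsetProd _ fun i _ => hN _ _)

theorem continuousOn_normalize {Z : Type*} [TopologicalSpace Z] {T : Finset (Idx q)} (i₀ : T)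
    {w : Set Z} {N : Z → Matrix T T ℝ} (hN : ∀ i j, ContinuousOn (fun z => N z i j) w)
    (hd : ∀ z ∈ w, (N z).det ≠ 0) : ContinuousOn (fun z => normalize i₀ (N z)) w := by
  rw [continuousOn_SL_iff]
  intro i j
  have : Set.EqOn (fun z => (normalize i₀ (N z) : Matrix T T ℝ) i j)
      (fun z => if j = i₀ then ((N z).det)⁻¹ * N z i i₀ else N z i j) w :=
    fun z hz => normalize_apply i₀ (hd z hz) i j
  refine ContinuousOn.congr ?_ this
  by_cases hj : j = i₀
  · simp only [if_pos hj]
    exact ((continuousOn_det hN).inv₀ hd).mul (hN _ _)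
  · simp only [if_neg hj]
    exact hN _ _

theorem contDiffOn_det {n : ℕ} {T : Finset (Idx q)} {w : Set (EuclideanSpace ℝ (Fin n))}
    {N : EuclideanSpace ℝ (Fin n) → Matrix T T ℝ}
    (hN : ∀ i j, ContDiffOn ℝ ∞ (fun z => N z i j) w) :
    ContDiffOn ℝ ∞ (fun z => (N z).det) w := by
  simp only [Matrix.det_apply']
  exact ContDiffOn.sum fun σ _ => contDiffOn_const.mul
    (contDiffOn_prod fun i _ => hN _ _)

theorem contDiffOn_normalize {n : ℕ} {T : Finset (Idx q)} (i₀ : T)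
    {w : Set (EuclideanSpace ℝ (Fin n))} {N : EuclideanSpace ℝ (Fin n) → Matrix T T ℝ}
    (hN : ∀ i j, ContDiffOn ℝ ∞ (fun z => N z i j) w) (hd : ∀ z ∈ w, (N z).det ≠ 0) (i j : T) :
    ContDiffOn ℝ ∞ (fun z => (normalize i₀ (N z) : Matrix T T ℝ) i j) w := by
  have : ∀ z ∈ w, (normalize i₀ (N z) : Matrix T T ℝ) i j =
      if j = i₀ then ((N z).det)⁻¹ * N z i i₀ else N z i j :=
    fun z hz => normalize_apply i₀ (hd z hz) i j
  refine ContDiffOn.congr ?_ this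
  by_cases hj : j = i₀
  · simp only [if_pos hj]
    exact ((contDiffOn_det hN).inv hd).mul (hN _ _)
  · simp only [if_neg hj]
    exact hN _ _

theorem contDiffOn_raise {n : ℕ} {T T' : Finset (Idx q)} (hT : T ⊆ T')
    {w : Set (EuclideanSpace ℝ (Fin n))}
    {M : EuclideanSpace ℝ (Fin n) → Matrix.SpecialLinearGroup T ℝ}
    (hM : ∀ i j, ContDiffOn ℝ ∞ (fun z => (M z : Matrix T T ℝ) i j) w) (i j : T') :
    ContDiffOn ℝ ∞ (fun z => (raise hT (M z) : Matrix T' T' ℝ) i j) w := by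
  simp only [raise_apply]
  split_ifs with h
  · exact hM _ _
  · exact contDiffOn_const
  · exact contDiffOn_const

/-! ### Adjoints and orthogonal complements -/

/-- The adjoint matrix with respect to the form. -/
def adj {T : Finset (Idx q)} (N : Matrix T T ℝ) : Matrix T T ℝ :=
  Matrix.of fun i j => sgn (i : Idx q) * sgn (j : Idx q) * N j i

/-- The adjoint is D Nᵀ D for the diagonal matrix D of signs, and D² = 1. -/
theorem det_adj {T : Finset (Idx q)} (N : Matrix T T ℝ) : (adj N).det = N.det := by
  have h : adj N = Matrix.diagonal (fun i : T => sgn (i : Idx q)) * N.transpose *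
      Matrix.diagonal (fun i : T => sgn (i : Idx q)) := by
    ext i j
    simp only [adj, Matrix.of_apply, Matrix.mul_diagonal, Matrix.diagonal_mul,
      Matrix.transpose_apply]
    ring
  have h1 : (Matrix.diagonal fun i : T => sgn (i : Idx q)).det *
      (Matrix.diagonal fun i : T => sgn (i : Idx q)).det = 1 := by
    rw [← Matrix.det_mul, Matrix.diagonal_mul_diagonal]
    simp only [sgn_mul_self, Matrix.diagonal_one, Matrix.det_one]
  rw [h, Matrix.det_mul, Matrix.det_mul, Matrix.det_transpose]
  linear_combination N.det * h1

theorem B_extend (T : Finset (Idx q)) (N : Matrix T T ℝ) (x y : V q) :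
    B (extend T N x) y = B x (extend T (adj N) y) := by
  have : B.comp (extend T N) = (B.flip.comp (extend T (adj N))).flip := by
    refine hom_ext fun i => hom_ext fun j => ?_
    simp only [LinearMap.comp_apply, LinearMap.flip_apply]
    rw [B_e_left, B_e_right]
    by_cases hi : i ∈ T
    · by_cases hj : j ∈ T
      · rw [co_extend T N ⟨j, hj⟩ ⟨i, hi⟩, co_extend T (adj N) ⟨i, hi⟩ ⟨j, hj⟩]
        simp only [adj, Matrix.of_apply]
        linear_combination (-sgn j * N ⟨j, hj⟩ ⟨i, hi⟩) * sgn_mul_self i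
      · rw [(suppIn_extend T (adj N)).1 j hj, mem_Vs.1 ((suppIn_extend T N).2 i hi) j hj,
          co_e_ne fun h : i = j => hj (h ▸ hi)]
        ring
    · rw [(suppIn_extend T N).1 i hi]
      by_cases hj : j ∈ T
      · rw [mem_Vs.1 ((suppIn_extend T (adj N)).2 j hj) i hi, co_e_ne fun h : j = i => hi (h ▸ hj)]
        ring
      · rw [(suppIn_extend T (adj N)).1 j hj, co_e, co_e]
        by_cases hij : i = j
        · simp [hij]
        · simp [hij, Ne.symm hij]
  exact LinearMap.congr_fun (LinearMap.congr_fun this x) y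

/-- The adjoint with respect to the form. -/
def adjSL {T : Finset (Idx q)} (M : Matrix.SpecialLinearGroup T ℝ) :
    Matrix.SpecialLinearGroup T ℝ :=
  ⟨adj (M : Matrix T T ℝ), (det_adj _).trans M.2⟩

/-- The inverse of the adjoint. -/
def coadj {T : Finset (Idx q)} (M : Matrix.SpecialLinearGroup T ℝ) :
    Matrix.SpecialLinearGroup T ℝ := (adjSL M)⁻¹

/-- Since the determinant is 1, the inverse is the adjugate; its entries are polynomial in those of
M, which is the source of the smoothness of W ↦ W⊥. -/
theorem coadj_apply {T : Finset (Idx q)} (M : Matrix.SpecialLinearGroup T ℝ) (i j : T) :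
    (coadj M : Matrix T T ℝ) i j =
      ((adj (M : Matrix T T ℝ)).updateRow j (Pi.single i 1)).det := by
  have h : (coadj M : Matrix T T ℝ) = (adj (M : Matrix T T ℝ)).adjugate :=
    Matrix.SpecialLinearGroup.coe_inv _
  rw [h, Matrix.adjugate_apply]

/-- B(Mx, (M*)⁻¹y) = B(x, M*(M*)⁻¹y). Consequently (M*)⁻¹ carries W⊥ to (MW)⊥. -/
theorem B_stage_coadj {T : Finset (Idx q)} (M : Matrix.SpecialLinearGroup T ℝ) (x y : V q) :
    B (toLin (stage T M) x) (toLin (stage T (coadj M)) y) = B x y := by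
  rw [toLin_stage, B_extend]
  have : extend T (adj (M : Matrix T T ℝ)) = toLin (stage T (coadj M))⁻¹ := by
    rw [coadj, stage_inv, inv_inv]; rfl
  rw [this, toLin_inv_apply]

theorem contDiffOn_coadj {n : ℕ} {T : Finset (Idx q)} {w : Set (EuclideanSpace ℝ (Fin n))}
    {M : EuclideanSpace ℝ (Fin n) → Matrix.SpecialLinearGroup T ℝ}
    (hM : ∀ i j, ContDiffOn ℝ ∞ (fun z => (M z : Matrix T T ℝ) i j) w) (i j : T) :
    ContDiffOn ℝ ∞ (fun z => (coadj (M z) : Matrix T T ℝ) i j) w := by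
  simp only [coadj_apply]
  refine contDiffOn_det fun k l => ?_
  simp only [Matrix.updateRow_apply]
  split_ifs
  · exact contDiffOn_const
  · exact contDiffOn_const.mul (hM _ _)

/-- The orthogonal complement. -/
def perp (W : Submodule ℝ (V q)) : Submodule ℝ (V q) where
  carrier := {x | ∀ y ∈ W, B y x = 0}
  add_mem' ha hb y hy := by rw [map_add, ha y hy, hb y hy, add_zero]
  zero_mem' y _ := map_zero _
  smul_mem' c x hx y hy := by rw [map_smul, hx y hy, smul_zero]

theorem mem_perp {W : Submodule ℝ (V q)} {x : V q} : x ∈ perp W ↔ ∀ y ∈ W, B y x = 0 := Iff.rfl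

theorem perp_Vs (s : Set (Idx q)) : perp (Vs s) = Vs sᶜ := by
  ext x
  rw [mem_perp, mem_Vs]
  constructor
  · intro h i hi
    have := h (e i) (e_mem_Vs.2 (not_not.1 hi))
    rw [B_e_left] at this
    exact (mul_eq_zero.1 this).resolve_left (sgn_ne_zero i)
  · intro h y hy
    exact B_eq_zero_of_disjoint disjoint_compl_right hy (mem_Vs.2 h)

theorem perp_translate {g g' : SL q} (h : ∀ x y, B (toLin g x) (toLin g' y) = B x y)
    (W : Submodule ℝ (V q)) : perp (translate g W) = translate g' (perp W) := by
  ext x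
  rw [mem_translate, mem_perp, mem_perp]
  constructor
  · intro hx y hy
    rw [← h, toLin_apply_inv]
    exact hx _ (apply_mem_translate.2 hy)
  · intro hx y hy
    have := hx _ (mem_translate.1 hy)
    rwa [← h, toLin_apply_inv, toLin_apply_inv] at this

/-! ### Gluing two maps along complementary coordinate subspaces -/

open Classical in
/-- The endomorphism that is `f` on the span of the `eᵢ`, `i ∈ s`, and `f'` on the span of the
others. -/
def mix (s : Set (Idx q)) (f f' : V q →ₗ[ℝ] V q) : V q →ₗ[ℝ] V q :=
  (E q).constr ℝ fun i => if i ∈ s then f (e i) else f' (e i)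

open Classical in
theorem mix_e (s : Set (Idx q)) (f f' : V q →ₗ[ℝ] V q) (i : Idx q) :
    mix s f f' (e i) = if i ∈ s then f (e i) else f' (e i) := (E q).constr_basis ℝ _ i

theorem mix_eq_left {s : Set (Idx q)} (f f' : V q →ₗ[ℝ] V q) {x : V q} (hx : x ∈ Vs s) :
    mix s f f' x = f x := by
  have : Vs s ≤ LinearMap.ker (mix s f f' - f) := Vs_le.2 fun i hi => by simp [mix_e, hi]
  simpa [sub_eq_zero] using this hx

theorem mix_eq_right {s : Set (Idx q)} (f f' : V q →ₗ[ℝ] V q) {x : V q} (hx : x ∈ Vs sᶜ) :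
    mix s f f' x = f' x := by
  have : Vs sᶜ ≤ LinearMap.ker (mix s f f' - f') := Vs_le.2 fun i hi => by
    have hi' : i ∉ s := hi
    simp [mix_e, hi']
  simpa [sub_eq_zero] using this hx

theorem map_mix_left {s t : Set (Idx q)} (f f' : V q →ₗ[ℝ] V q) (h : t ⊆ s) :
    (Vs t).map (mix s f f') = (Vs t).map f := by
  ext x
  constructor <;> rintro ⟨y, hy, rfl⟩
  · exact ⟨y, hy, (mix_eq_left f f' (Vs_mono h hy)).symm⟩
  · exact ⟨y, hy, mix_eq_left f f' (Vs_mono h hy)⟩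

theorem map_mix_right {s t : Set (Idx q)} (f f' : V q →ₗ[ℝ] V q) (h : t ⊆ sᶜ) :
    (Vs t).map (mix s f f') = (Vs t).map f' := by
  ext x
  constructor <;> rintro ⟨y, hy, rfl⟩
  · exact ⟨y, hy, (mix_eq_right f f' (Vs_mono h hy)).symm⟩
  · exact ⟨y, hy, mix_eq_right f f' (Vs_mono h hy)⟩

theorem SuppIn.mix {T : Set (Idx q)} (s : Set (Idx q)) {f f' : V q →ₗ[ℝ] V q} (hf : SuppIn T f)
    (hf' : SuppIn T f') : SuppIn T (mix s f f') := by
  refine ⟨fun j hj => ?_, fun j hj => ?_⟩ <;> rw [mix_e] <;> split_ifs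
  exacts [hf.1 j hj, hf'.1 j hj, hf.2 j hj, hf'.2 j hj]

theorem exists_add_of_compl (s : Set (Idx q)) (x : V q) :
    ∃ y ∈ Vs s, ∃ z ∈ Vs sᶜ, y + z = x :=
  Submodule.mem_sup.1 (Vs_sup_compl s ▸ Submodule.mem_top)

theorem mix_injective {s : Set (Idx q)} {f f' : V q →ₗ[ℝ] V q} (hf : Function.Injective f)
    (hf' : Function.Injective f') (h : (Vs s).map f ⊓ (Vs sᶜ).map f' = ⊥) :
    Function.Injective (mix s f f') := by
  rw [injective_iff_map_eq_zero]
  intro x hx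
  obtain ⟨y, hy, z, hz, rfl⟩ := exists_add_of_compl s x
  rw [map_add, mix_eq_left f f' hy, mix_eq_right f f' hz] at hx
  have h1 : f y = 0 := by
    rw [← Submodule.mem_bot ℝ, ← h]
    refine ⟨⟨y, hy, rfl⟩, ⟨-z, Submodule.neg_mem _ hz, ?_⟩⟩
    rw [map_neg]; exact (eq_neg_of_add_eq_zero_left hx).symm
  rw [h1, zero_add] at hx
  rw [(injective_iff_map_eq_zero f).1 hf y h1, (injective_iff_map_eq_zero f').1 hf' z hx, add_zero]

theorem exists_suppIn₂ (g g' : SL q) : ∃ T : Finset (Idx q),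
    SuppIn (T : Set (Idx q)) (toLin g) ∧ SuppIn (T : Set (Idx q)) (toLin g') := by
  obtain ⟨T, hT⟩ := exists_suppIn g
  obtain ⟨T', hT'⟩ := exists_suppIn g'
  exact ⟨T ∪ T', hT.mono (by simp), hT'.mono (by simp)⟩

/-- Glue g on the span of s and g' on the complementary span. The trivial intersection makes the
glued map injective, and normalization puts it in G. -/
theorem exists_translate_pair {g g' : SL q} {s : Set (Idx q)}
    (h : translate g (Vs s) ⊓ translate g' (Vs sᶜ) = ⊥) :
    ∃ k : SL q, translate k (Vs s) = translate g (Vs s) ∧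
      translate k (Vs sᶜ) = translate g' (Vs sᶜ) := by
  obtain ⟨T, hT, hT'⟩ := exists_suppIn₂ g g'
  obtain ⟨k, hk⟩ := exists_SL_of_injective (hT.mix s hT')
    (mix_injective (toLin_injective g) (toLin_injective g') h)
  exact ⟨k, by rw [hk, map_mix_left _ _ subset_rfl]; rfl,
    by rw [hk, map_mix_right _ _ subset_rfl]; rfl⟩

/-- The dimension count is absorbed in the glued element k of G: it is surjective and carries the
two coordinate spans to the two summands. -/
theorem sup_eq_top_of_inf_eq_bot {g g' : SL q} {s : Set (Idx q)}
    (h : translate g (Vs s) ⊓ translate g' (Vs sᶜ) = ⊥) :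
    translate g (Vs s) ⊔ translate g' (Vs sᶜ) = ⊤ := by
  obtain ⟨k, hk, hk'⟩ := exists_translate_pair h
  rw [← hk, ← hk', ← translate_sup, Vs_sup_compl, translate, Submodule.map_top,
    LinearMap.range_eq_top]
  exact fun x => ⟨toLin k⁻¹ x, toLin_apply_inv k x⟩

/-! ### Definite translates -/

theorem CDef.inf_eq_bot {c : ℝ} {W W' : Submodule ℝ (V q)} (h : CDef c W) (h' : CDef (-c) W') :
    W ⊓ W' = ⊥ := by
  rw [Submodule.eq_bot_iff]
  rintro x ⟨hx, hx'⟩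
  refine h.eq_zero hx ?_
  have := h'.nonneg hx'
  linarith

theorem cdef_Vs_compl {c : ℝ} (hc : c = 1 ∨ c = -1) : CDef (-c) (Vs (ID c : Set (Idx q))ᶜ) := by
  rw [ID_compl hc]
  exact cdef_Vs (by rcases hc with rfl | rfl <;> simp)

theorem CDef.exists_add {c : ℝ} (hc : c = 1 ∨ c = -1) {g : SL q}
    (h : CDef c (translate g (Vs (ID c)))) (x : V q) :
    ∃ w ∈ translate g (Vs (ID c)), ∃ v ∈ Vs (ID c : Set (Idx q))ᶜ, w + v = x := by
  have h1 : translate g (Vs (ID c)) ⊓ translate 1 (Vs (ID c)ᶜ) = ⊥ := by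
    rw [translate_one]; exact h.inf_eq_bot (cdef_Vs_compl hc)
  have h2 := sup_eq_top_of_inf_eq_bot h1
  rw [translate_one] at h2
  exact Submodule.mem_sup.1 (h2 ▸ Submodule.mem_top)

/-- Decompose x = w + v with w in the definite translate and v in the standard subspace of opposite
sign. As B(w, x) = 0, one gets cB(v, v) = cB(x, x) + cB(w, w). The left side is at most 0, so cB(x,
x) ≥ 0 would force w = v = 0. -/
theorem CDef.perp {c : ℝ} (hc : c = 1 ∨ c = -1) {g : SL q}
    (h : CDef c (translate g (Vs (ID c)))) : CDef (-c) (perp (translate g (Vs (ID c)))) := by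
  intro x hx hx0
  by_contra hcon
  obtain ⟨w, hw, v, hv, rfl⟩ := h.exists_add hc x
  have h1 : B w (w + v) = 0 := hx w hw
  have h2 : c * B v v = c * B (w + v) (w + v) + c * B w w := by
    simp only [map_add, LinearMap.add_apply] at h1 ⊢
    rw [B_comm v w]
    linear_combination (-2 * c) * h1
  have h3 := h.nonneg hw
  have h4 := (cdef_Vs_compl hc).nonneg hv
  have h5 : w = 0 := h.eq_zero hw (by linarith)
  have h6 : v = 0 := (cdef_Vs_compl hc).eq_zero hv (by linarith)
  exact hx0 (by rw [h5, h6, add_zero])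

/-- The translate already has the opposite coordinate subspace as a complement, and a definite
subspace meets that one trivially. So nothing can be added. -/
theorem CDef.maximal {c : ℝ} (hc : c = 1 ∨ c = -1) {g : SL q}
    (h : CDef c (translate g (Vs (ID c)))) : Maximal (CDef c) (translate g (Vs (ID c))) := by
  refine ⟨h, fun W hW hle x hx => ?_⟩
  obtain ⟨w, hw, v, hv, rfl⟩ := h.exists_add hc x
  have hvW : v ∈ W := by simpa using Submodule.sub_mem _ hx (hle hw)
  have : v ∈ W ⊓ Vs (ID c)ᶜ := ⟨hvW, hv⟩
  rw [hW.inf_eq_bot (cdef_Vs_compl hc), Submodule.mem_bot] at this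
  rw [this, add_zero]; exact hw

/-! ### Subspaces that are standard outside a finite part -/

instance finiteDimensional_Vs (T : Finset (Idx q)) :
    FiniteDimensional ℝ (Vs (T : Set (Idx q))) :=
  FiniteDimensional.span_of_finite ℝ (T.finite_toSet.image _)

theorem finiteDimensional_of_le {T : Finset (Idx q)} {A : Submodule ℝ (V q)}
    (h : A ≤ Vs (T : Set (Idx q))) : FiniteDimensional ℝ A :=
  Submodule.finiteDimensional_of_le h

theorem finrank_Vs (T : Finset (Idx q)) : finrank ℝ (Vs (T : Set (Idx q))) = T.card := by
  have h : LinearIndependent ℝ fun i : T => e (q := q) (i : Idx q) :=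
    (E q).linearIndependent.comp _ Subtype.val_injective
  have := finrank_span_eq_card h
  rw [Fintype.card_coe] at this
  have himg : e '' (T : Set (Idx q)) = Set.range fun i : T => e (q := q) (i : Idx q) := by
    ext x; simp
  rw [← this, Vs, himg]

theorem finrank_Vs_ncard {s : Set (Idx q)} (hs : s.Finite) : finrank ℝ (Vs s) = s.ncard := by
  lift s to Finset (Idx q) using hs
  rw [finrank_Vs, Set.ncard_coe_finset]

theorem exists_le_Vs (U : Submodule ℝ (V q)) [FiniteDimensional ℝ U] :
    ∃ T : Finset (Idx q), U ≤ Vs (T : Set (Idx q)) := by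
  obtain ⟨S, hS⟩ := (Submodule.fg_iff_finiteDimensional U).2 ‹_›
  choose T hT using fun x : V q => exists_finset_mem x
  classical
  refine ⟨S.biUnion T, ?_⟩
  rw [← hS, Submodule.span_le]
  intro x hx
  refine Vs_mono ?_ (hT x)
  exact Finset.coe_subset.2 (Finset.subset_biUnion_of_mem T hx)

/-- `F` is the sum of its part in the span of the `eᵢ`, `i ∈ T`, and of the span of the `eᵢ`,
`i ∈ s`, `i ∉ T`. -/
def Adapted (T : Set (Idx q)) (s : Set (Idx q)) (F : Submodule ℝ (V q)) : Prop :=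
  F = (F ⊓ Vs T) ⊔ Vs (s \ T)

theorem sup_inf_Vs {T s : Set (Idx q)} {A : Submodule ℝ (V q)} (hA : A ≤ Vs T) :
    (A ⊔ Vs (s \ T)) ⊓ Vs T = A := by
  rw [sup_inf_assoc_of_le _ hA, ← Vs_inter, Set.sdiff_inter_self, Vs_empty, sup_bot_eq]

theorem adapted_sup {T s : Set (Idx q)} {A : Submodule ℝ (V q)} (hA : A ≤ Vs T) :
    Adapted T s (A ⊔ Vs (s \ T)) := by
  rw [Adapted, sup_inf_Vs hA]

theorem SuppIn.translate_Vs {T : Set (Idx q)} {g : SL q} (h : SuppIn T (toLin g)) :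
    translate g (Vs T) = Vs T := by
  apply le_antisymm
  · rintro _ ⟨x, hx, rfl⟩
    exact h.map_mem hx
  · intro x hx
    exact ⟨_, h.inv.map_mem hx, toLin_apply_inv g x⟩

theorem SuppIn.translate_eq {T t : Set (Idx q)} {g : SL q} (h : SuppIn T (toLin g))
    (ht : Disjoint t T) : translate g (Vs t) = Vs t := by
  have h1 : ∀ x ∈ Vs t, toLin g x = x := fun x hx =>
    h.map_eq (Vs_mono (Set.subset_compl_iff_disjoint_right.2 ht) hx)
  ext x
  constructor
  · rintro ⟨y, hy, rfl⟩
    rw [h1 y hy]; exact hy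
  · intro hx
    exact ⟨x, hx, h1 x hx⟩

theorem SuppIn.translate_sup {T s : Set (Idx q)} {g : SL q} (h : SuppIn T (toLin g))
    (A : Submodule ℝ (V q)) : translate g (A ⊔ Vs (s \ T)) = translate g A ⊔ Vs (s \ T) := by
  rw [RealCycle.translate_sup, h.translate_eq Set.disjoint_sdiff_left]

theorem Vs_eq_sup (s T : Set (Idx q)) : Vs s = Vs (s ∩ T) ⊔ Vs (s \ T) := by
  rw [← Vs_union, Set.inter_union_sdiff]

theorem SuppIn.translate_Vs_eq {T : Set (Idx q)} {g : SL q} (h : SuppIn T (toLin g))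
    (s : Set (Idx q)) :
    translate g (Vs s) = translate g (Vs (s ∩ T)) ⊔ Vs (s \ T) := by
  rw [← h.translate_sup, ← Vs_eq_sup]

theorem SuppIn.translate_le {T : Set (Idx q)} {g : SL q} (h : SuppIn T (toLin g))
    {A : Submodule ℝ (V q)} (hA : A ≤ Vs T) : translate g A ≤ Vs T :=
  (translate_mono hA).trans h.translate_Vs.le

theorem SuppIn.adapted {T : Set (Idx q)} {g : SL q} (h : SuppIn T (toLin g))
    (s : Set (Idx q)) : Adapted T s (translate g (Vs s)) := by
  rw [h.translate_Vs_eq]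
  exact adapted_sup (h.translate_le (Vs_mono Set.inter_subset_right))

theorem SuppIn.translate_inf {T : Set (Idx q)} {g : SL q} (h : SuppIn T (toLin g))
    (s : Set (Idx q)) : translate g (Vs s) ⊓ Vs T = translate g (Vs (s ∩ T)) := by
  rw [h.translate_Vs_eq, sup_inf_Vs (h.translate_le (Vs_mono Set.inter_subset_right))]

theorem exists_map_eq {A A' : Submodule ℝ (V q)} [FiniteDimensional ℝ A]
    [FiniteDimensional ℝ A'] (h : finrank ℝ A = finrank ℝ A') :
    ∃ f : V q →ₗ[ℝ] V q, (∀ x ∈ A, f x = 0 → x = 0) ∧ A.map f = A' := by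
  let φ : A ≃ₗ[ℝ] A' := LinearEquiv.ofFinrankEq _ _ h
  obtain ⟨f, hf⟩ := LinearMap.exists_extend (A'.subtype ∘ₗ φ.toLinearMap)
  have hf' : ∀ x : A, f x = φ x := fun x => LinearMap.congr_fun hf x
  refine ⟨f, fun x hx h0 => ?_, ?_⟩
  · have h1 : ((φ ⟨x, hx⟩ : A') : V q) = 0 := by rw [← hf']; exact h0
    have h2 : φ ⟨x, hx⟩ = 0 := Subtype.ext h1
    exact congrArg Subtype.val ((LinearEquiv.map_eq_zero_iff φ).1 h2)
  · ext y
    constructor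
    · rintro ⟨x, hx, rfl⟩
      rw [hf' ⟨x, hx⟩]
      exact (φ ⟨x, hx⟩).2
    · intro hy
      exact ⟨φ.symm ⟨y, hy⟩, (φ.symm ⟨y, hy⟩).2, by simp [hf']⟩

/-- Choose a complement C of A inside the span of T. By dimension, the spans of s ∩ T and T \ s can
be mapped isomorphically to A and C; with the identity outside T this gives an injective map
supported in T. -/
theorem exists_translate_eq {T : Finset (Idx q)} {s : Set (Idx q)} {A : Submodule ℝ (V q)}
    (hA : A ≤ Vs (T : Set (Idx q))) (hd : finrank ℝ A = (s ∩ T).ncard) :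
    ∃ g : SL q, A ⊔ Vs (s \ T) = translate g (Vs s) := by
  obtain ⟨C₀, hC₀⟩ := Submodule.exists_isCompl A
  set C := C₀ ⊓ Vs (T : Set (Idx q)) with hC
  have hsup : A ⊔ C = Vs (T : Set (Idx q)) := by
    rw [hC, ← sup_inf_assoc_of_le _ hA, hC₀.sup_eq_top, top_inf_eq]
  have hinf : A ⊓ C = ⊥ := by
    rw [hC, ← inf_assoc, hC₀.inf_eq_bot, bot_inf_eq]
  have hCT : C ≤ Vs (T : Set (Idx q)) := inf_le_right
  have := finiteDimensional_of_le hA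
  have := finiteDimensional_of_le hCT
  have hfin1 : (s ∩ T).Finite := T.finite_toSet.subset Set.inter_subset_right
  have hfin2 : ((T : Set (Idx q)) \ s).Finite := T.finite_toSet.subset Set.sdiff_subset
  have : FiniteDimensional ℝ (Vs (s ∩ T)) := finiteDimensional_of_le (Vs_mono Set.inter_subset_right)
  have : FiniteDimensional ℝ (Vs ((T : Set (Idx q)) \ s)) :=
    finiteDimensional_of_le (Vs_mono Set.sdiff_subset)
  have hCd : finrank ℝ C = ((T : Set (Idx q)) \ s).ncard := by
    have h1 := Submodule.finrank_sup_add_finrank_inf_eq A C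
    rw [hsup, hinf, finrank_bot, finrank_Vs, hd] at h1
    have h2 := Set.ncard_inter_add_ncard_sdiff_eq_ncard (T : Set (Idx q)) s T.finite_toSet
    rw [Set.inter_comm, Set.ncard_coe_finset] at h2
    omega
  obtain ⟨f₁, hf₁, hm₁⟩ := exists_map_eq (A := Vs (s ∩ T)) (A' := A)
    (by rw [finrank_Vs_ncard hfin1, hd])
  obtain ⟨f₂, hf₂, hm₂⟩ := exists_map_eq (A := Vs ((T : Set (Idx q)) \ s)) (A' := C)
    (by rw [finrank_Vs_ncard hfin2, hCd])
  set f := mix (T : Set (Idx q)) (mix s f₁ f₂) LinearMap.id with hf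
  have hfa : ∀ x ∈ Vs (s ∩ T), f x = f₁ x := fun x hx => by
    rw [hf, mix_eq_left _ _ (Vs_mono Set.inter_subset_right hx),
      mix_eq_left _ _ (Vs_mono Set.inter_subset_left hx)]
  have hfb : ∀ x ∈ Vs ((T : Set (Idx q)) \ s), f x = f₂ x := fun x hx => by
    rw [hf, mix_eq_left _ _ (Vs_mono Set.sdiff_subset hx),
      mix_eq_right _ _ (Vs_mono (fun i hi => hi.2) hx)]
  have hfc : ∀ x ∈ Vs (T : Set (Idx q))ᶜ, f x = x := fun x hx => by
    rw [hf, mix_eq_right _ _ hx]; rfl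
  have hfaA : ∀ x ∈ Vs (s ∩ T), f x ∈ A := fun x hx => by
    rw [hfa x hx, ← hm₁]; exact ⟨x, hx, rfl⟩
  have hfbC : ∀ x ∈ Vs ((T : Set (Idx q)) \ s), f x ∈ C := fun x hx => by
    rw [hfb x hx, ← hm₂]; exact ⟨x, hx, rfl⟩
  have hsupp : SuppIn (T : Set (Idx q)) f := by
    refine ⟨fun j hj => hfc _ (e_mem_Vs.2 hj), fun j hj => ?_⟩
    by_cases hjs : j ∈ s
    · exact hA (hfaA _ (e_mem_Vs.2 ⟨hjs, hj⟩))
    · exact hCT (hfbC _ (e_mem_Vs.2 ⟨hj, hjs⟩))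
  have hinj : Function.Injective f := by
    rw [injective_iff_map_eq_zero]
    intro x hx
    obtain ⟨y, hy, z, hz, rfl⟩ := exists_add_of_compl (T : Set (Idx q)) x
    have hz0 : z ∈ Vs (T : Set (Idx q)) ⊓ Vs (T : Set (Idx q))ᶜ := by
      refine ⟨?_, hz⟩
      rw [map_add, hfc z hz] at hx
      have h1 := hsupp.map_mem hy
      rw [eq_neg_of_add_eq_zero_left hx] at h1
      simpa using h1
    rw [← Vs_inter, Set.inter_compl_self, Vs_empty, Submodule.mem_bot] at hz0
    subst hz0
    rw [add_zero] at hx ⊢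
    rw [Vs_eq_sup _ s, Set.inter_comm] at hy
    obtain ⟨a, ha, b, hb, rfl⟩ := Submodule.mem_sup.1 hy
    rw [map_add] at hx
    have h1 : f a ∈ A ⊓ C := by
      refine ⟨hfaA a ha, ?_⟩
      rw [eq_neg_of_add_eq_zero_left hx]
      exact Submodule.neg_mem _ (hfbC b hb)
    rw [hinf, Submodule.mem_bot] at h1
    rw [h1, zero_add, hfb b hb] at hx
    rw [hfa a ha] at h1
    rw [hf₁ a ha h1, hf₂ b hb hx, add_zero]
  obtain ⟨g, hg⟩ := exists_SL_of_injective hsupp hinj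
  refine ⟨g, ?_⟩
  have h1 : (Vs (s ∩ T)).map f = A := by
    rw [← hm₁]
    ext y
    constructor <;> rintro ⟨x, hx, rfl⟩
    · exact ⟨x, hx, (hfa x hx).symm⟩
    · exact ⟨x, hx, hfa x hx⟩
  have h2 : (Vs (s \ T)).map f = Vs (s \ T) := by
    have h3 : ∀ x ∈ Vs (s \ T), f x = x := fun x hx => hfc x (Vs_mono (fun i hi => hi.2) hx)
    ext y
    constructor
    · rintro ⟨x, hx, rfl⟩
      rw [h3 x hx]; exact hx
    · exact fun hy => ⟨y, hy, h3 y hy⟩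
  rw [hg, Vs_eq_sup s T, Submodule.map_sup, h1, h2]

theorem SuppIn.finrank_eq {T : Finset (Idx q)} {g : SL q}
    (h : SuppIn (T : Set (Idx q)) (toLin g)) (s : Set (Idx q)) :
    finrank ℝ ↥(translate g (Vs s) ⊓ Vs (T : Set (Idx q))) = (s ∩ T).ncard := by
  rw [h.translate_inf, finrank_translate,
    finrank_Vs_ncard (T.finite_toSet.subset Set.inter_subset_right)]

theorem Adapted.exists_translate_eq {T : Finset (Idx q)} {s : Set (Idx q)}
    {F : Submodule ℝ (V q)} (h : Adapted T s F)
    (hd : finrank ℝ ↥(F ⊓ Vs (T : Set (Idx q))) = (s ∩ T).ncard) :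
    ∃ g : SL q, F = translate g (Vs s) := by
  obtain ⟨g, hg⟩ := RealCycle.exists_translate_eq inf_le_right hd
  exact ⟨g, h.trans hg⟩

/-! ### Weakly compatible subspaces -/

theorem mem_of_mem_span {L S : Set (V q)} (hL : LinearIndepOn ℝ id L) (hS : S ⊆ L) {x : V q}
    (hx : x ∈ L) (h : x ∈ Submodule.span ℝ S) : x ∈ S :=
  (LinearIndepOn.mem_span_iff_id (hL.mono hS)).1 h (hL.mono (Set.insert_subset hx hS))

theorem exists_finset_span {L : Set (V q)} (hspan : Submodule.span ℝ L = ⊤) (S : Finset (V q)) :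
    ∃ L' : Finset (V q), (L' : Set (V q)) ⊆ L ∧ (S : Set (V q)) ⊆ Submodule.span ℝ (L' : Set (V q)) := by
  classical
  have h : ∀ x : V q, ∃ L' : Finset (V q), (L' : Set (V q)) ⊆ L ∧
      x ∈ Submodule.span ℝ (L' : Set (V q)) := fun x =>
    Submodule.mem_span_finite_of_mem_span (hspan ▸ Submodule.mem_top)
  choose φ hφ hφ' using h
  refine ⟨S.biUnion φ, ?_, fun x hx => ?_⟩
  · intro x hx
    obtain ⟨y, -, hy⟩ := Finset.mem_biUnion.1 (Finset.mem_coe.1 hx)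
    exact hφ y hy
  · exact Submodule.span_mono (Finset.coe_subset.2 (Finset.subset_biUnion_of_mem φ hx)) (hφ' x)

/-- The basis L adapted to F differs from E by finitely many vectors in both directions. T collects
the supports of these, of U, and of the finitely many elements of L that span U; outside T,
membership of a basis vector in F is then decided by s. -/
theorem WeaklyCompatible.adapted {F U : Submodule ℝ (V q)} {s : Set (Idx q)}
    [FiniteDimensional ℝ U] (hF : WeaklyCompatible F) (h1 : F ≤ Vs s ⊔ U) (h2 : Vs s ≤ F ⊔ U) :
    ∃ T : Finset (Idx q), Adapted T s F ∧ U ≤ Vs (T : Set (Idx q)) := by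
  classical
  obtain ⟨L, hL, hspan, hfin, S, hSL, rfl⟩ := hF
  obtain ⟨T₁, hT₁⟩ := exists_le_Vs U
  obtain ⟨P, hPL, hP⟩ := exists_finset_span hspan hfin.toFinset
  -- The subset (L ∩ E) ∪ P of L spans the whole space, because P spans the missing members of E. By
  -- independence it is all of L, so L \ E is finite.
  have hLE : L ⊆ Set.range e ∪ P := by
    have := eq_of_linearIndepOn_id_of_span_subtype hL
      (Set.union_subset (Set.inter_subset_left (t := Set.range e)) hPL) ?_
    · rw [this]
      exact Set.union_subset_union_left _ Set.inter_subset_right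
    · have htop : Submodule.span ℝ (L ∩ Set.range e ∪ P) = ⊤ := by
        rw [eq_top_iff, ← Vs_univ, Vs_le]
        intro i _
        by_cases hi : e i ∈ L
        · exact Submodule.subset_span (Or.inl ⟨hi, i, rfl⟩)
        · refine Submodule.span_mono Set.subset_union_right (hP ?_)
          rw [Finset.mem_coe, Set.Finite.mem_toFinset]
          exact ⟨⟨i, rfl⟩, hi⟩
      rw [htop]
      exact fun _ _ => Submodule.mem_top
  obtain ⟨S₁, hS₁⟩ := (Submodule.fg_iff_finiteDimensional U).2 ‹_›
  obtain ⟨Q, hQL, hQ⟩ := exists_finset_span hspan S₁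
  have hUQ : U ≤ Submodule.span ℝ (Q : Set (V q)) := by
    rw [← hS₁, Submodule.span_le]; exact hQ
  choose supp hsupp using fun x : V q => exists_finset_mem x
  let T : Finset (Idx q) := T₁ ∪ P.biUnion supp ∪ Q.biUnion supp ∪ hfin.toFinset.biUnion supp
  have hmemT : ∀ x : V q, x ∈ P ∨ x ∈ Q ∨ x ∈ hfin.toFinset → x ∈ Vs (T : Set (Idx q)) := by
    intro x hx
    refine Vs_mono (Finset.coe_subset.2 ?_) (hsupp x)
    intro i hi
    simp only [T, Finset.mem_union, Finset.mem_biUnion]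
    rcases hx with hx | hx | hx
    exacts [Or.inl (Or.inl (Or.inr ⟨x, hx, hi⟩)), Or.inl (Or.inr ⟨x, hx, hi⟩), Or.inr ⟨x, hx, hi⟩]
  have hUT : U ≤ Vs (T : Set (Idx q)) :=
    hT₁.trans (Vs_mono (Finset.coe_subset.2 fun i hi => by simp [T, hi]))
  refine ⟨T, le_antisymm ?_ (sup_le inf_le_left (Vs_le.2 ?_)), hUT⟩
  · rw [Submodule.span_le]
    intro x hx
    have hxF := Submodule.subset_span (R := ℝ) hx
    by_cases hxT : x ∈ Vs (T : Set (Idx q))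
    · exact Submodule.mem_sup_left ⟨hxF, hxT⟩
    · rcases hLE (hSL hx) with ⟨i, rfl⟩ | hxP
      · refine Submodule.mem_sup_right (e_mem_Vs.2 ⟨?_, fun hi => hxT (e_mem_Vs.2 hi)⟩)
        have h3 : e i ∈ Vs (s ∪ T) := by
          rw [Vs_union]
          exact (sup_le_sup_left hUT _) (h1 hxF)
        exact (e_mem_Vs.1 h3).resolve_right fun hi => hxT (e_mem_Vs.2 hi)
      · exact absurd (hmemT x (Or.inl hxP)) hxT
  · rintro i ⟨his, hiT⟩
    have hiT' : e i ∉ Vs (T : Set (Idx q)) := fun h => hiT (e_mem_Vs.1 h)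
    have hiL : e i ∈ L := by
      by_contra hi
      exact hiT' (hmemT _ (Or.inr (Or.inr (by
        rw [Set.Finite.mem_toFinset]; exact ⟨⟨i, rfl⟩, hi⟩))))
    -- By independence of L, a member of L in the span of S ∪ Q belongs to S or to Q; members of Q
    -- are supported in T, which excludes eᵢ.
    have h3 : e i ∈ Submodule.span ℝ (S ∪ Q) := by
      rw [Submodule.span_union]
      exact (sup_le_sup_left hUQ _) (h2 (e_mem_Vs.2 his))
    rcases mem_of_mem_span hL (Set.union_subset hSL hQL) hiL h3 with h4 | h4
    · exact Submodule.subset_span h4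
    · exact absurd (hmemT _ (Or.inr (Or.inl h4))) hiT'

/-- The image of E under g is a basis, and it contains every eᵢ with i outside the support of g. -/
theorem weaklyCompatible_translate (g : SL q) (s : Set (Idx q)) :
    WeaklyCompatible (translate g (Vs s)) := by
  obtain ⟨T, hT⟩ := exists_suppIn g
  have hli : LinearIndependent ℝ fun i => toLin g (e i) :=
    (E q).linearIndependent.map' _ (LinearMap.ker_eq_bot.2 (toLin_injective g))
  refine ⟨Set.range fun i => toLin g (e i), hli.linearIndepOn_id, ?_, ?_,
    (fun i => toLin g (e i)) '' s, Set.image_subset_range _ _, ?_⟩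
  · rw [eq_top_iff]
    intro x _
    have h1 : x ∈ translate g ⊤ := mem_translate.2 Submodule.mem_top
    rw [← Vs_univ, translate, Vs, Submodule.map_span, ← Set.image_comp] at h1
    rw [Set.image_univ] at h1
    exact h1
  · refine (T.finite_toSet.image e).subset ?_
    rintro _ ⟨⟨i, rfl⟩, hi⟩
    by_contra hcon
    refine hi ⟨i, hT.1 i fun h => hcon ⟨i, h, rfl⟩⟩
  · rw [translate, Vs, Submodule.map_span, ← Set.image_comp]; rfl

theorem finiteCodimIn_of_le {A B U : Submodule ℝ (V q)} [FiniteDimensional ℝ U]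
    (h : A ≤ B ⊔ U) : FiniteCodimIn A B := by
  have hker : LinearMap.ker (B.mkQ ∘ₗ A.subtype) = (A ⊓ B).submoduleOf A := by
    ext x
    simp [Submodule.submoduleOf]
  have hr : LinearMap.range (B.mkQ ∘ₗ A.subtype) ≤ U.map B.mkQ := by
    rintro _ ⟨x, rfl⟩
    obtain ⟨b, hb, u, hu, hbu⟩ := Submodule.mem_sup.1 (h x.2)
    refine ⟨u, hu, ?_⟩
    have hb0 : B.mkQ b = 0 := (Submodule.Quotient.mk_eq_zero B).2 hb
    rw [LinearMap.comp_apply, Submodule.subtype_apply, ← hbu, map_add, hb0, zero_add]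
  have := Submodule.finiteDimensional_of_le hr
  rw [FiniteCodimIn, ← hker]
  exact (LinearMap.quotKerEquivRange _).symm.finiteDimensional

theorem FiniteCodimIn.exists_le {A B : Submodule ℝ (V q)} (h : FiniteCodimIn A B) :
    ∃ U : Submodule ℝ (V q), FiniteDimensional ℝ U ∧ A ≤ B ⊔ U := by
  obtain ⟨C, hC⟩ := Submodule.exists_isCompl ((A ⊓ B).submoduleOf A)
  have : FiniteDimensional ℝ (↥A ⧸ (A ⊓ B).submoduleOf A) := h
  have : FiniteDimensional ℝ C :=
    (Submodule.quotientEquivOfIsCompl _ _ hC).finiteDimensional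
  refine ⟨C.map A.subtype, inferInstance, fun x hx => ?_⟩
  have : (⟨x, hx⟩ : A) ∈ (A ⊓ B).submoduleOf A ⊔ C := by
    rw [hC.sup_eq_top]; exact Submodule.mem_top
  obtain ⟨y, hy, z, hz, hyz⟩ := Submodule.mem_sup.1 this
  have hy' : (y : V q) ∈ A ⊓ B := hy
  rw [← show (y : V q) + z = x from congrArg Subtype.val hyz]
  exact Submodule.add_mem_sup hy'.2 ⟨z, hz, rfl⟩

/-! ### The bounded symmetric domains -/

theorem finrank_le_of_inf_eq_bot {s : Set (Idx q)} {T : Finset (Idx q)}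
    {A : Submodule ℝ (V q)} (hA : A ≤ Vs (T : Set (Idx q))) (h : A ⊓ Vs sᶜ = ⊥) :
    finrank ℝ A ≤ (s ∩ (T : Set (Idx q))).ncard := by
  have h0 : Vs ((T : Set (Idx q)) \ s) ≤ Vs (T : Set (Idx q)) := Vs_mono Set.sdiff_subset
  have := finiteDimensional_of_le hA
  have := finiteDimensional_of_le h0
  have h1 := Submodule.finrank_sup_add_finrank_inf_eq A (Vs ((T : Set (Idx q)) \ s))
  have h2 : A ⊓ Vs ((T : Set (Idx q)) \ s) = ⊥ :=
    le_bot_iff.1 (h ▸ inf_le_inf_left _ (Vs_mono fun i hi => hi.2))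
  have h3 := Submodule.finrank_mono (sup_le hA h0)
  have h4 := Set.ncard_inter_add_ncard_sdiff_eq_ncard (T : Set (Idx q)) s T.finite_toSet
  rw [h2, finrank_bot, finrank_Vs_ncard (T.finite_toSet.subset Set.sdiff_subset)] at h1
  rw [finrank_Vs] at h3
  rw [Set.inter_comm, Set.ncard_coe_finset] at h4
  omega

/-- The map C → A* given by the form cannot be injective for dimension reasons. -/
theorem exists_orthogonal {A C : Submodule ℝ (V q)} [FiniteDimensional ℝ A]
    [FiniteDimensional ℝ C] (h : finrank ℝ A < finrank ℝ C) :
    ∃ x ∈ C, x ≠ 0 ∧ ∀ y ∈ A, B x y = 0 := by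
  let φ : C →ₗ[ℝ] Module.Dual ℝ A := A.subtype.dualMap ∘ₗ B ∘ₗ C.subtype
  have hφ : LinearMap.ker φ ≠ ⊥ := LinearMap.ker_ne_bot_of_finrank_lt (by
    rwa [Subspace.dual_finrank_eq])
  obtain ⟨x, hx, hx0⟩ := Submodule.exists_mem_ne_zero_of_ne_bot hφ
  exact ⟨x, x.2, fun h => hx0 (Subtype.ext h), fun y hy =>
    LinearMap.congr_fun (LinearMap.mem_ker.1 hx) ⟨y, hy⟩⟩

theorem CDef.sup_span {c : ℝ} {W : Submodule ℝ (V q)} (hW : CDef c W) {x : V q}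
    (hx : 0 < c * B x x) (hxW : ∀ w ∈ W, B x w = 0) : CDef c (W ⊔ Submodule.span ℝ {x}) := by
  intro y hy hy0
  obtain ⟨w, hw, z, hz, rfl⟩ := Submodule.mem_sup.1 hy
  obtain ⟨a, rfl⟩ := Submodule.mem_span_singleton.1 hz
  have h1 : c * B (w + a • x) (w + a • x) = c * B w w + a ^ 2 * (c * B x x) := by
    simp only [map_add, map_smul, LinearMap.add_apply, LinearMap.smul_apply, smul_eq_mul]
    rw [B_comm w x, hxW w hw]
    ring
  rw [h1]
  have h2 := hW.nonneg hw
  by_cases ha : a = 0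
  · have hw0 : w ≠ 0 := fun h => hy0 (by rw [h, ha]; simp)
    have := hW w hw hw0
    positivity
  · positivity

/-- The dimension cannot be larger, because W meets the coordinate subspace of opposite sign
trivially. If it were smaller, some vector of the right sign in the span of T would be orthogonal to
W inside T, hence to all of W, and could be adjoined to W. -/
theorem maximal_finrank_eq {c : ℝ} (hc : c = 1 ∨ c = -1) {W : Submodule ℝ (V q)}
    (hW : Maximal (CDef c) W) {T : Finset (Idx q)} (hT : Adapted T (ID c) W) :
    finrank ℝ ↥(W ⊓ Vs (T : Set (Idx q))) = (ID c ∩ (T : Set (Idx q))).ncard := by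
  have hfin : (ID c ∩ (T : Set (Idx q))).Finite := T.finite_toSet.subset Set.inter_subset_right
  have : FiniteDimensional ℝ ↥(W ⊓ Vs (T : Set (Idx q))) := finiteDimensional_of_le inf_le_right
  have : FiniteDimensional ℝ (Vs (ID c ∩ (T : Set (Idx q)))) :=
    finiteDimensional_of_le (Vs_mono Set.inter_subset_right)
  apply le_antisymm
  · refine finrank_le_of_inf_eq_bot inf_le_right ?_
    exact (hW.1.mono inf_le_left).inf_eq_bot (cdef_Vs_compl hc)
  · rw [← finrank_Vs_ncard hfin]
    by_contra! hlt
    obtain ⟨x, hx, hx0, hxW⟩ := exists_orthogonal hlt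
    have hpos : 0 < c * B x x := cdef_Vs hc x (Vs_mono Set.inter_subset_left hx) hx0
    have hxW' : ∀ w ∈ W, B x w = 0 := by
      intro w hw
      rw [hT] at hw
      obtain ⟨a, ha, b, hb, rfl⟩ := Submodule.mem_sup.1 hw
      rw [map_add, hxW a ha, zero_add]
      exact B_eq_zero_of_disjoint Set.disjoint_sdiff_right (Vs_mono Set.inter_subset_right hx) hb
    have hle := hW.2 (hW.1.sup_span hpos hxW') le_sup_left
    have hx' : x ∈ W := hle (Submodule.mem_sup_right (Submodule.mem_span_singleton_self x))
    rw [hxW' x hx', mul_zero] at hpos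
    exact lt_irrefl _ hpos

/-- The two finite codimension conditions supply the finite dimensional U needed to make W standard
outside a finite T; maximality fixes the dimension inside T. Treating both signs c = ±1 at once
gives both domains. -/
theorem domain_iff {c : ℝ} (hc : c = 1 ∨ c = -1) {W : Submodule ℝ (V q)} :
    (Maximal (CDef c) W ∧ WeaklyCompatible W ∧ FiniteCodimIn W (Vs (ID c)) ∧
      FiniteCodimIn (Vs (ID c)) W) ↔ (∃ g : SL q, W = translate g (Vs (ID c))) ∧ CDef c W := by
  constructor
  · rintro ⟨hmax, hwc, h1, h2⟩
    refine ⟨?_, hmax.1⟩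
    obtain ⟨U₁, _, hU₁⟩ := h1.exists_le
    obtain ⟨U₂, _, hU₂⟩ := h2.exists_le
    obtain ⟨T, hT, -⟩ := hwc.adapted (U := U₁ ⊔ U₂)
      (hU₁.trans (sup_le_sup_left le_sup_left _)) (hU₂.trans (sup_le_sup_left le_sup_right _))
    exact hT.exists_translate_eq (maximal_finrank_eq hc hmax hT)
  · rintro ⟨⟨g, rfl⟩, hW⟩
    obtain ⟨T, hT⟩ := exists_suppIn g
    refine ⟨hW.maximal hc, weaklyCompatible_translate g _, ?_, ?_⟩
    · refine finiteCodimIn_of_le (U := Vs (T : Set (Idx q))) ?_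
      rw [hT.translate_Vs_eq, sup_comm]
      exact sup_le_sup (Vs_mono Set.sdiff_subset) (hT.translate_le (Vs_mono Set.inter_subset_right))
    · refine finiteCodimIn_of_le (U := Vs (T : Set (Idx q))) ?_
      rw [hT.translate_Vs_eq, Vs_eq_sup (ID c) T, sup_comm]
      exact sup_le_sup le_sup_right (Vs_mono Set.inter_subset_right)

theorem mem_Bplus_iff {W : Submodule ℝ (V q)} :
    W ∈ Bplus q ↔ (∃ g : SL q, W = translate g (Vs (ID 1))) ∧ CDef 1 W := by
  rw [← domain_iff (Or.inl rfl), ← Vplus_eq, ← funext fun W => propext (posDef_iff (W := W))]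
  rfl

theorem mem_Bminus_iff {W : Submodule ℝ (V q)} :
    W ∈ Bminus q ↔ (∃ g : SL q, W = translate g (Vs (ID (-1)))) ∧ CDef (-1) W := by
  rw [← domain_iff (Or.inr rfl), ← Vminus_eq, ← funext fun W => propext (negDef_iff (W := W))]
  rfl

theorem Bplus_eq : Bplus q =
    {W | (∃ g : SL q, W = translate g (Vplus q)) ∧ PosDef W} := by
  ext W
  rw [mem_Bplus_iff, ← Vplus_eq, ← posDef_iff]; rfl

theorem Bminus_eq : Bminus q =
    {W | (∃ g : SL q, W = translate g (Vminus q)) ∧ NegDef W} := by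
  ext W
  rw [mem_Bminus_iff, ← Vminus_eq, ← negDef_iff]; rfl

/-- Every point of the Grassmann manifold is a translate of `(V₀)₋`. -/
theorem exists_translate_of_mem_Grass {F : Submodule ℝ (V q)} (hF : F ∈ Grass q) :
    ∃ g : SL q, F = translate g (Vs (ID (-1))) := by
  obtain ⟨hwc, -, U, _, h1, h2, h3⟩ := hF
  rw [Vminus_eq] at h1 h2 h3
  obtain ⟨T, hT, hU⟩ := hwc.adapted h1 h2
  refine hT.exists_translate_eq ?_
  have hsup : F ⊔ U = Vs (ID (-1)) ⊔ U :=
    le_antisymm (sup_le h1 le_sup_right) (sup_le h2 le_sup_right)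
  -- Modular law with U inside the span of T. F and V₋ have the same sum with U and intersections
  -- with U of equal dimension, so their parts inside T have equal dimension.
  have key : ∀ A : Submodule ℝ (V q), finrank ℝ ↥((A ⊔ U) ⊓ Vs (T : Set (Idx q))) +
      finrank ℝ ↥(A ⊓ U) = finrank ℝ ↥(A ⊓ Vs (T : Set (Idx q))) + finrank ℝ U := by
    intro A
    have := finiteDimensional_of_le (inf_le_right : A ⊓ Vs (T : Set (Idx q)) ≤ _)
    have h4 := Submodule.finrank_sup_add_finrank_inf_eq (A ⊓ Vs (T : Set (Idx q))) U
    rw [inf_assoc, inf_eq_right.2 hU] at h4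
    rw [← h4, sup_comm A, sup_inf_assoc_of_le _ hU, sup_comm]
  have h5 := key F
  have h6 := key (Vs (ID (-1)))
  rw [← Vs_inter, finrank_Vs_ncard (T.finite_toSet.subset Set.inter_subset_right)] at h6
  rw [hsup, h3] at h5
  omega

/-! ### Rotations and boosts in coordinate planes -/

/-- The entries of a map of the plane spanned by `eᵢ` and `eⱼ`. -/
def planeEntry (i : Idx q) (a b c d : ℝ) (k l : Idx q) : ℝ :=
  if k = i then (if l = i then a else b) else if l = i then c else d

theorem det_plane {i j : Idx q} (hij : i ≠ j) (a b c d : ℝ) :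
    (Matrix.of fun k l : ({i, j} : Finset (Idx q)) => planeEntry i a b c d k l).det =
      a * d - b * c := by
  let φ : Fin 2 → ({i, j} : Finset (Idx q)) := ![⟨i, by simp⟩, ⟨j, by simp⟩]
  have hφ : Function.Bijective φ := by
    constructor
    · intro k l hkl
      fin_cases k <;> fin_cases l <;> simp_all [φ]
    · rintro ⟨k, hk⟩
      rcases Finset.mem_insert.1 hk with rfl | hk'
      · exact ⟨0, rfl⟩
      · exact ⟨1, Subtype.ext (Finset.mem_singleton.1 hk').symm⟩
  rw [← Matrix.det_submatrix_equiv_self (Equiv.ofBijective φ hφ), Matrix.det_fin_two]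
  simp [φ, planeEntry, hij.symm]

/-- The element of `G` that acts on the plane spanned by `eᵢ` and `eⱼ` by a matrix of determinant
one. -/
def planeSL {i j : Idx q} (hij : i ≠ j) (a b c d : ℝ) (h : a * d - b * c = 1) :
    Matrix.SpecialLinearGroup ({i, j} : Finset (Idx q)) ℝ :=
  ⟨Matrix.of fun k l => planeEntry i a b c d k l, (det_plane hij a b c d).trans h⟩

theorem plane_fst {i j : Idx q} (hij : i ≠ j) {a b c d : ℝ} (h : a * d - b * c = 1) :
    toLin (stage _ (planeSL hij a b c d h)) (e i) = a • e i + c • e j := by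
  rw [toLin_stage, extend_apply_mem _ _ (Finset.mem_insert_self i {j})]
  change ∑ k : ({i, j} : Finset (Idx q)), planeEntry i a b c d k i • e (k : Idx q) = _
  rw [Finset.sum_coe_sort ({i, j} : Finset (Idx q)) fun k => planeEntry i a b c d k i • e k,
    Finset.sum_pair hij]
  simp [planeEntry, hij.symm]

theorem plane_snd {i j : Idx q} (hij : i ≠ j) {a b c d : ℝ} (h : a * d - b * c = 1) :
    toLin (stage _ (planeSL hij a b c d h)) (e j) = b • e i + d • e j := by
  rw [toLin_stage, extend_apply_mem _ _ (Finset.mem_insert_of_mem (Finset.mem_singleton_self j))]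
  change ∑ k : ({i, j} : Finset (Idx q)), planeEntry i a b c d k j • e (k : Idx q) = _
  rw [Finset.sum_coe_sort ({i, j} : Finset (Idx q)) fun k => planeEntry i a b c d k j • e k,
    Finset.sum_pair hij]
  simp [planeEntry, hij.symm]

theorem suppIn_plane {i j : Idx q} (hij : i ≠ j) {a b c d : ℝ} (h : a * d - b * c = 1) :
    SuppIn {i, j} (toLin (stage _ (planeSL hij a b c d h))) := by
  have := suppIn_stage _ (planeSL hij a b c d h)
  rwa [Finset.coe_pair] at this

/-- The three equations say that the images of eᵢ and eⱼ have the Gram matrix of eᵢ and eⱼ. -/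
theorem plane_isometry {i j : Idx q} (hij : i ≠ j) {a b c d : ℝ} (h : a * d - b * c = 1)
    (h1 : sgn i * a ^ 2 + sgn j * c ^ 2 = sgn i) (h2 : sgn i * b ^ 2 + sgn j * d ^ 2 = sgn j)
    (h3 : sgn i * a * b + sgn j * c * d = 0) :
    IsIsometry (stage _ (planeSL hij a b c d h)) := by
  rw [isIsometry_iff]
  set f := toLin (stage _ (planeSL hij a b c d h)) with hf
  have hfi : f (e i) = a • e i + c • e j := plane_fst hij h
  have hfj : f (e j) = b • e i + d • e j := plane_snd hij h
  have hfk : ∀ k, k ≠ i → k ≠ j → f (e k) = e k := fun k hi hj =>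
    (suppIn_plane hij h).1 k (by simp [hi, hj])
  have key : B.compl₁₂ f f = B := by
    refine hom_ext fun k => hom_ext fun l => ?_
    rw [LinearMap.compl₁₂_apply]
    have hji := hij.symm
    by_cases hki : k = i
    · subst hki
      by_cases hli : l = k
      · subst hli
        rw [hfi]; simp [B_e_left, co_e, hij, hji]; linear_combination h1
      by_cases hlj : l = j
      · subst hlj
        rw [hfi, hfj]; simp [B_e_left, co_e, hij, hji]; linear_combination h3
      · rw [hfi, hfk l hli hlj]; simp [B_e_left, co_e, Ne.symm hli, Ne.symm hlj]
    by_cases hkj : k = j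
    · subst hkj
      by_cases hli : l = i
      · subst hli
        rw [hfi, hfj]; simp [B_e_left, co_e, hij, hji]; linear_combination h3
      by_cases hlj : l = k
      · subst hlj
        rw [hfj]; simp [B_e_left, co_e, hij, hji]; linear_combination h2
      · rw [hfj, hfk l hli hlj]; simp [B_e_left, co_e, Ne.symm hli, Ne.symm hlj]
    · rw [hfk k hki hkj]
      by_cases hli : l = i
      · subst hli
        rw [hfi]; simp [B_e_left, co_e, hki, hkj]
      by_cases hlj : l = j
      · subst hlj
        rw [hfj]; simp [B_e_left, co_e, hki, hkj]
      · rw [hfk l hli hlj]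
  exact fun x y => LinearMap.congr_fun (LinearMap.congr_fun key x) y

theorem continuous_plane {i j : Idx q} (hij : i ≠ j) {a b c d : ℝ → ℝ}
    (h : ∀ t, a t * d t - b t * c t = 1) (ha : Continuous a) (hb : Continuous b)
    (hc : Continuous c) (hd : Continuous d) :
    Continuous fun t => planeSL hij (a t) (b t) (c t) (d t) (h t) := by
  rw [← continuousOn_univ, continuousOn_SL_iff]
  intro k l
  rw [continuousOn_univ]
  change Continuous fun t => planeEntry i (a t) (b t) (c t) (d t) k l
  simp only [planeEntry]
  split_ifs <;> assumption

theorem plane_one {i j : Idx q} (hij : i ≠ j) (h : (1 : ℝ) * 1 - 0 * 0 = 1) :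
    planeSL hij 1 0 0 1 h = 1 := by
  ext ⟨k, hk⟩ ⟨l, hl⟩
  change planeEntry i 1 0 0 1 k l = _
  rw [Matrix.SpecialLinearGroup.coe_one, Matrix.one_apply]
  simp only [Finset.mem_insert, Finset.mem_singleton] at hk hl
  rcases hk with rfl | rfl <;> rcases hl with rfl | rfl <;> simp [planeEntry, hij, hij.symm]

/-- Letting the angle run from 0 to θ gives a path from 1 among the isometries that preserve both
summands, so the rotation lies in the identity component. -/
theorem exists_rotation {i j : Idx q} (hij : i ≠ j) (hs : sgn i = sgn j) (θ : ℝ) :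
    ∃ h ∈ K q, SuppIn {i, j} (toLin h) ∧
      toLin h (e i) = Real.cos θ • e i + Real.sin θ • e j ∧
      toLin h (e j) = -Real.sin θ • e i + Real.cos θ • e j := by
  have hd : ∀ t, Real.cos t * Real.cos t - -Real.sin t * Real.sin t = 1 := fun t => by
    linear_combination Real.sin_sq_add_cos_sq t
  refine ⟨stage _ (planeSL hij _ _ _ _ (hd θ)), ?_, suppIn_plane hij _, plane_fst hij _,
    plane_snd hij _⟩
  refine mem_idComp_of_path (continuous_plane hij hd Real.continuous_cos Real.continuous_sin.neg
    Real.continuous_sin Real.continuous_cos) ?_ (fun t => ?_) θ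
  · rw [← plane_one hij (by norm_num)]
    congr 1 <;> simp
  refine ⟨?_, ?_⟩
  · apply plane_isometry
    · linear_combination sgn i * Real.sin_sq_add_cos_sq t -
        Real.sin t ^ 2 * hs
    · linear_combination sgn j * Real.sin_sq_add_cos_sq t + Real.sin t ^ 2 * hs
    · linear_combination (-Real.cos t * Real.sin t) * hs
  · have hsupp := suppIn_plane hij (hd t)
    have key : ∀ c, translate (stage _ (planeSL hij _ _ _ _ (hd t))) (Vs (ID c)) = Vs (ID c) := by
      intro c
      by_cases hi : i ∈ ID c
      · have hj : j ∈ ID c := by rw [mem_ID, ← hs]; exact hi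
        exact (hsupp.mono (by intro k hk; rcases hk with rfl | rfl <;> assumption)).translate_Vs
      · have hj : j ∉ ID c := by rw [mem_ID, ← hs]; exact hi
        refine hsupp.translate_eq (Set.disjoint_right.2 ?_)
        intro k hk
        rcases hk with rfl | rfl <;> assumption
    rw [Vplus_eq, Vminus_eq]
    exact ⟨key 1, key (-1)⟩

/-- The hyperbolic counterpart of a rotation. The path t ↦ boost starts at 1 but mixes the two
summands, so it shows membership in G₀ only. -/
theorem exists_boost {i j : Idx q} (hs : sgn i = -sgn j) (t : ℝ) :
    ∃ h ∈ SO q, SuppIn {i, j} (toLin h) ∧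
      toLin h (e i) = Real.cosh t • e i + Real.sinh t • e j ∧
      toLin h (e j) = Real.sinh t • e i + Real.cosh t • e j := by
  have hij : i ≠ j := by
    rintro rfl
    exact sgn_ne_zero i (by linarith)
  have hd : ∀ t, Real.cosh t * Real.cosh t - Real.sinh t * Real.sinh t = 1 := fun t => by
    linear_combination Real.cosh_sq_sub_sinh_sq t
  refine ⟨stage _ (planeSL hij _ _ _ _ (hd t)), ?_, suppIn_plane hij _, plane_fst hij _,
    plane_snd hij _⟩
  refine mem_idComp_of_path (continuous_plane hij hd Real.continuous_cosh Real.continuous_sinh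
    Real.continuous_sinh Real.continuous_cosh) ?_ (fun t => ?_) t
  · rw [← plane_one hij (by norm_num)]
    congr 1 <;> simp
  · apply plane_isometry
    · rw [hs]; linear_combination (-sgn j) * hd t
    · rw [hs]; linear_combination sgn j * hd t
    · rw [hs]; ring

theorem SuppIn.mul {T : Set (Idx q)} {g h : SL q} (hg : SuppIn T (toLin g))
    (hh : SuppIn T (toLin h)) : SuppIn T (toLin (g * h)) := hg.comp hh

theorem sub_mem_Vs {T : Set (Idx q)} {x : V q} {j : Idx q} (hx : x ∈ Vs (insert j T)) :
    x - co j x • e j ∈ Vs T := by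
  rw [mem_Vs]
  intro k hk
  rw [map_sub, map_smul, smul_eq_mul, co_e]
  by_cases hkj : k = j
  · subst hkj; simp
  · rw [mem_Vs.1 hx k (by simp [hkj, hk])]; simp [hkj]

theorem mem_Vs_singleton {x : V q} {i : Idx q} (hx : x ∈ Vs {i}) : x = co i x • e i := by
  have h := sub_mem_Vs (T := ∅) (j := i) (x := x) (by simpa using hx)
  rw [Vs_empty, Submodule.mem_bot, sub_eq_zero] at h
  exact h

/-- A vector can be rotated to a multiple of a basis vector. -/
theorem exists_rotate_to_line {c : ℝ} {i : Idx q} (hi : i ∈ ID c) (T : Finset (Idx q))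
    (hT : (T : Set (Idx q)) ⊆ ID c) {x : V q} (hx : x ∈ Vs (insert i (T : Set (Idx q)))) :
    ∃ h ∈ K q, SuppIn (insert i (T : Set (Idx q))) (toLin h) ∧ ∃ r : ℝ, toLin h x = r • e i := by
  classical
  induction T using Finset.induction_on generalizing x with
  | empty =>
    exact ⟨1, isSub_K.1, SuppIn.id _, co i x,
      mem_Vs_singleton (x := x) (by simpa using hx)⟩
  | insert j T hj ih =>
    rw [Finset.coe_insert] at hT hx ⊢
    by_cases hji : j = i
    · subst hji
      rw [Set.insert_idem] at hx ⊢
      exact ih (fun k hk => hT (Or.inr hk)) hx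
    · rw [Set.insert_comm] at hx ⊢
      have hsub : (insert i (T : Set (Idx q))) ⊆ insert j (insert i (T : Set (Idx q))) :=
        Set.subset_insert _ _
      obtain ⟨h, hh, hsupp, r, hr⟩ := ih (fun k hk => hT (Or.inr hk)) (sub_mem_Vs hx)
      have hej : toLin h (e j) = e j := hsupp.1 j (by simp [hji, hj])
      have hx' : toLin h x = r • e i + co j x • e j := by
        rw [map_sub, map_smul, hej, sub_eq_iff_eq_add] at hr
        exact hr
      have hs : sgn i = sgn j := by
        rw [mem_ID.1 hi, mem_ID.1 (hT (Set.mem_insert j _))]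
      -- The angle θ has to satisfy r sin θ + xⱼ cos θ = 0. The argument of r - i xⱼ does, also when
      -- z = 0.
      set z : ℂ := ⟨r, -co j x⟩ with hz
      obtain ⟨k, hk, hks, hki, hkj⟩ := exists_rotation (Ne.symm hji) hs z.arg
      refine ⟨k * h, isSub_K.2.2 k hk h hh, (hks.mono ?_).mul (hsupp.mono hsub), 
        r * Real.cos z.arg - co j x * Real.sin z.arg, ?_⟩
      · intro l hl
        rcases hl with rfl | rfl <;> simp
      · rw [toLin_mul_apply, hx', map_add, map_smul, map_smul, hki, hkj]
        have h1 : ‖z‖ * Real.cos z.arg = r := Complex.norm_mul_cos_arg z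
        have h2 : ‖z‖ * Real.sin z.arg = -co j x := Complex.norm_mul_sin_arg z
        have h3 : r * Real.sin z.arg + co j x * Real.cos z.arg = 0 := by
          rw [← h1, ← neg_neg (co j x), ← h2]; ring
        have h4 : r • (Real.cos z.arg • e i + Real.sin z.arg • e j) +
            co j x • (-Real.sin z.arg • e i + Real.cos z.arg • e j) =
            (r * Real.cos z.arg - co j x * Real.sin z.arg) • e i +
            (r * Real.sin z.arg + co j x * Real.cos z.arg) • e j := by module
        rw [h4, h3, zero_smul, add_zero]

theorem exists_rotate_to_line' {c : ℝ} {i : Idx q} (hi : i ∈ ID c) {x : V q}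
    (hx : x ∈ Vs (ID c)) :
    ∃ h ∈ K q, SuppIn (ID c) (toLin h) ∧ ∃ r : ℝ, toLin h x = r • e i := by
  classical
  obtain ⟨T, hT⟩ := exists_finset_mem x
  have hT' : x ∈ Vs (insert i ((T.filter (· ∈ ID c) : Finset (Idx q)) : Set (Idx q))) := by
    refine Vs_mono ?_ (show x ∈ Vs (T ∩ ID c) by rw [Vs_inter]; exact ⟨hT, hx⟩)
    intro k hk
    refine Or.inr ?_
    simp only [Finset.coe_filter]
    exact hk
  obtain ⟨h, hh, hs, hr⟩ := exists_rotate_to_line hi (T.filter (· ∈ ID c))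
    (fun k hk => by
      simp only [Finset.coe_filter] at hk
      exact hk.2) hT'
  refine ⟨h, hh, hs.mono ?_, hr⟩
  rintro k (rfl | hk)
  · exact hi
  · simp only [Finset.coe_filter] at hk
    exact hk.2

theorem exists_boost_to_line {i j : Idx q} (hs : sgn i = -sgn j) {a b : ℝ} (hab : b ^ 2 < a ^ 2) :
    ∃ h ∈ SO q, SuppIn {i, j} (toLin h) ∧ ∃ r : ℝ, toLin h (a • e i + b • e j) = r • e i := by
  have ha : a ≠ 0 := by rintro rfl; nlinarith [sq_nonneg b]
  have hu : -b / a ∈ Set.Ioo (-1 : ℝ) 1 := by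
    rw [Set.mem_Ioo, ← abs_lt, abs_div, abs_neg, div_lt_one (abs_pos.2 ha)]
    exact sq_lt_sq.1 hab
  -- The parameter solves a sinh t + b cosh t = 0, that is, tanh t = -b/a, which is possible because
  -- |b| < |a|.
  obtain ⟨h, hh, hsupp, hi, hj⟩ := exists_boost hs (Real.artanh (-b / a))
  refine ⟨h, hh, hsupp, a * Real.cosh (Real.artanh (-b / a)) +
    b * Real.sinh (Real.artanh (-b / a)), ?_⟩
  have h0 : a * Real.sinh (Real.artanh (-b / a)) + b * Real.cosh (Real.artanh (-b / a)) = 0 := by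
    rw [Real.sinh_artanh hu, Real.cosh_artanh hu]
    field_simp
    ring
  rw [map_add, map_smul, map_smul, hi, hj]
  generalize Real.cosh (Real.artanh (-b / a)) = C at *
  generalize Real.sinh (Real.artanh (-b / a)) = S at *
  have h4 : a • (C • e i + S • e j) + b • (S • e i + C • e j) =
      (a * C + b * S) • e i + (a * S + b * C) • e j := by module
  rw [h4, h0, zero_smul, add_zero]

theorem exists_add_of_sign (x : V q) :
    ∃ y ∈ Vs (ID 1), ∃ z ∈ Vs (ID (-1)), y + z = x := by
  rw [← ID_compl (Or.inl rfl)]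
  exact exists_add_of_compl _ x

theorem mem_Vs_of_add {s t : Set (Idx q)} {y z : V q} (hy : y ∈ Vs s) (hz : z ∈ Vs sᶜ)
    (h : y + z ∈ Vs t) : y ∈ Vs t ∧ z ∈ Vs t := by
  have hyt : y ∈ Vs t := mem_Vs.2 fun i hi => by
    by_cases his : i ∈ s
    · have h1 := mem_Vs.1 h i hi
      rwa [map_add, mem_Vs.1 hz i (fun h => h his), add_zero] at h1
    · exact mem_Vs.1 hy i his
  refine ⟨hyt, ?_⟩
  have := Submodule.sub_mem _ h hyt
  rwa [add_sub_cancel_left] at this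

/-- A vector of the span of the `eᵢ`, `i ∈ T`, that has fixed sign can be rotated to a line. -/
theorem exists_rotate_of_sign {c : ℝ} {T : Finset (Idx q)} {x : V q}
    (hxT : x ∈ Vs (T : Set (Idx q))) (hxc : x ∈ Vs (ID c)) (hx : x ≠ 0) :
    ∃ h ∈ K q, SuppIn ((T : Set (Idx q)) ∩ ID c) (toLin h) ∧
      ∃ i ∈ (T : Set (Idx q)) ∩ ID c, ∃ r : ℝ,
      toLin h x = r • e i := by
  classical
  have hx' : x ∈ Vs ((T : Set (Idx q)) ∩ ID c) := by rw [Vs_inter]; exact ⟨hxT, hxc⟩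
  obtain ⟨i, hi⟩ : ((T : Set (Idx q)) ∩ ID c).Nonempty := by
    by_contra hcon
    rw [Set.not_nonempty_iff_eq_empty.1 hcon, Vs_empty] at hx'
    exact hx hx'
  have heq : insert i ((T.filter (· ∈ ID c) : Finset (Idx q)) : Set (Idx q)) =
      (T : Set (Idx q)) ∩ ID c := by
    rw [Finset.coe_filter]
    exact Set.insert_eq_of_mem hi
  obtain ⟨h, hh, hs, hr⟩ := exists_rotate_to_line (x := x) hi.2 (T.filter (· ∈ ID c))
    (fun k hk => by
      simp only [Finset.coe_filter] at hk
      exact hk.2) (by rw [heq]; exact hx')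
  rw [heq] at hs
  exact ⟨h, hh, hs, i, hi, hr⟩

/-- Being non-isotropic means r² ≠ t². The boost moves the vector to the axis of the larger
coordinate. -/
theorem exists_boost_to_line' {i j : Idx q} (hs : sgn i = -sgn j) {r t : ℝ}
    (hb : B (r • e i + t • e j) (r • e i + t • e j) ≠ 0) :
    ∃ h ∈ SO q, SuppIn {i, j} (toLin h) ∧ ∃ l ∈ ({i, j} : Set (Idx q)), ∃ r' : ℝ,
      toLin h (r • e i + t • e j) = r' • e l := by
  have hne : i ≠ j := by
    rintro rfl
    exact sgn_ne_zero i (by linarith)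
  have hB : r ^ 2 ≠ t ^ 2 := by
    intro h0
    apply hb
    simp only [map_add, map_smul, LinearMap.add_apply, LinearMap.smul_apply, B_e_left, co_e,
      if_neg hne, if_neg hne.symm, if_true, smul_eq_mul]
    rw [hs]
    linear_combination (-sgn j) * h0
  rcases lt_or_gt_of_ne hB with hlt | hlt
  · obtain ⟨b, hbO, hbs, r', hr'⟩ := exists_boost_to_line (i := j) (j := i) (by linarith) hlt
    rw [Set.pair_comm] at hbs
    rw [add_comm] at hr'
    exact ⟨b, hbO, hbs, j, Or.inr rfl, r', hr'⟩
  · obtain ⟨b, hbO, hbs, r', hr'⟩ := exists_boost_to_line (i := i) (j := j) hs hlt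
    exact ⟨b, hbO, hbs, i, Or.inl rfl, r', hr'⟩

theorem disjoint_ID : Disjoint (ID 1 : Set (Idx q)) (ID (-1)) := by
  rw [← ID_compl (Or.inl rfl)]; exact disjoint_compl_right

/-- Rotate the positive component to a multiple of some eᵢ and the negative one to a multiple of
some eⱼ. The two rotations do not disturb each other, and a boost in the plane of eᵢ, eⱼ finishes.
-/
theorem exists_move_of_ne_zero {T : Finset (Idx q)} {x : V q} (hx : x ∈ Vs (T : Set (Idx q)))
    (hb : B x x ≠ 0) :
    ∃ h ∈ SO q, SuppIn (T : Set (Idx q)) (toLin h) ∧ ∃ i ∈ T, ∃ r : ℝ, toLin h x = r • e i := by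
  obtain ⟨y, hy, z, hz, rfl⟩ := exists_add_of_sign x
  have hyz := mem_Vs_of_add hy (by rw [ID_compl (Or.inl rfl)]; exact hz) hx
  have hsub : ∀ c : ℝ, (T : Set (Idx q)) ∩ ID c ⊆ T := fun c => Set.inter_subset_left
  by_cases hy0 : y = 0
  · have hz0 : z ≠ 0 := by rintro rfl; simp [hy0] at hb
    obtain ⟨h, hh, hs, i, hi, r, hr⟩ := exists_rotate_of_sign hyz.2 hz hz0
    exact ⟨h, K_subset_SO hh, hs.mono (hsub _), i, hi.1, r, by rw [hy0, zero_add, hr]⟩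
  by_cases hz0 : z = 0
  · obtain ⟨h, hh, hs, i, hi, r, hr⟩ := exists_rotate_of_sign hyz.1 hy hy0
    exact ⟨h, K_subset_SO hh, hs.mono (hsub _), i, hi.1, r, by rw [hz0, add_zero, hr]⟩
  obtain ⟨h, hh, hs, i, hi, r, hr⟩ := exists_rotate_of_sign hyz.1 hy hy0
  obtain ⟨k, hk, ks, j, hj, t, ht⟩ := exists_rotate_of_sign hyz.2 hz hz0
  have hsubc : (ID (-1) : Set (Idx q)) ⊆ ((T : Set (Idx q)) ∩ ID 1)ᶜ :=
    disjoint_ID.symm.subset_compl_right.trans (Set.compl_subset_compl.2 Set.inter_subset_right)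
  have hz' : toLin h z = z := hs.map_eq (Vs_mono hsubc hz)
  have hi' : toLin k (e i) = e i := by
    refine ks.1 i fun hl => ?_
    exact Set.disjoint_left.1 disjoint_ID hi.2 hl.2
  have hkh : toLin (k * h) (y + z) = r • e i + t • e j := by
    rw [toLin_mul_apply, map_add, hr, hz', map_add, map_smul, hi', ht]
  have hkhO : k * h ∈ SO q := isSub_SO.2.2 k (K_subset_SO hk) h (K_subset_SO hh)
  have hkhs := (ks.mono (hsub _)).mul (hs.mono (hsub _))
  rw [← SO_isometry hkhO, hkh] at hb
  have hij : sgn i = -sgn j := by rw [mem_ID.1 hi.2, mem_ID.1 hj.2, neg_neg]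
  obtain ⟨b, hbO, hbs, l, hl, r', hr'⟩ := exists_boost_to_line' hij hb
  have hsubij : ({i, j} : Set (Idx q)) ⊆ T := Set.pair_subset hi.1 hj.1
  exact ⟨b * (k * h), isSub_SO.2.2 b hbO _ hkhO, (hbs.mono hsubij).mul hkhs, l, hsubij hl, r', by
    rw [toLin_mul_apply, hkh, hr']⟩

/-! ### Moving subspaces to coordinate subspaces -/

/-- If every nonzero subspace with property `Q` can be moved by `C` such that a basis vector
splits off, then every one can be moved to a coordinate subspace. -/
theorem exists_move_to_coordinate {C : Set (SL q)} (hC : IsSub C)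
    {Q : Submodule ℝ (V q) → Prop}
    (step : ∀ (T : Finset (Idx q)) (A : Submodule ℝ (V q)), A ≤ Vs (T : Set (Idx q)) → A ≠ ⊥ →
      Q A → ∃ h ∈ C, SuppIn (T : Set (Idx q)) (toLin h) ∧ ∃ i ∈ T, e i ∈ translate h A ∧
        Q (translate h A ⊓ Vs ((T : Set (Idx q)) \ {i})))
    (T : Finset (Idx q)) {A : Submodule ℝ (V q)} (hA : A ≤ Vs (T : Set (Idx q))) (hQ : Q A) :
    ∃ h ∈ C, SuppIn (T : Set (Idx q)) (toLin h) ∧ ∃ S ⊆ T, translate h A = Vs (S : Set (Idx q)) := by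
  classical
  induction hn : T.card generalizing T A with
  | zero =>
    have hT : T = ∅ := Finset.card_eq_zero.1 hn
    subst hT
    rw [Finset.coe_empty, Vs_empty, le_bot_iff] at hA
    subst hA
    exact ⟨1, hC.1, SuppIn.id _, ∅, subset_rfl, by
      rw [translate_one, Finset.coe_empty, Vs_empty]⟩
  | succ n ih =>
    by_cases hA0 : A = ⊥
    · subst hA0
      exact ⟨1, hC.1, SuppIn.id _, ∅, Finset.empty_subset _, by
        rw [translate_one, Finset.coe_empty, Vs_empty]⟩
    obtain ⟨h, hh, hs, i, hi, hei, hQ'⟩ := step T A hA hA0 hQ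
    rw [← Finset.coe_erase] at hQ'
    obtain ⟨k, hk, ks, S, hS, hSk⟩ := ih (T.erase i) inf_le_right hQ'
      (by rw [Finset.card_erase_of_mem hi, hn]; rfl)
    refine ⟨k * h, hC.2.2 k hk h hh, (ks.mono (by simp)).mul hs, insert i S,
      Finset.insert_subset hi (hS.trans (Finset.erase_subset _ _)), ?_⟩
    -- As eᵢ lies in the subspace, the eᵢ-coordinate can be subtracted from each of its vectors. The
    -- later move k is supported away from i and so keeps eᵢ.
    have hsplit : translate h A = Vs {i} ⊔
        (translate h A ⊓ Vs ((T.erase i : Finset (Idx q)) : Set (Idx q))) := by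
      apply le_antisymm
      · intro y hy
        have hyT : y ∈ Vs (insert i ((T.erase i : Finset (Idx q)) : Set (Idx q))) := by
          rw [← Finset.coe_insert, Finset.insert_erase hi]
          exact hs.translate_le hA hy
        have h1 := sub_mem_Vs hyT
        rw [← add_sub_cancel (co i y • e i) y]
        refine Submodule.add_mem_sup (Submodule.smul_mem _ _ (e_mem_Vs.2 rfl)) ⟨?_, h1⟩
        exact Submodule.sub_mem _ hy (Submodule.smul_mem _ _ hei)
      · refine sup_le (Vs_le.2 ?_) inf_le_left
        rintro _ rfl
        exact hei
    rw [translate_mul, hsplit, translate_sup, hSk, ks.translate_eq (by simp), ← Vs_union,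
      Finset.coe_insert, Set.insert_eq]

/-- The radical of the form on `F` vanishes. -/
def Nondeg (F : Submodule ℝ (V q)) : Prop := ∀ x ∈ F, (∀ y ∈ F, B x y = 0) → x = 0

theorem Nondeg.exists_ne_zero {A : Submodule ℝ (V q)} (h : Nondeg A) (hA : A ≠ ⊥) :
    ∃ x ∈ A, B x x ≠ 0 := by
  by_contra! hcon
  obtain ⟨x, hx, hx0⟩ := Submodule.exists_mem_ne_zero_of_ne_bot hA
  refine hx0 (h x hx fun y hy => ?_)
  have h1 := hcon (x + y) (A.add_mem hx hy)
  simp only [map_add, LinearMap.add_apply, hcon x hx, hcon y hy, B_comm y x] at h1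
  linarith

theorem Nondeg.translate {A : Submodule ℝ (V q)} (h : Nondeg A) {g : SL q} (hg : g ∈ SO q) :
    Nondeg (translate g A) := by
  rintro _ ⟨x, hx, rfl⟩ hxy
  rw [h x hx, map_zero]
  intro y hy
  rw [← SO_isometry hg]
  exact hxy _ ⟨y, hy, rfl⟩

theorem mem_of_smul_eq {g : SL q} {A : Submodule ℝ (V q)} {x : V q} (hx : x ∈ A) (hx0 : x ≠ 0)
    {i : Idx q} {r : ℝ} (h : toLin g x = r • e i) : e i ∈ RealCycle.translate g A := by
  have hr : r ≠ 0 := by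
    rintro rfl
    rw [zero_smul] at h
    exact hx0 (toLin_injective g (by rw [h, map_zero]))
  rw [← inv_smul_smul₀ hr (e i), ← h]
  exact Submodule.smul_mem _ _ ⟨x, hx, rfl⟩

/-- Gram–Schmidt: a nonzero nondegenerate space contains a non-isotropic vector, which is moved to a
line of a basis vector eᵢ. What remains is the part orthogonal to eᵢ, and it is again nondegenerate.
-/
theorem Nondeg.exists_move {T : Finset (Idx q)} {A : Submodule ℝ (V q)}
    (hA : A ≤ Vs (T : Set (Idx q))) (h : Nondeg A) :
    ∃ h ∈ SO q, SuppIn (T : Set (Idx q)) (toLin h) ∧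
      ∃ S ⊆ T, RealCycle.translate h A = Vs (S : Set (Idx q)) := by
  refine exists_move_to_coordinate isSub_SO ?_ T hA h
  intro T A hA hA0 hN
  obtain ⟨x, hx, hb⟩ := hN.exists_ne_zero hA0
  have hx0 : x ≠ 0 := by rintro rfl; simp at hb
  obtain ⟨h, hh, hs, i, hi, r, hr⟩ := exists_move_of_ne_zero (hA hx) hb
  have hei := mem_of_smul_eq hx hx0 hr
  refine ⟨h, hh, hs, i, hi, hei, ?_⟩
  rintro y ⟨hy, hyT⟩ hperp
  refine (hN.translate hh) y hy fun z hz => ?_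
  have hyi : B y (e i) = 0 := by
    rw [B_e_right, mem_Vs.1 hyT i (by simp), mul_zero]
  have hzT : z ∈ Vs (insert i ((T : Set (Idx q)) \ {i})) := by
    rw [Set.insert_sdiff_self_of_mem (Finset.mem_coe.2 hi)]
    exact hs.translate_le hA hz
  have := hperp (z - co i z • e i)
    ⟨Submodule.sub_mem _ hz (Submodule.smul_mem _ _ hei), sub_mem_Vs hzT⟩
  rwa [map_sub, map_smul, hyi, smul_zero, sub_zero] at this

/-- `F` is the sum of its intersections with the positive and the negative summand. -/
def Fits (F : Submodule ℝ (V q)) : Prop :=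
  ∀ x ∈ F, ∃ y ∈ F ⊓ Vs (ID 1), ∃ z ∈ F ⊓ Vs (ID (-1)), y + z = x

theorem fitsSplitting_iff {F : Submodule ℝ (V q)} : FitsSplitting F ↔ Fits F := by
  rw [FitsSplitting, Vplus_eq, Vminus_eq]
  constructor
  · intro h x hx
    rw [h] at hx
    exact Submodule.mem_sup.1 hx
  · intro h
    exact le_antisymm (fun x hx => Submodule.mem_sup.2 (h x hx)) (sup_le inf_le_left inf_le_left)

theorem Fits.translate {F : Submodule ℝ (V q)} (h : Fits F) {g : SL q}
    (h1 : translate g (Vs (ID 1)) = Vs (ID 1)) (h2 : translate g (Vs (ID (-1))) = Vs (ID (-1))) :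
    Fits (translate g F) := by
  rintro _ ⟨x, hx, rfl⟩
  obtain ⟨y, hy, z, hz, rfl⟩ := h x hx
  refine ⟨toLin g y, ⟨⟨y, hy.1, rfl⟩, ?_⟩, toLin g z, ⟨⟨z, hz.1, rfl⟩, ?_⟩, (map_add _ _ _).symm⟩
  · rw [← h1]; exact ⟨y, hy.2, rfl⟩
  · rw [← h2]; exact ⟨z, hz.2, rfl⟩

theorem Fits.inf_Vs {F : Submodule ℝ (V q)} (h : Fits F) (t : Set (Idx q)) :
    Fits (F ⊓ Vs t) := by
  rintro x ⟨hx, hxt⟩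
  obtain ⟨y, hy, z, hz, rfl⟩ := h x hx
  have := mem_Vs_of_add hy.2 (by rw [ID_compl (Or.inl rfl)]; exact hz.2) hxt
  exact ⟨y, ⟨⟨hy.1, this.1⟩, hy.2⟩, z, ⟨⟨hz.1, this.2⟩, hz.2⟩, rfl⟩

/-- A nonzero subspace that fits the splitting contains a nonzero vector in one of the summands, so
rotations suffice and no boost is needed. This keeps the move inside K₀. -/
theorem Fits.exists_move {T : Finset (Idx q)} {A : Submodule ℝ (V q)}
    (hA : A ≤ Vs (T : Set (Idx q))) (h : Fits A) :
    ∃ h ∈ K q, SuppIn (T : Set (Idx q)) (toLin h) ∧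
      ∃ S ⊆ T, RealCycle.translate h A = Vs (S : Set (Idx q)) := by
  refine exists_move_to_coordinate isSub_K ?_ T hA h
  intro T A hA hA0 hF
  obtain ⟨x, hx, hx0⟩ := Submodule.exists_mem_ne_zero_of_ne_bot hA0
  have key : ∃ c, ∃ x ∈ A, x ∈ Vs (ID c) ∧ x ≠ 0 := by
    obtain ⟨y, hy, z, hz, rfl⟩ := hF x hx
    by_cases hy0 : y = 0
    · exact ⟨-1, z, hz.1, hz.2, fun h => hx0 (by rw [hy0, h, add_zero])⟩
    · exact ⟨1, y, hy.1, hy.2, hy0⟩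
  obtain ⟨c, y, hy, hyc, hy0⟩ := key
  obtain ⟨h, hh, hs, i, hi, r, hr⟩ := exists_rotate_of_sign (hA hy) hyc hy0
  refine ⟨h, hh, hs.mono Set.inter_subset_left, i, hi.1, mem_of_smul_eq hy hy0 hr, ?_⟩
  exact (hF.translate (K_fix hh (Or.inl rfl)) (K_fix hh (Or.inr rfl))).inf_Vs _

/-- Two finite coordinate subspaces of the same signature are equivalent under rotations. -/
theorem exists_rotate_Vs (S S' : Finset (Idx q))
    (hcard : ∀ c : ℝ, ((S : Set (Idx q)) ∩ ID c).ncard = ((S' : Set (Idx q)) ∩ ID c).ncard) :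
    ∃ h ∈ K q, SuppIn ((S : Set (Idx q)) ∪ S') (toLin h) ∧
      translate h (Vs (S : Set (Idx q))) = Vs (S' : Set (Idx q)) := by
  classical
  have hcard' : ∀ c : ℝ, (S.filter (· ∈ ID c)).card = (S'.filter (· ∈ ID c)).card := by
    intro c
    have h := hcard c
    rw [← Set.ncard_coe_finset, ← Set.ncard_coe_finset, Finset.coe_filter, Finset.coe_filter]
    exact h
  clear hcard
  induction hn : (S \ S').card generalizing S with
  | zero =>
    have hsub : S ⊆ S' := Finset.sdiff_eq_empty_iff_subset.1 (Finset.card_eq_zero.1 hn)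
    have : S = S' := by
      refine Finset.Subset.antisymm hsub fun j hj => ?_
      have h1 : S.filter (· ∈ ID (sgn j)) = S'.filter (· ∈ ID (sgn j)) :=
        Finset.eq_of_subset_of_card_le (Finset.filter_subset_filter _ hsub) (hcard' _).ge
      have h2 : j ∈ S'.filter (· ∈ ID (sgn j)) := Finset.mem_filter.2 ⟨hj, rfl⟩
      rw [← h1] at h2
      exact (Finset.mem_filter.1 h2).1
    subst this
    exact ⟨1, isSub_K.1, SuppIn.id _, translate_one _⟩
  | succ n ih =>
    obtain ⟨i, hi⟩ : (S \ S').Nonempty := by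
      rw [← Finset.card_pos]; omega
    obtain ⟨hiS, hiS'⟩ := Finset.mem_sdiff.1 hi
    -- Both sets have equally many indices of the sign of i, so i in S \ S' forces an index j of the
    -- same sign in S' \ S.
    obtain ⟨j, hj⟩ : (S'.filter (· ∈ ID (sgn i)) \ S.filter (· ∈ ID (sgn i))).Nonempty := by
      rw [← Finset.card_pos, ← Finset.card_sdiff_comm (hcard' _), Finset.card_pos]
      exact ⟨i, by simp [hiS, hiS', mem_ID]⟩
    have hjS' : j ∈ S' := by simp at hj; exact hj.1.1
    have hs : sgn j = sgn i := by simp [mem_ID] at hj; exact hj.1.2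
    have hjS : j ∉ S := by
      intro h
      simp [mem_ID] at hj
      exact hj.2 h hs
    have hij : i ≠ j := fun h => hjS (h ▸ hiS)
    -- A quarter turn sends eᵢ to eⱼ; replacing i by j in S lowers the number of elements of S \ S'.
    obtain ⟨h, hh, hsupp, h1, h2⟩ := exists_rotation hij hs.symm (Real.pi / 2)
    simp only [Real.cos_pi_div_two, Real.sin_pi_div_two, zero_smul, one_smul, zero_add,
      add_zero] at h1 h2
    have htr : translate h (Vs (S : Set (Idx q))) =
        Vs ((insert j (S.erase i) : Finset (Idx q)) : Set (Idx q)) := by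
      have hSe : (S : Set (Idx q)) = {i} ∪ ((S.erase i : Finset (Idx q)) : Set (Idx q)) := by
        rw [← Set.insert_eq, ← Finset.coe_insert, Finset.insert_erase hiS]
      have hdisj : Disjoint ((S.erase i : Finset (Idx q)) : Set (Idx q)) {i, j} := by
        rw [Set.disjoint_left]
        intro k hk
        rw [Finset.mem_coe, Finset.mem_erase] at hk
        rintro (rfl | rfl)
        · exact hk.1 rfl
        · exact hjS hk.2
      rw [hSe, Vs_union, translate_sup, hsupp.translate_eq hdisj, Finset.coe_insert,
        Set.insert_eq, Vs_union]
      congr 1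
      rw [RealCycle.translate, Vs, Submodule.map_span, Vs, Set.image_singleton,
        Set.image_singleton, Set.image_singleton, h1]
    obtain ⟨k, hk, ks, hkS⟩ := ih (insert j (S.erase i)) (by
      intro c
      rw [← hcard' c]
      by_cases hc : i ∈ ID c
      · have hjc : j ∈ ID c := by rw [mem_ID, hs]; exact hc
        rw [Finset.filter_insert, if_pos hjc, Finset.filter_erase, Finset.card_insert_of_notMem,
          Finset.card_erase_of_mem (Finset.mem_filter.2 ⟨hiS, hc⟩), Nat.sub_add_cancel]
        · exact Finset.card_pos.2 ⟨i, Finset.mem_filter.2 ⟨hiS, hc⟩⟩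
        · simp [hjS]
      · have hjc : j ∉ ID c := by rw [mem_ID, hs]; exact hc
        rw [Finset.filter_insert, if_neg hjc, Finset.filter_erase, Finset.erase_eq_of_notMem]
        simp [hc]) (by
      have : insert j (S.erase i) \ S' = (S \ S').erase i := by
        ext l
        simp only [Finset.mem_sdiff, Finset.mem_insert, Finset.mem_erase]
        constructor
        · rintro ⟨rfl | hl, hl'⟩
          · exact absurd hjS' hl'
          · exact ⟨hl.1, hl.2, hl'⟩
        · rintro ⟨h1, h2, h3⟩
          exact ⟨Or.inr ⟨h1, h2⟩, h3⟩
      rw [this, Finset.card_erase_of_mem hi, hn]; rfl)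
    refine ⟨k * h, isSub_K.2.2 k hk h hh, (ks.mono ?_).mul (hsupp.mono ?_), ?_⟩
    · rintro l (hl | hl)
      · rw [Finset.mem_coe, Finset.mem_insert, Finset.mem_erase] at hl
        rcases hl with rfl | hl
        · exact Or.inr hjS'
        · exact Or.inl hl.2
      · exact Or.inr hl
    · rintro l (rfl | rfl)
      · exact Or.inl hiS
      · exact Or.inr hjS'
    · rw [translate_mul, htr, hkS]

/-! ### Signatures -/

/-- Q embeds in (P + N)/N, a quotient of P. Since N may be infinite dimensional, the count is made
with N ∩ (P + Q) instead. -/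
theorem finrank_le_of_le_sup {P N Q : Submodule ℝ (V q)} [FiniteDimensional ℝ P]
    [FiniteDimensional ℝ Q] (h : Q ≤ P ⊔ N) (h0 : Q ⊓ N = ⊥) : finrank ℝ Q ≤ finrank ℝ P := by
  set N' := N ⊓ (P ⊔ Q) with hN'
  have : FiniteDimensional ℝ N' := Submodule.finiteDimensional_of_le inf_le_right
  have h1 : P ⊔ N' = P ⊔ Q := by
    rw [hN', ← sup_inf_assoc_of_le N (le_sup_left : P ≤ P ⊔ Q)]
    exact inf_eq_right.2 (sup_le le_sup_left h)
  have h2 := Submodule.finrank_add_le_finrank_add_finrank P N'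
  have h3 := Submodule.finrank_sup_add_finrank_inf_eq Q N'
  have h4 : Q ⊓ N' = ⊥ := le_bot_iff.1 (h0 ▸ inf_le_inf_left _ inf_le_left)
  have h5 : finrank ℝ ↥(Q ⊔ N') ≤ finrank ℝ ↥(P ⊔ Q) :=
    Submodule.finrank_mono (sup_le le_sup_right inf_le_right)
  rw [h4, finrank_bot] at h3
  rw [h1] at h2
  omega

/-- `F` is the sum of a positive definite subspace of dimension `k` and of a negative definite
subspace. -/
def HasType (k : ℕ) (F : Submodule ℝ (V q)) : Prop :=
  ∃ P N : Submodule ℝ (V q), P ⊔ N = F ∧ CDef 1 P ∧ CDef (-1) N ∧ FiniteDimensional ℝ P ∧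
    finrank ℝ P = k

/-- Sylvester's law of inertia: Q meets the negative definite summand trivially. Semidefiniteness of
Q is enough, which matters when isotropic vectors have to be excluded. -/
theorem HasType.finrank_le {k : ℕ} {F Q : Submodule ℝ (V q)} (h : HasType k F)
    [FiniteDimensional ℝ Q] (hQ : Q ≤ F) (hpos : ∀ x ∈ Q, 0 ≤ B x x) : finrank ℝ Q ≤ k := by
  obtain ⟨P, N, rfl, -, hN, _, rfl⟩ := h
  refine finrank_le_of_le_sup hQ ?_
  rw [Submodule.eq_bot_iff]
  rintro x ⟨hx, hxN⟩
  exact hN.eq_zero hxN (by linarith [hpos x hx])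

theorem HasType.le {k l : ℕ} {F : Submodule ℝ (V q)} (h : HasType k F) (h' : HasType l F) :
    k ≤ l := by
  obtain ⟨P, N, hF, hP, -, _, rfl⟩ := h
  exact h'.finrank_le (hF ▸ le_sup_left) fun x hx => by simpa using hP.nonneg hx

theorem HasType.unique {k l : ℕ} {F : Submodule ℝ (V q)} (h : HasType k F) (h' : HasType l F) :
    k = l := le_antisymm (h.le h') (h'.le h)

/-- If x = y + z is orthogonal to both of its components, then B(y, y) = -B(y, z) = B(z, z), where
the left side is at least 0 and the right side at most 0. -/
theorem HasType.nondeg {k : ℕ} {F : Submodule ℝ (V q)} (h : HasType k F) : Nondeg F := by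
  obtain ⟨P, N, rfl, hP, hN, -, -⟩ := h
  intro x hx hperp
  obtain ⟨y, hy, z, hz, rfl⟩ := Submodule.mem_sup.1 hx
  have h1 := hperp y (Submodule.mem_sup_left hy)
  have h2 := hperp z (Submodule.mem_sup_right hz)
  simp only [map_add, LinearMap.add_apply] at h1 h2
  rw [B_comm z y] at h1
  have h3 := hP.nonneg hy
  have h4 := hN.nonneg hz
  rw [hP.eq_zero hy (by linarith), hN.eq_zero hz (by linarith), add_zero]

theorem CDef.translate {c : ℝ} {W : Submodule ℝ (V q)} (h : CDef c W) {g : SL q}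
    (hg : g ∈ SO q) : CDef c (RealCycle.translate g W) := by
  rintro _ ⟨x, hx, rfl⟩ hx0
  rw [SO_isometry hg]
  exact h x hx fun h0 => hx0 (by rw [h0, map_zero])

theorem HasType.translate {k : ℕ} {F : Submodule ℝ (V q)} (h : HasType k F) {g : SL q}
    (hg : g ∈ SO q) : HasType k (RealCycle.translate g F) := by
  obtain ⟨P, N, rfl, hP, hN, _, rfl⟩ := h
  exact ⟨_, _, (translate_sup g P N).symm, hP.translate hg, hN.translate hg,
    inferInstanceAs (FiniteDimensional ℝ (P.map (toLin g))), finrank_translate g P⟩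

theorem hasType_Vs {S : Set (Idx q)} (hS : (S ∩ ID 1).Finite) :
    HasType (S ∩ ID 1).ncard (Vs S) := by
  refine ⟨Vs (S ∩ ID 1), Vs (S \ ID 1), (Vs_eq_sup S (ID 1)).symm,
    (cdef_Vs (Or.inl rfl)).mono (Vs_mono Set.inter_subset_right),
    (cdef_Vs_compl (Or.inl rfl)).mono (Vs_mono fun i hi => hi.2), ?_, finrank_Vs_ncard hS⟩
  exact FiniteDimensional.span_of_finite ℝ (hS.image _)

/-! ### The orbit of `(V₀)₋` -/

/-- `F` is a translate of `(V₀)₋`. -/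
def InOrbit (F : Submodule ℝ (V q)) : Prop := ∃ g : SL q, F = translate g (Vs (ID (-1)))

theorem InOrbit.translate {F : Submodule ℝ (V q)} (h : InOrbit F) (g : SL q) :
    InOrbit (RealCycle.translate g F) := by
  obtain ⟨g', rfl⟩ := h
  exact ⟨g * g', (translate_mul g g' _).symm⟩

theorem exists_coordinate_of_move {C : Set (SL q)} {T : Finset (Idx q)} {g : SL q}
    (hT : SuppIn (T : Set (Idx q)) (toLin g))
    (h : ∃ h ∈ C, SuppIn (T : Set (Idx q)) (toLin h) ∧ ∃ S ⊆ T,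
      translate h (translate g (Vs (ID (-1))) ⊓ Vs (T : Set (Idx q))) = Vs (S : Set (Idx q))) :
    ∃ h ∈ C, ∃ S ⊆ T, S.card = (ID (-1) ∩ (T : Set (Idx q))).ncard ∧
      translate h (translate g (Vs (ID (-1)))) = Vs ((S : Set (Idx q)) ∪ (ID (-1) \ T)) := by
  obtain ⟨h, hh, hs, S, hS, hhS⟩ := h
  refine ⟨h, hh, S, hS, ?_, ?_⟩
  · rw [← hT.finrank_eq, ← finrank_Vs, ← hhS, finrank_translate]
  · rw [hT.adapted (ID (-1)), hs.translate_sup, hhS, Vs_union]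

/-- The part of the translate outside T is a coordinate subspace orthogonal to the part inside, so
the finite dimensional inner part inherits nondegeneracy and is the only part to be moved. -/
theorem Nondeg.exists_coordinate {T : Finset (Idx q)} {g : SL q}
    (hT : SuppIn (T : Set (Idx q)) (toLin g)) (h : Nondeg (RealCycle.translate g (Vs (ID (-1))))) :
    ∃ h ∈ SO q, ∃ S ⊆ T, S.card = (ID (-1) ∩ (T : Set (Idx q))).ncard ∧
      RealCycle.translate h (RealCycle.translate g (Vs (ID (-1)))) =
        Vs ((S : Set (Idx q)) ∪ (ID (-1) \ T)) := by
  refine exists_coordinate_of_move hT (Nondeg.exists_move inf_le_right ?_)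
  rintro x ⟨hx, hxT⟩ hperp
  refine h x hx fun y hy => ?_
  rw [hT.adapted (ID (-1))] at hy
  obtain ⟨a, ha, b, hb, rfl⟩ := Submodule.mem_sup.1 hy
  rw [map_add, hperp a ha, zero_add]
  exact B_eq_zero_of_disjoint Set.disjoint_sdiff_right hxT hb

theorem Fits.exists_coordinate {T : Finset (Idx q)} {g : SL q}
    (hT : SuppIn (T : Set (Idx q)) (toLin g)) (h : Fits (RealCycle.translate g (Vs (ID (-1))))) :
    ∃ h ∈ K q, ∃ S ⊆ T, S.card = (ID (-1) ∩ (T : Set (Idx q))).ncard ∧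
      RealCycle.translate h (RealCycle.translate g (Vs (ID (-1)))) =
        Vs ((S : Set (Idx q)) ∪ (ID (-1) \ T)) :=
  exists_coordinate_of_move hT (Fits.exists_move inf_le_right (h.inf_Vs _))

theorem union_inter_ID (S : Set (Idx q)) (T : Set (Idx q)) :
    (S ∪ (ID (-1) \ T)) ∩ ID 1 = S ∩ ID 1 := by
  rw [Set.union_inter_distrib_right,
    (disjoint_ID.symm.mono_left Set.sdiff_subset).inter_eq, Set.union_empty]

/-- Equal cardinality and equally many positive indices give equally many negative ones. The
rotation is supported in T and leaves the common outer part alone. -/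
theorem exists_rotate_coordinate {T S S' : Finset (Idx q)} (hS : S ⊆ T) (hS' : S' ⊆ T)
    (hcard : S.card = S'.card)
    (h1 : ((S : Set (Idx q)) ∩ ID 1).ncard = ((S' : Set (Idx q)) ∩ ID 1).ncard) :
    ∃ h ∈ K q, translate h (Vs ((S : Set (Idx q)) ∪ (ID (-1) \ T))) =
      Vs ((S' : Set (Idx q)) ∪ (ID (-1) \ T)) := by
  have hm : ∀ S : Finset (Idx q),
      ((S : Set (Idx q)) ∩ ID 1).ncard + ((S : Set (Idx q)) ∩ ID (-1)).ncard = S.card := by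
    intro S
    rw [← ID_compl (Or.inl rfl), ← Set.sdiff_eq,
      Set.ncard_inter_add_ncard_sdiff_eq_ncard _ _ S.finite_toSet, Set.ncard_coe_finset]
  obtain ⟨h, hh, hs, hSS⟩ := exists_rotate_Vs S S' (by
    intro c
    by_cases hc1 : c = 1
    · subst hc1; exact h1
    by_cases hc2 : c = -1
    · subst hc2
      have := hm S
      have := hm S'
      omega
    · have : (ID c : Set (Idx q)) = ∅ := Set.eq_empty_of_forall_notMem fun i hi => by
        rcases sgn_eq i with h | h
        · exact hc1 (hi.symm.trans h)
        · exact hc2 (hi.symm.trans h)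
      rw [this, Set.inter_empty, Set.inter_empty])
  have hsT : SuppIn (T : Set (Idx q)) (toLin h) :=
    hs.mono (Set.union_subset (Finset.coe_subset.2 hS) (Finset.coe_subset.2 hS'))
  exact ⟨h, hh, by rw [Vs_union, hsT.translate_sup, hSS, Vs_union]⟩

/-- Translates of `(V₀)₋` of the same signature are conjugate under `G₀`. -/
theorem HasType.exists_translate {k : ℕ} {F F' : Submodule ℝ (V q)} (hF : InOrbit F)
    (hF' : InOrbit F') (h : HasType k F) (h' : HasType k F') :
    ∃ g ∈ SO q, F' = RealCycle.translate g F := by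
  obtain ⟨g, rfl⟩ := hF
  obtain ⟨g', rfl⟩ := hF'
  obtain ⟨T, hT, hT'⟩ := exists_suppIn₂ g g'
  obtain ⟨h₁, hh₁, S, hS, hSc, hE⟩ := h.nondeg.exists_coordinate hT
  obtain ⟨h₂, hh₂, S', hS', hSc', hE'⟩ := h'.nondeg.exists_coordinate hT'
  -- By inertia the coordinate model must have exactly k positive indices, all of them in S, since
  -- the outer part is negative.
  have key : ∀ {S : Finset (Idx q)} {h : SL q} {F : Submodule ℝ (V q)}, h ∈ SO q →
      HasType k F → RealCycle.translate h F = Vs ((S : Set (Idx q)) ∪ (ID (-1) \ T)) →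
      k = ((S : Set (Idx q)) ∩ ID 1).ncard := by
    intro S h F hh hF hE
    have h1 := hF.translate hh
    rw [hE] at h1
    have hfin : (((S : Set (Idx q)) ∪ (ID (-1) \ T)) ∩ ID 1).Finite := by
      rw [union_inter_ID]; exact S.finite_toSet.inter_of_left _
    rw [h1.unique (hasType_Vs hfin), union_inter_ID]
  obtain ⟨r, hr, hrE⟩ := exists_rotate_coordinate hS hS' (hSc.trans hSc'.symm)
    ((key hh₁ h hE).symm.trans (key hh₂ h' hE'))
  refine ⟨h₂⁻¹ * (r * h₁), isSub_SO.2.2 _ (isSub_SO.2.1 _ hh₂) _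
    (isSub_SO.2.2 _ (K_subset_SO hr) _ hh₁), ?_⟩
  rw [translate_mul, translate_mul, hE, hrE, ← hE', translate_inv_translate]

/-- The dimension of the positive part. -/
def posDim (F : Submodule ℝ (V q)) : ℕ := finrank ℝ ↥(F ⊓ Vs (ID 1))

theorem posDim_translate {F : Submodule ℝ (V q)} {g : SL q} (hg : g ∈ K q) :
    posDim (translate g F) = posDim F := by
  rw [posDim, ← K_fix hg (Or.inl rfl), ← translate_inf, finrank_translate, posDim]

theorem posDim_Vs {S : Set (Idx q)} (hS : (S ∩ ID 1).Finite) :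
    posDim (Vs S) = (S ∩ ID 1).ncard := by
  rw [posDim, ← Vs_inter, finrank_Vs_ncard hS]

/-- Translates of `(V₀)₋` that fit the splitting are conjugate under `K₀` if their positive parts
have the same dimension. -/
theorem Fits.exists_translate {F F' : Submodule ℝ (V q)} (hF : InOrbit F) (hF' : InOrbit F')
    (h : Fits F) (h' : Fits F') (hd : posDim F = posDim F') :
    ∃ g ∈ K q, F' = RealCycle.translate g F := by
  obtain ⟨g, rfl⟩ := hF
  obtain ⟨g', rfl⟩ := hF'
  obtain ⟨T, hT, hT'⟩ := exists_suppIn₂ g g'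
  obtain ⟨h₁, hh₁, S, hS, hSc, hE⟩ := h.exists_coordinate hT
  obtain ⟨h₂, hh₂, S', hS', hSc', hE'⟩ := h'.exists_coordinate hT'
  have key : ∀ {S : Finset (Idx q)} {h : SL q} {F : Submodule ℝ (V q)}, h ∈ K q →
      RealCycle.translate h F = Vs ((S : Set (Idx q)) ∪ (ID (-1) \ T)) →
      posDim F = ((S : Set (Idx q)) ∩ ID 1).ncard := by
    intro S h F hh hE
    rw [← posDim_translate hh, hE, posDim_Vs, union_inter_ID]
    rw [union_inter_ID]; exact S.finite_toSet.inter_of_left _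
  obtain ⟨r, hr, hrE⟩ := exists_rotate_coordinate hS hS' (hSc.trans hSc'.symm)
    ((key hh₁ hE).symm.trans (hd.trans (key hh₂ hE')))
  refine ⟨h₂⁻¹ * (r * h₁), isSub_K.2.2 _ (isSub_K.2.1 _ hh₂) _
    (isSub_K.2.2 _ hr _ hh₁), ?_⟩
  rw [translate_mul, translate_mul, hE, hrE, ← hE', translate_inv_translate]

/-- A translate of V₋ is contained in V₋ plus the span of a finite T, so it meets V₊ inside that
finite span. This makes `posDim` a genuine dimension on the orbit. -/
theorem InOrbit.finiteDimensional {F : Submodule ℝ (V q)} (hF : InOrbit F) :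
    FiniteDimensional ℝ ↥(F ⊓ Vs (ID 1)) := by
  obtain ⟨g, rfl⟩ := hF
  obtain ⟨T, hT⟩ := exists_suppIn g
  refine finiteDimensional_of_le (T := T) ?_
  have h1 : RealCycle.translate g (Vs (ID (-1))) ≤ Vs (ID (-1) ∪ (T : Set (Idx q))) := by
    rw [hT.translate_Vs_eq, Vs_union, sup_comm]
    exact sup_le_sup (Vs_mono Set.sdiff_subset) (hT.translate_le (Vs_mono Set.inter_subset_right))
  refine (inf_le_inf_right _ h1).trans ?_
  rw [← Vs_inter, Set.union_inter_distrib_right, disjoint_ID.symm.inter_eq, Set.empty_union]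
  exact Vs_mono Set.inter_subset_left

theorem Fits.hasType {F : Submodule ℝ (V q)} (h : Fits F) (hF : InOrbit F) :
    HasType (posDim F) F := by
  refine ⟨F ⊓ Vs (ID 1), F ⊓ Vs (ID (-1)), 
    le_antisymm (sup_le inf_le_left inf_le_left) fun x hx => Submodule.mem_sup.2 (h x hx),
    (cdef_Vs (Or.inl rfl)).mono inf_le_right, (cdef_Vs (Or.inr rfl)).mono inf_le_right,
    hF.finiteDimensional, rfl⟩

/-! ### Open orbits are nondegenerate -/

/-- A polynomial function of one real variable. -/
def IsPoly (f : ℝ → ℝ) : Prop := ∃ P : Polynomial ℝ, ∀ t, f t = P.eval t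

theorem isPoly_const (c : ℝ) : IsPoly fun _ => c := ⟨Polynomial.C c, by simp⟩

theorem isPoly_id : IsPoly fun t => t := ⟨Polynomial.X, by simp⟩

theorem IsPoly.add {f g : ℝ → ℝ} (hf : IsPoly f) (hg : IsPoly g) : IsPoly fun t => f t + g t := by
  obtain ⟨P, hP⟩ := hf
  obtain ⟨R, hR⟩ := hg
  exact ⟨P + R, fun t => by simp [hP, hR]⟩

theorem IsPoly.mul {f g : ℝ → ℝ} (hf : IsPoly f) (hg : IsPoly g) : IsPoly fun t => f t * g t := by
  obtain ⟨P, hP⟩ := hf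
  obtain ⟨R, hR⟩ := hg
  exact ⟨P * R, fun t => by simp [hP, hR]⟩

theorem IsPoly.sum {ι : Type*} (s : Finset ι) {f : ι → ℝ → ℝ} (hf : ∀ i, IsPoly (f i)) :
    IsPoly fun t => ∑ i ∈ s, f i t := by
  choose P hP using hf
  exact ⟨∑ i ∈ s, P i, fun t => by simp [Polynomial.eval_finsetSum, hP]⟩

theorem IsPoly.det {ι : Type*} [Fintype ι] [DecidableEq ι] {A : ℝ → Matrix ι ι ℝ}
    (hA : ∀ i j, IsPoly fun t => A t i j) : IsPoly fun t => (A t).det := by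
  choose P hP using hA
  refine ⟨(Matrix.of P).det, fun t => ?_⟩
  rw [← Polynomial.coe_evalRingHom, RingHom.map_det]
  refine congrArg Matrix.det (Matrix.ext fun i j => ?_)
  simp [hP]

/-- One nonzero value leaves only finitely many zeros. The point t₀ itself may be a zero, hence the
punctured neighbourhood. -/
theorem IsPoly.eventually_ne {f : ℝ → ℝ} (hf : IsPoly f) {t₁ : ℝ} (h : f t₁ ≠ 0) (t₀ : ℝ) :
    ∀ᶠ t in nhdsWithin t₀ {t₀}ᶜ, f t ≠ 0 := by
  obtain ⟨P, hP⟩ := hf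
  have hP0 : P ≠ 0 := by
    rintro rfl
    exact h (by rw [hP, Polynomial.eval_zero])
  have hfin : {t | f t = 0}.Finite := by
    refine (P.roots.toFinset.finite_toSet).subset fun t ht => ?_
    rw [Finset.mem_coe, Multiset.mem_toFinset, Polynomial.mem_roots hP0, Polynomial.IsRoot, ← hP]
    exact ht
  have h2 : ({t | f t = 0} \ {t₀})ᶜ ∈ nhds t₀ :=
    (hfin.subset Set.sdiff_subset).isClosed.isOpen_compl.mem_nhds (by simp)
  filter_upwards [mem_nhdsWithin_of_mem_nhds h2, self_mem_nhdsWithin] with t ht ht0 h0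
  exact ht ⟨h0, ht0⟩

open Classical in
/-- The Gram matrix of the images of the negative basis vectors under `extend T N`, completed by
an identity block. -/
def gram {T : Finset (Idx q)} (N : Matrix T T ℝ) : Matrix T T ℝ :=
  Matrix.of fun i j => if (i : Idx q) ∈ ID (-1) ∧ (j : Idx q) ∈ ID (-1) then
    ∑ k : T, sgn (k : Idx q) * (N k i * N k j) else if i = j then 1 else 0

theorem B_extend_e {T : Finset (Idx q)} (N : Matrix T T ℝ) (i j : T) :
    B (extend T N (e (i : Idx q))) (extend T N (e (j : Idx q))) =
      ∑ k : T, sgn (k : Idx q) * (N k i * N k j) := by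
  rw [B_self_eq ((suppIn_extend T N).2 _ i.2), ← Finset.sum_coe_sort]
  exact Finset.sum_congr rfl fun k _ => by rw [co_extend, co_extend]

/-- Let y in V₋ have its image in the radical. Pairing with the eⱼ of negative square outside T
shows that y is supported in T; pairing with the images of those inside T shows that its coordinate
vector is in the kernel of the Gram matrix. The identity block takes care of the positive indices,
where y vanishes. -/
theorem nondeg_of_gram {T : Finset (Idx q)} {N : Matrix T T ℝ} (hG : (gram N).det ≠ 0) :
    Nondeg ((Vs (ID (-1))).map (extend T N)) := by
  rintro _ ⟨y, hy, rfl⟩ hperp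
  have hs := suppIn_extend T N
  have hyT : y ∈ Vs (T : Set (Idx q)) := mem_Vs.2 fun j hj => by
    by_cases hjm : j ∈ ID (-1)
    · have h1 := hperp (extend T N (e j)) ⟨e j, e_mem_Vs.2 hjm, rfl⟩
      rw [hs.1 j hj, B_e_right, hs.co_eq hj] at h1
      exact (mul_eq_zero.1 h1).resolve_left (sgn_ne_zero j)
    · exact mem_Vs.1 hy j hjm
  have hysum : y = ∑ i : T, co (i : Idx q) y • e (i : Idx q) := by
    refine ext_co fun j => ?_
    simp only [map_sum, map_smul, smul_eq_mul]
    by_cases hj : j ∈ T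
    · rw [Finset.sum_eq_single (⟨j, hj⟩ : T)]
      · simp
      · intro k _ hk
        rw [co_e_ne fun h => hk (Subtype.ext h.symm), mul_zero]
      · simp
    · rw [mem_Vs.1 hyT j hj]
      exact (Finset.sum_eq_zero fun k _ => by
        rw [co_e_ne fun h : j = k => hj (h ▸ k.2), mul_zero]).symm
  have hmul : (gram N).mulVec (fun i => co (i : Idx q) y) = 0 := by
    funext i
    rw [Matrix.mulVec, dotProduct, Pi.zero_apply]
    by_cases hi : (i : Idx q) ∈ ID (-1)
    · have h1 := hperp (extend T N (e (i : Idx q))) ⟨_, e_mem_Vs.2 hi, rfl⟩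
      conv at h1 => 
        lhs
        rw [hysum]
      simp only [map_sum, map_smul, LinearMap.sum_apply, LinearMap.smul_apply, smul_eq_mul] at h1
      rw [← h1]
      refine Finset.sum_congr rfl fun j _ => ?_
      by_cases hj : (j : Idx q) ∈ ID (-1)
      · simp only [gram, Matrix.of_apply, if_pos (And.intro hi hj)]
        rw [B_comm, B_extend_e, mul_comm]
      · rw [mem_Vs.1 hy j hj, mul_zero, zero_mul]
    · have hyi := mem_Vs.1 hy i hi
      rw [← hyi, Finset.sum_eq_single i]
      · simp [gram, hi]
      · intro j _ hj
        simp [gram, hi, Ne.symm hj]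
      · simp
  have hv := Matrix.eq_zero_of_mulVec_eq_zero hG hmul
  have : y = 0 := by
    rw [hysum]
    exact Finset.sum_eq_zero fun i _ => by rw [congrFun hv i, Pi.zero_apply, zero_smul]
  rw [this, map_zero]

theorem det_gram_one (T : Finset (Idx q)) : (gram (1 : Matrix T T ℝ)).det ≠ 0 := by
  classical
  have h : gram (1 : Matrix T T ℝ) = Matrix.diagonal fun i : T =>
      if (i : Idx q) ∈ ID (-1) then sgn (i : Idx q) else 1 := by
    ext i j
    simp only [gram, Matrix.of_apply, Matrix.one_apply, Matrix.diagonal_apply]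
    by_cases hij : i = j
    · subst hij
      by_cases hi : (i : Idx q) ∈ ID (-1) <;> simp [hi]
    · have : ∀ k : T, sgn (k : Idx q) * ((if k = i then (1 : ℝ) else 0) *
          if k = j then 1 else 0) = 0 := fun k => by
        by_cases hk : k = i
        · subst hk; simp [hij]
        · simp [hk]
      simp [hij, Ne.symm hij]
  rw [h, Matrix.det_diagonal, Finset.prod_ne_zero_iff]
  intro i _
  split_ifs
  exacts [sgn_ne_zero _, one_ne_zero]

/-- Move the representing matrix M along the line towards 1, where V₋ is nondegenerate. The Gram
determinant is a polynomial in t that is nonzero at t = 1, so it is nonzero for small t ≠ 0. For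
small t the point is still in the orbit of F, and isometries preserve nondegeneracy. -/
theorem nondeg_of_isOpen {F : Submodule ℝ (V q)} (hF : InOrbit F)
    (hD : IsOpen {g : SL q | ∃ h ∈ SO q, translate g (Vs (ID (-1))) = translate h F}) :
    Nondeg F := by
  obtain ⟨g, rfl⟩ := hF
  obtain ⟨T₀, hT₀⟩ := exists_stage_of_superset g
  set T : Finset (Idx q) := insert (Sum.inl 0) T₀ with hT
  obtain ⟨M, rfl⟩ := hT₀ T (Finset.subset_insert _ _)
  set i₀ : T := ⟨Sum.inl 0, Finset.mem_insert_self _ _⟩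
  -- The segment (1 - t)M + t·1, with 1 - t written by sums and products to match the closure
  -- properties of `IsPoly`.
  set N : ℝ → Matrix T T ℝ := fun t => Matrix.of fun i j =>
    (1 + t * (-1)) * (M : Matrix T T ℝ) i j + t * (1 : Matrix T T ℝ) i j with hN
  have hN0 : N 0 = (M : Matrix T T ℝ) := by
    ext i j; simp [hN]
  have hN1 : N 1 = 1 := by
    ext i j; simp [hN]
  have hpN : ∀ i j, IsPoly fun t => N t i j := fun i j =>
    (((isPoly_const 1).add (isPoly_id.mul (isPoly_const (-1)))).mul (isPoly_const _)).add
      (isPoly_id.mul (isPoly_const _))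
  have hpG : ∀ i j, IsPoly fun t => gram (N t) i j := fun i j => by
    simp only [gram, Matrix.of_apply]
    split_ifs
    · exact IsPoly.sum _ fun k => (isPoly_const _).mul ((hpN k i).mul (hpN k j))
    · exact isPoly_const 1
    · exact isPoly_const 0
  have hdM : (M : Matrix T T ℝ).det = 1 := M.2
  have e1 := (IsPoly.det hpN).eventually_ne (t₁ := 0)
    (by rw [hN0, hdM]; exact one_ne_zero) 0
  have e2 := (IsPoly.det hpG).eventually_ne (t₁ := 1)
    (by rw [hN1]; exact det_gram_one T) 0
  have hcN : ∀ i j, Continuous fun t => N t i j := fun i j => by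
    simp only [hN, Matrix.of_apply]
    fun_prop
  have hcont : ContinuousAt (fun t => stage T (normalize i₀ (N t))) 0 := by
    -- At singular matrices `normalize` takes the default value 1, so continuity holds only on this
    -- open set, which contains t = 0.
    have hopen : IsOpen {t | (N t).det ≠ 0} := by
      refine isOpen_ne_fun ?_ continuous_const
      rw [← continuousOn_univ]
      exact continuousOn_det fun i j => (hcN i j).continuousOn
    have h0 : (0 : ℝ) ∈ {t | (N t).det ≠ 0} := by
      rw [Set.mem_ofPred_eq, hN0, hdM]; exact one_ne_zero
    exact (continuous_stage T).continuousAt.comp ((continuousOn_normalize i₀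
      (fun i j => (hcN i j).continuousOn) fun t ht => ht).continuousAt (hopen.mem_nhds h0))
  have hmem : stage T (normalize i₀ (N 0)) ∈
      {g : SL q | ∃ h ∈ SO q, translate g (Vs (ID (-1))) =
        translate h (translate (stage T M) (Vs (ID (-1))))} := by
    rw [hN0, normalize_of_det_eq_one]
    exact ⟨1, isSub_SO.1, (translate_one _).symm⟩
  have e3 := hcont.eventually (hD.mem_nhds hmem)
  obtain ⟨t, ht1, ht2, h, hh, hE⟩ := (e1.and (e2.and (e3.filter_mono nhdsWithin_le_nhds))).exists
  rw [translate_normalize i₀ ht1] at hE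
  have := (nondeg_of_gram ht2)
  rw [hE] at this
  have h2 := this.translate (isSub_SO.2.1 h hh)
  rwa [translate_inv_translate] at h2

theorem IsOpenOrbit.exists_eq {D : Set (Submodule ℝ (V q))} (hD : IsOpenOrbit D) :
    ∃ F, InOrbit F ∧ Nondeg F ∧ D = {F' | ∃ g ∈ SO q, F' = translate g F} := by
  obtain ⟨⟨F, hF, rfl⟩, hopen⟩ := hD
  have hFO := exists_translate_of_mem_Grass hF
  refine ⟨F, hFO, nondeg_of_isOpen hFO ?_, rfl⟩
  have := isOpen_coinduced.1 hopen
  rw [Vminus_eq] at this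
  exact this

theorem IsOpenOrbit.exists_compatible {D : Set (Submodule ℝ (V q))} (hD : IsOpenOrbit D) :
    ∃ F ∈ D, Compatible F := by
  obtain ⟨F, ⟨g, rfl⟩, hN, rfl⟩ := hD.exists_eq
  obtain ⟨T, hT⟩ := exists_suppIn g
  obtain ⟨h, hh, S, -, -, hE⟩ := hN.exists_coordinate hT
  exact ⟨_, ⟨h, hh, rfl⟩, _, Set.image_subset_range e _, hE⟩

theorem IsOpenOrbit.inOrbit {D : Set (Submodule ℝ (V q))} (hD : IsOpenOrbit D)
    {F : Submodule ℝ (V q)} (hF : F ∈ D) : InOrbit F := by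
  obtain ⟨F₀, hF₀, -, rfl⟩ := hD.exists_eq
  obtain ⟨g, -, rfl⟩ := hF
  exact hF₀.translate g

/-- Signature is a complete invariant of G₀ on nondegenerate translates of V₋. Membership in D thus
becomes a condition that makes sense for gF' with arbitrary g in G. -/
theorem IsOpenOrbit.mem_iff {D : Set (Submodule ℝ (V q))} (hD : IsOpenOrbit D)
    {F : Submodule ℝ (V q)} (hF : F ∈ D) (hfit : Fits F) {F' : Submodule ℝ (V q)} :
    F' ∈ D ↔ InOrbit F' ∧ HasType (posDim F) F' := by
  have hFO := hD.inOrbit hF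
  have hty := hfit.hasType hFO
  constructor
  · intro hF'
    refine ⟨hD.inOrbit hF', ?_⟩
    obtain ⟨F₀, -, -, rfl⟩ := hD.exists_eq
    obtain ⟨g, hg, rfl⟩ := hF
    obtain ⟨g', hg', rfl⟩ := hF'
    have := (hty.translate (isSub_SO.2.1 g hg)).translate hg'
    rwa [translate_inv_translate] at this
  · rintro ⟨hF'O, hF'⟩
    obtain ⟨h, hh, rfl⟩ := hty.exists_translate hFO hF'O hF'
    obtain ⟨F₀, -, -, rfl⟩ := hD.exists_eq
    obtain ⟨g, hg, rfl⟩ := hF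
    exact ⟨h * g, isSub_SO.2.2 h hh g hg, (translate_mul h g F₀).symm⟩

/-- Describes the cycle without reference to K₀, so that elements of G outside K₀ can be tested for
stabilizing it. -/
theorem mem_baseCycle_iff {F : Submodule ℝ (V q)} (hF : InOrbit F) (hfit : Fits F)
    {F' : Submodule ℝ (V q)} :
    F' ∈ baseCycle F ↔ InOrbit F' ∧ Fits F' ∧ posDim F' = posDim F := by
  constructor
  · rintro ⟨k, hk, rfl⟩
    exact ⟨hF.translate k, hfit.translate (K_fix hk (Or.inl rfl)) (K_fix hk (Or.inr rfl)),
      posDim_translate hk⟩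
  · rintro ⟨h1, h2, h3⟩
    obtain ⟨k, hk, h⟩ := hfit.exists_translate hF h1 h2 h3.symm
    exact ⟨k, hk, h⟩

/-! ### Translates of the base cycle -/

theorem translateCycle_mul (Y : Set (Submodule ℝ (V q))) (g h : SL q) :
    translateCycle Y (g * h) = translateCycle (translateCycle Y h) g := by
  rw [translateCycle, translateCycle, translateCycle, Set.image_image]
  simp only [translate_mul]

theorem translateCycle_one (Y : Set (Submodule ℝ (V q))) : translateCycle Y 1 = Y := by
  rw [translateCycle]
  simp

theorem translateCycle_inv {Y : Set (Submodule ℝ (V q))} {m : SL q}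
    (h : translateCycle Y m = Y) : translateCycle Y m⁻¹ = Y := by
  conv_lhs => rw [← h]
  rw [← translateCycle_mul, inv_mul_cancel, translateCycle_one]

theorem translateCycle_eq_iff {Y : Set (Submodule ℝ (V q))} {g h : SL q} :
    translateCycle Y g = translateCycle Y h ↔ translateCycle Y (h⁻¹ * g) = Y := by
  constructor
  · intro H
    rw [translateCycle_mul, H, ← translateCycle_mul, inv_mul_cancel, translateCycle_one]
  · intro H
    conv_rhs => rw [← H]
    rw [← translateCycle_mul, mul_inv_cancel_left]

theorem translate_mem_of_translateCycle {Y : Set (Submodule ℝ (V q))} {m : SL q}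
    (h : translateCycle Y m = Y) {F : Submodule ℝ (V q)} (hF : F ∈ Y) : translate m F ∈ Y := by
  have : translate m F ∈ translateCycle Y m := ⟨F, hF, rfl⟩
  rwa [h] at this

theorem translateCycle_eq_of_forall {Y : Set (Submodule ℝ (V q))} {m : SL q}
    (h1 : ∀ F ∈ Y, translate m F ∈ Y) (h2 : ∀ F ∈ Y, translate m⁻¹ F ∈ Y) :
    translateCycle Y m = Y := by
  apply Set.Subset.antisymm
  · rintro _ ⟨F, hF, rfl⟩
    exact h1 F hF
  · intro F hF
    exact ⟨_, h2 F hF, translate_translate_inv m F⟩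

theorem translate_eq_of_le {m : SL q} {W : Submodule ℝ (V q)} (h1 : translate m W ≤ W)
    (h2 : translate m⁻¹ W ≤ W) : translate m W = W := by
  refine le_antisymm h1 ?_
  have := translate_mono (g := m) h2
  rwa [translate_translate_inv] at this

theorem translate_inv_eq {m : SL q} {W : Submodule ℝ (V q)} (h : translate m W = W) :
    translate m⁻¹ W = W := by
  conv_lhs => rw [← h]
  rw [translate_inv_translate]

theorem exists_mem_ID_neg (hq : 2 < q) : ∃ j : Idx q, j ∈ ID (-1) :=
  ⟨Sum.inr ⟨0, lt_of_le_of_lt (by simp) hq⟩, rfl⟩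

theorem InOrbit.ne_bot (hq : 2 < q) {F : Submodule ℝ (V q)} (hF : InOrbit F) : F ≠ ⊥ := by
  obtain ⟨g, rfl⟩ := hF
  obtain ⟨j, hj⟩ := exists_mem_ID_neg hq
  intro h
  have : toLin g (e j) ∈ RealCycle.translate g (Vs (ID (-1))) := apply_mem_translate.2 (e_mem_Vs.2 hj)
  rw [h, Submodule.mem_bot] at this
  exact e_ne_zero j (toLin_injective g (by rw [this, map_zero]))

theorem IsOpenOrbit.exists_translate {D : Set (Submodule ℝ (V q))} (hD : IsOpenOrbit D)
    {F F' : Submodule ℝ (V q)} (hF : F ∈ D) (hF' : F' ∈ D) :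
    ∃ h ∈ SO q, F' = translate h F := by
  obtain ⟨F₀, -, -, rfl⟩ := hD.exists_eq
  obtain ⟨g, hg, rfl⟩ := hF
  obtain ⟨g', hg', rfl⟩ := hF'
  refine ⟨g' * g⁻¹, isSub_SO.2.2 _ hg' _ (isSub_SO.2.1 _ hg), ?_⟩
  rw [translate_mul, translate_inv_translate]

/-! ### Positive definite base points -/

/-- The negative component of a vector of F lies in F again, where the form is positive, so it is
zero. -/
theorem Fits.le_of_cdef {F : Submodule ℝ (V q)} (h : Fits F) (hF : CDef 1 F) :
    F ≤ Vs (ID 1) := by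
  intro x hx
  obtain ⟨y, hy, z, hz, rfl⟩ := h x hx
  have hz0 : z = 0 := by
    refine hF.eq_zero hz.1 ?_
    have := (cdef_Vs (Or.inr rfl)).nonneg hz.2
    linarith
  rw [hz0, add_zero]
  exact hy.2

theorem Fits.le_of_cdef_neg {F : Submodule ℝ (V q)} (h : Fits F) (hF : CDef (-1) F) :
    F ≤ Vs (ID (-1)) := by
  intro x hx
  obtain ⟨y, hy, z, hz, rfl⟩ := h x hx
  have hy0 : y = 0 := by
    refine hF.eq_zero hy.1 ?_
    have := (cdef_Vs (Or.inl rfl)).nonneg hy.2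
    linarith
  rw [hy0, zero_add]
  exact hz.2

theorem fits_of_le {F : Submodule ℝ (V q)} (h : F ≤ Vs (ID 1)) : Fits F :=
  fun x hx => ⟨x, ⟨hx, h hx⟩, 0, Submodule.zero_mem _, add_zero x⟩

theorem baseCycle_le {F : Submodule ℝ (V q)} (hle : F ≤ Vs (ID 1)) {F' : Submodule ℝ (V q)}
    (h : F' ∈ baseCycle F) : F' ≤ Vs (ID 1) := by
  obtain ⟨k, hk, rfl⟩ := h
  rw [← K_fix hk (Or.inl rfl)]
  exact translate_mono hle

theorem translate_mem_baseCycle {F F' : Submodule ℝ (V q)} (h : F' ∈ baseCycle F) {k : SL q}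
    (hk : k ∈ K q) : translate k F' ∈ baseCycle F := by
  obtain ⟨l, hl, rfl⟩ := h
  exact ⟨k * l, isSub_K.2.2 k hk l hl, (translate_mul k l F).symm⟩

theorem Fits.exists_coordinate_mem {F : Submodule ℝ (V q)} (hF : InOrbit F) (hfit : Fits F) :
    ∃ S T : Finset (Idx q), S ⊆ T ∧ S.card = (ID (-1) ∩ (T : Set (Idx q))).ncard ∧
      Vs ((S : Set (Idx q)) ∪ (ID (-1) \ T)) ∈ baseCycle F := by
  obtain ⟨g, rfl⟩ := hF
  obtain ⟨T, hT⟩ := exists_suppIn g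
  obtain ⟨h, hh, S, hS, hSc, hE⟩ := hfit.exists_coordinate hT
  exact ⟨S, T, hS, hSc, h, hh, hE.symm⟩

/-- The cycle contains a nonzero coordinate subspace of V₊; rotate x to a line in it and rotate the
subspace back. The bound on q enters through V₋ ≠ 0, which makes the members nonzero. -/
theorem exists_mem_baseCycle_of_le (hq : 2 < q) {F : Submodule ℝ (V q)} (hF : InOrbit F)
    (hle : F ≤ Vs (ID 1)) {x : V q} (hx : x ∈ Vs (ID 1)) : ∃ F' ∈ baseCycle F, x ∈ F' := by
  have hfit := fits_of_le hle
  obtain ⟨S, T, -, -, hmem⟩ := hfit.exists_coordinate_mem hF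
  set S' := (S : Set (Idx q)) ∪ (ID (-1) \ T)
  have hne : S'.Nonempty := by
    by_contra hcon
    rw [Set.not_nonempty_iff_eq_empty.1 hcon, Vs_empty] at hmem
    exact ((mem_baseCycle_iff hF hfit).1 hmem).1.ne_bot hq rfl
  obtain ⟨i, hi⟩ := hne
  have hi1 : i ∈ ID 1 := e_mem_Vs.1 (baseCycle_le hle hmem (e_mem_Vs.2 hi))
  obtain ⟨h, hh, -, r, hr⟩ := exists_rotate_to_line' hi1 hx
  refine ⟨_, translate_mem_baseCycle hmem (isSub_K.2.1 h hh), mem_translate.2 ?_⟩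
  rw [inv_inv, hr]
  exact Submodule.smul_mem _ _ (e_mem_Vs.2 hi)

/-- The members of the cycle lie in V₊ and cover it, so a stabilizer of the cycle preserves V₊.
Conversely the cycle consists of all translates of V₋ inside V₊ of a given dimension, a class
preserved by every element that preserves V₊. -/
theorem translateCycle_eq_iff_of_le (hq : 2 < q) {F : Submodule ℝ (V q)} (hF : InOrbit F)
    (hle : F ≤ Vs (ID 1)) {m : SL q} :
    translateCycle (baseCycle F) m = baseCycle F ↔ translate m (Vs (ID 1)) = Vs (ID 1) := by
  have hfit := fits_of_le hle
  constructor
  · intro h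
    have key : ∀ m : SL q, translateCycle (baseCycle F) m = baseCycle F →
        translate m (Vs (ID 1)) ≤ Vs (ID 1) := by
      rintro m hm _ ⟨x, hx, rfl⟩
      obtain ⟨F', hF', hxF'⟩ := exists_mem_baseCycle_of_le hq hF hle hx
      exact baseCycle_le hle (translate_mem_of_translateCycle hm hF') ⟨x, hxF', rfl⟩
    exact translate_eq_of_le (key m h) (key m⁻¹ (translateCycle_inv h))
  · intro h
    have key : ∀ m : SL q, translate m (Vs (ID 1)) = Vs (ID 1) →
        ∀ F' ∈ baseCycle F, translate m F' ∈ baseCycle F := by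
      intro m hm F' hF'
      have hle' := baseCycle_le hle hF'
      have hmle : translate m F' ≤ Vs (ID 1) := by rw [← hm]; exact translate_mono hle'
      obtain ⟨h1, -, h3⟩ := (mem_baseCycle_iff hF hfit).1 hF'
      refine (mem_baseCycle_iff hF hfit).2 ⟨h1.translate m, fits_of_le hmle, ?_⟩
      rw [← h3, posDim, posDim, inf_eq_left.2 hmle, inf_eq_left.2 hle', finrank_translate]
    exact translateCycle_eq_of_forall (key m h) (key m⁻¹ (translate_inv_eq h))

/-- Every vector of gV₊ lies in some member of gY; members of D are isometric images of the positive
definite F. Conversely a member of gY lies in the positive definite gV₊ and has the right dimension.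
-/
theorem translateCycle_subset_iff_of_le (hq : 2 < q) {D : Set (Submodule ℝ (V q))}
    (hD : IsOpenOrbit D) {F : Submodule ℝ (V q)} (hFD : F ∈ D) (hle : F ≤ Vs (ID 1)) {g : SL q} :
    translateCycle (baseCycle F) g ⊆ D ↔ CDef 1 (translate g (Vs (ID 1))) := by
  have hF := hD.inOrbit hFD
  have hfit := fits_of_le hle
  constructor
  · rintro h _ ⟨x, hx, rfl⟩ hx0
    obtain ⟨F', hF', hxF'⟩ := exists_mem_baseCycle_of_le hq hF hle hx
    obtain ⟨k, hk, hE⟩ := hD.exists_translate hFD (h ⟨F', hF', rfl⟩)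
    have hdef : CDef 1 (translate g F') := by
      rw [hE]
      exact ((cdef_Vs (Or.inl rfl)).mono hle).translate hk
    exact hdef _ ⟨x, hxF', rfl⟩ hx0
  · rintro h _ ⟨F', hF', rfl⟩
    have hle' := baseCycle_le hle hF'
    obtain ⟨h1, -, h3⟩ := (mem_baseCycle_iff hF hfit).1 hF'
    refine (hD.mem_iff hFD hfit).2 ⟨h1.translate g, translate g F', ⊥, sup_bot_eq _,
      h.mono (translate_mono hle'), ?_, ?_, ?_⟩
    · intro x hx hx0
      exact absurd hx hx0
    · have := h1.finiteDimensional
      rw [inf_eq_left.2 hle'] at this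
      exact inferInstanceAs (FiniteDimensional ℝ (F'.map (toLin g)))
    · rw [finrank_translate, ← h3, posDim, inf_eq_left.2 hle']

/-! ### Negative definite base points -/

theorem inOrbit_Vs : InOrbit (Vs (ID (-1) : Set (Idx q))) := ⟨1, (translate_one _).symm⟩

theorem fits_Vs (S : Set (Idx q)) : Fits (Vs S) := by
  intro x hx
  obtain ⟨y, hy, z, hz, rfl⟩ := exists_add_of_sign x
  have := mem_Vs_of_add hy (by rw [ID_compl (Or.inl rfl)]; exact hz) hx
  exact ⟨y, ⟨this.1, hy⟩, z, ⟨this.2, hz⟩, rfl⟩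

theorem posDim_of_le {F : Submodule ℝ (V q)} (hle : F ≤ Vs (ID (-1))) : posDim F = 0 := by
  have : F ⊓ Vs (ID 1) = ⊥ := by
    refine le_bot_iff.1 ((inf_le_inf_right _ hle).trans ?_)
    rw [← Vs_inter, disjoint_ID.symm.inter_eq, Vs_empty]
  rw [posDim, this, finrank_bot]

/-- F and V₋ both have positive part 0, so they are conjugate under K₀, which fixes V₋. -/
theorem eq_Vs_of_le {F : Submodule ℝ (V q)} (hF : InOrbit F) (hfit : Fits F)
    (hle : F ≤ Vs (ID (-1))) : F = Vs (ID (-1)) := by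
  have h1 : Vs (ID (-1)) ∈ baseCycle F := (mem_baseCycle_iff hF hfit).2
    ⟨inOrbit_Vs, fits_Vs _, by rw [posDim_of_le hle, posDim_of_le le_rfl]⟩
  obtain ⟨k, hk, hE⟩ := h1
  have := K_fix (isSub_K.2.1 k hk) (Or.inr rfl)
  rwa [hE, translate_inv_translate, ← hE] at this

theorem baseCycle_Vs : baseCycle (Vs (ID (-1) : Set (Idx q))) = {Vs (ID (-1))} := by
  ext F'
  constructor
  · rintro ⟨k, hk, rfl⟩
    exact K_fix hk (Or.inr rfl)
  · rintro rfl
    exact ⟨1, isSub_K.1, (translate_one _).symm⟩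

theorem translateCycle_singleton (F : Submodule ℝ (V q)) (g : SL q) :
    translateCycle {F} g = {translate g F} := Set.image_singleton

theorem hasType_zero_iff {F : Submodule ℝ (V q)} : HasType 0 F ↔ CDef (-1) F := by
  constructor
  · rintro ⟨P, N, rfl, -, hN, _, hP⟩
    rw [Submodule.finrank_eq_zero.1 hP, bot_sup_eq]
    exact hN
  · intro h
    exact ⟨⊥, F, bot_sup_eq _, fun x hx hx0 => absurd hx hx0, h, inferInstance, finrank_bot _ _⟩

theorem mem_orbit_iff_cdef {D : Set (Submodule ℝ (V q))} (hD : IsOpenOrbit D)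
    (hFD : Vs (ID (-1)) ∈ D) {g : SL q} :
    translateCycle {Vs (ID (-1))} g ⊆ D ↔ CDef (-1) (translate g (Vs (ID (-1)))) := by
  rw [translateCycle_singleton, Set.singleton_subset_iff, hD.mem_iff hFD (fits_Vs _),
    posDim_of_le le_rfl, hasType_zero_iff]
  exact and_iff_right ⟨g, rfl⟩

/-! ### Indefinite base points -/

theorem infinite_ID : (ID 1 : Set (Idx q)).Infinite := by
  refine (Set.infinite_range_of_injective (f := fun n : ℕ => (Sum.inl n : Idx q))
    Sum.inl_injective).mono ?_
  rintro _ ⟨n, rfl⟩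
  rfl

/-- Because V₊ is infinite dimensional, k positive basis vectors can be chosen that are fixed by a
given element supported in T. -/
theorem exists_disjoint_finset (k : ℕ) (T : Finset (Idx q)) :
    ∃ A : Finset (Idx q), (A : Set (Idx q)) ⊆ ID 1 ∧ A.card = k ∧ Disjoint A T := by
  obtain ⟨A, hA, hk⟩ := (infinite_ID.sdiff T.finite_toSet).exists_subset_card_eq k
  refine ⟨A, fun i hi => (hA hi).1, hk, Finset.disjoint_left.2 fun i hi => (hA hi).2⟩

/-- The coordinate subspaces that arise from `(V₀)₋` by exchanging basis vectors. -/
theorem exchange_mem_baseCycle {F : Submodule ℝ (V q)} (hF : InOrbit F) (hfit : Fits F)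
    {A C : Finset (Idx q)} (hA : (A : Set (Idx q)) ⊆ ID 1) (hC : (C : Set (Idx q)) ⊆ ID (-1))
    (hAc : A.card = posDim F) (hCc : C.card = posDim F) :
    Vs ((A : Set (Idx q)) ∪ (ID (-1) \ C)) ∈ baseCycle F := by
  classical
  have hAm : Disjoint (A : Set (Idx q)) (ID (-1)) := disjoint_ID.mono_left hA
  refine (mem_baseCycle_iff hF hfit).2 ⟨?_, fits_Vs _, ?_⟩
  · have h1 : (ID (-1) ∩ ((A ∪ C : Finset (Idx q)) : Set (Idx q))) = C := by
      rw [Finset.coe_union, Set.inter_union_distrib_left, hAm.symm.inter_eq, Set.empty_union,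
        Set.inter_eq_right.2 hC]
    have h2 : ID (-1) \ ((A ∪ C : Finset (Idx q)) : Set (Idx q)) = ID (-1) \ C := by
      rw [Finset.coe_union, ← Set.sdiff_sdiff, hAm.symm.sdiff_eq_left]
    obtain ⟨g, hg⟩ := exists_translate_eq (T := A ∪ C) (s := ID (-1)) (A := Vs (A : Set (Idx q)))
      (Vs_mono (by simp)) (by
        rw [finrank_Vs, h1, Set.ncard_coe_finset, hAc, hCc])
    rw [h2, ← Vs_union] at hg
    exact ⟨g, hg⟩
  · have h3 : ((A : Set (Idx q)) ∪ (ID (-1) \ C)) ∩ ID 1 = A := by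
      rw [union_inter_ID, Set.inter_eq_left.2 hA]
    rw [posDim_Vs (by rw [h3]; exact A.finite_toSet), h3, Set.ncard_coe_finset, hAc]

/-- C consists of the negative indices missing from a coordinate member of the cycle. As many
indices are gained on the positive side as are lost on the negative one, and a negative index j
survives because F has a nonzero negative part. -/
theorem exists_exchange {F : Submodule ℝ (V q)} (hF : InOrbit F) (hfit : Fits F)
    (hneg : F ⊓ Vs (ID (-1)) ≠ ⊥) :
    ∃ C : Finset (Idx q), (C : Set (Idx q)) ⊆ ID (-1) ∧ C.card = posDim F ∧
      ∃ j ∈ ID (-1), j ∉ C := by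
  classical
  obtain ⟨S, T, hST, hcard, hmem⟩ := hfit.exists_coordinate_mem hF
  have hk : posDim F = ((S : Set (Idx q)) ∩ ID 1).ncard := by
    rw [← ((mem_baseCycle_iff hF hfit).1 hmem).2.2, posDim_Vs, union_inter_ID]
    rw [union_inter_ID]; exact S.finite_toSet.inter_of_left _
  have hm : ((S : Set (Idx q)) ∩ ID 1).ncard + ((S : Set (Idx q)) ∩ ID (-1)).ncard = S.card := by
    rw [← ID_compl (Or.inl rfl), ← Set.sdiff_eq,
      Set.ncard_inter_add_ncard_sdiff_eq_ncard _ _ S.finite_toSet, Set.ncard_coe_finset]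
  have hfin : (ID (-1) ∩ (T : Set (Idx q))).Finite := T.finite_toSet.inter_of_right _
  have hm2 := Set.ncard_inter_add_ncard_sdiff_eq_ncard (ID (-1) ∩ (T : Set (Idx q))) S hfin
  have h4 : ID (-1) ∩ (T : Set (Idx q)) ∩ S = (S : Set (Idx q)) ∩ ID (-1) := by
    rw [Set.inter_assoc, Set.inter_eq_right.2 (Finset.coe_subset.2 hST), Set.inter_comm]
  rw [h4] at hm2
  have hfin2 : ((ID (-1) ∩ (T : Set (Idx q))) \ S).Finite := hfin.subset Set.sdiff_subset
  refine ⟨hfin2.toFinset, ?_, ?_, ?_⟩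
  · rw [Set.Finite.coe_toFinset]
    exact fun i hi => hi.1.1
  · rw [← Set.ncard_eq_toFinset_card _ hfin2]
    omega
  · by_contra! hcon
    apply hneg
    obtain ⟨k, hk', hE⟩ := hmem
    have h5 : translate k (F ⊓ Vs (ID (-1))) = ⊥ := by
      rw [translate_inf, ← hE, K_fix hk' (Or.inr rfl), ← Vs_inter, ← Vs_empty]
      congr 1
      refine Set.eq_empty_of_forall_notMem fun j hj => ?_
      have h6 := hcon j hj.2
      rw [Set.Finite.mem_toFinset] at h6
      rcases hj.1 with h7 | h7
      · exact h6.2 h7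
      · exact h7.2 h6.1.2
    rw [← translate_inv_translate k (F ⊓ Vs (ID (-1))), h5]
    exact Submodule.map_bot _

/-- A positive and a negative vector can be rotated to given lines at the same time. -/
theorem exists_rotate_pair {i j : Idx q} (hi : i ∈ ID 1) (hj : j ∈ ID (-1)) {x z : V q}
    (hx : x ∈ Vs (ID 1)) (hz : z ∈ Vs (ID (-1))) :
    ∃ κ ∈ K q, (∃ r : ℝ, toLin κ x = r • e i) ∧ ∃ r : ℝ, toLin κ z = r • e j := by
  obtain ⟨h, hh, hs, r, hr⟩ := exists_rotate_to_line' hi hx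
  obtain ⟨k, hk, ks, t, ht⟩ := exists_rotate_to_line' hj hz
  have h1 : toLin h z = z := hs.map_eq (by rw [ID_compl (Or.inl rfl)]; exact hz)
  have h2 : toLin k (e i) = e i := ks.1 i (Set.disjoint_left.1 disjoint_ID hi)
  refine ⟨k * h, isSub_K.2.2 k hk h hh, ⟨r, ?_⟩, t, ?_⟩
  · rw [toLin_mul_apply, hr, map_smul, h2]
  · rw [toLin_mul_apply, h1, ht]

/-! ### Cycles through indefinite base points -/

section Indefinite

variable {F : Submodule ℝ (V q)} {A C : Finset (Idx q)}

/-- Rotate x within V₋ to the line of eⱼ, which lies in the exchanged coordinate subspace. This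
rotation fixes the positive basis vectors, so the span of A stays in the member. -/
theorem exists_mem_baseCycle_of_neg (hF : InOrbit F) (hfit : Fits F)
    (hA : (A : Set (Idx q)) ⊆ ID 1) (hC : (C : Set (Idx q)) ⊆ ID (-1))
    (hAc : A.card = posDim F) (hCc : C.card = posDim F) {j : Idx q} (hj : j ∈ ID (-1))
    (hjC : j ∉ C) {x : V q} (hx : x ∈ Vs (ID (-1))) :
    ∃ F' ∈ baseCycle F, x ∈ F' ∧ Vs (A : Set (Idx q)) ≤ F' := by
  obtain ⟨h, hh, hs, r, hr⟩ := exists_rotate_to_line' hj hx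
  have hmem := exchange_mem_baseCycle hF hfit hA hC hAc hCc
  refine ⟨_, translate_mem_baseCycle hmem (isSub_K.2.1 h hh), mem_translate.2 ?_,
    Vs_le.2 fun a ha => mem_translate.2 ?_⟩
  · rw [inv_inv, hr]
    exact Submodule.smul_mem _ _ (e_mem_Vs.2 (Or.inr ⟨hj, hjC⟩))
  · rw [inv_inv, hs.1 a (Set.disjoint_left.1 disjoint_ID (hA ha))]
    exact e_mem_Vs.2 (Or.inl ha)

theorem mem_Vs_compl_of_suppIn {T : Finset (Idx q)} {g : SL q}
    (hT : SuppIn (T : Set (Idx q)) (toLin g)) (hA : (A : Set (Idx q)) ⊆ ID 1)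
    (hAT : Disjoint A T) {x : V q} (hx : x ∈ Vs (ID (-1))) :
    toLin g x ∈ Vs (A : Set (Idx q))ᶜ := by
  refine mem_Vs.2 fun a ha => ?_
  have ha' : a ∈ A := by simpa using ha
  rw [hT.co_eq (Finset.disjoint_left.1 hAT ha')]
  exact mem_Vs.1 hx a (Set.disjoint_left.1 disjoint_ID (hA ha'))

theorem Vs_le_translate {T : Finset (Idx q)} {g : SL q}
    (hT : SuppIn (T : Set (Idx q)) (toLin g)) (hAT : Disjoint A T) {F' : Submodule ℝ (V q)}
    (h : Vs (A : Set (Idx q)) ≤ F') : Vs (A : Set (Idx q)) ≤ translate g F' := by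
  refine Vs_le.2 fun a ha => ?_
  rw [← hT.1 a (Finset.disjoint_left.1 hAT ha)]
  exact apply_mem_translate.2 (h (e_mem_Vs.2 ha))

/-- Take A outside the support of g, so that a member gF' of gY contains both the span of A and gx.
If B(gx, gx) ≥ 0, these two span a positive semidefinite subspace of dimension k + 1, since gx has
no coordinates in A. That exceeds the signature of gF'. -/
theorem cdef_neg_of_translateCycle_subset {D : Set (Submodule ℝ (V q))} (hD : IsOpenOrbit D)
    (hFD : F ∈ D) (hfit : Fits F) (hneg : F ⊓ Vs (ID (-1)) ≠ ⊥) {g : SL q}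
    (hg : translateCycle (baseCycle F) g ⊆ D) : CDef (-1) (translate g (Vs (ID (-1)))) := by
  have hF := hD.inOrbit hFD
  obtain ⟨C, hC, hCc, j, hj, hjC⟩ := exists_exchange hF hfit hneg
  obtain ⟨T, hT⟩ := exists_suppIn g
  obtain ⟨A, hA, hAc, hAT⟩ := exists_disjoint_finset (posDim F) T
  rintro _ ⟨x, hx, rfl⟩ hx0
  by_contra hcon
  obtain ⟨F', hF', hxF', hAF'⟩ := exists_mem_baseCycle_of_neg hF hfit hA hC hAc hCc hj hjC hx
  have htype := ((hD.mem_iff hFD hfit).1 (hg ⟨F', hF', rfl⟩)).2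
  have hgx := mem_Vs_compl_of_suppIn hT hA hAT hx
  have horth : ∀ u ∈ Vs (A : Set (Idx q)), B u (toLin g x) = 0 := fun u hu =>
    B_eq_zero_of_disjoint disjoint_compl_right hu hgx
  have hfd : FiniteDimensional ℝ (Vs (A : Set (Idx q))) := finiteDimensional_Vs A
  have hle := htype.finrank_le (Q := Vs (A : Set (Idx q)) ⊔ Submodule.span ℝ {toLin g x})
    (sup_le (Vs_le_translate hT hAT hAF') (by
      rw [Submodule.span_singleton_le_iff_mem]
      exact apply_mem_translate.2 hxF')) (by
      intro y hy
      obtain ⟨u, hu, v, hv, rfl⟩ := Submodule.mem_sup.1 hy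
      obtain ⟨r, rfl⟩ := Submodule.mem_span_singleton.1 hv
      have h1 := horth u hu
      have h2 := (cdef_Vs (Or.inl rfl)).nonneg (Vs_mono hA hu)
      simp only [map_add, map_smul, LinearMap.add_apply, LinearMap.smul_apply, smul_eq_mul, h1,
        B_comm (toLin g x) u]
      nlinarith [sq_nonneg r])
  have hinf : Vs (A : Set (Idx q)) ⊓ Submodule.span ℝ {toLin g x} = ⊥ := by
    refine le_bot_iff.1 ((inf_le_inf_left _ ((Submodule.span_singleton_le_iff_mem _ _).2 hgx)).trans ?_)
    rw [← Vs_inter, Set.inter_compl_self, Vs_empty]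
  have hsum := Submodule.finrank_sup_add_finrank_inf_eq (Vs (A : Set (Idx q)))
    (Submodule.span ℝ {toLin g x})
  rw [hinf, finrank_bot, finrank_Vs, finrank_span_singleton hx0, hAc] at hsum
  omega

/-- Suppose x in V₊ has B(gx, gx) ≤ 0. Choose a member of Y that contains x and whose negative part
N satisfies gN ⊥ gx. Since gN is negative definite by the previous result, the span of gx and gN is
negative semidefinite, and only k - 1 further dimensions are left in that member of gY. But it lies
in D and has a positive definite subspace of dimension k. -/
theorem cdef_pos_of_translateCycle_subset {D : Set (Submodule ℝ (V q))} (hD : IsOpenOrbit D)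
    (hFD : F ∈ D) (hfit : Fits F) (hneg : F ⊓ Vs (ID (-1)) ≠ ⊥) (hpos : posDim F ≠ 0) {g : SL q}
    (hg : translateCycle (baseCycle F) g ⊆ D) : CDef 1 (translate g (Vs (ID 1))) := by
  classical
  have hF := hD.inOrbit hFD
  have hgneg := cdef_neg_of_translateCycle_subset hD hFD hfit hneg hg
  obtain ⟨C, hC, hCc, -⟩ := exists_exchange hF hfit hneg
  obtain ⟨A, hA, hAc, -⟩ := exists_disjoint_finset (q := q) (posDim F) ∅
  obtain ⟨i, hi⟩ := Finset.card_pos.1 (Nat.pos_of_ne_zero (hAc ▸ hpos))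
  obtain ⟨j, hj⟩ := Finset.card_pos.1 (Nat.pos_of_ne_zero (hCc ▸ hpos))
  rintro _ ⟨x, hx, rfl⟩ hx0
  by_contra hcon
  obtain ⟨T, M, rfl⟩ := exists_stage g
  set g := stage T M with hgdef
  -- For u in V₋, B(gu, gx) = B(u, g*gx) = B(u, z), so it is enough to make N orthogonal to z.
  obtain ⟨y, hy, z, hz, hyz⟩ := exists_add_of_sign (extend T (adj (M : Matrix T T ℝ)) (toLin g x))
  -- κ sends x to the line of eᵢ with i in A and z to that of eⱼ with j in C. The coordinate
  -- subspace of A ∪ (negative indices outside C) contains eᵢ, and its negative part is orthogonal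
  -- to eⱼ.
  obtain ⟨κ, hκ, ⟨r, hr⟩, s, hs⟩ := exists_rotate_pair (hA hi) (hC hj) hx hz
  have hmem := translate_mem_baseCycle (exchange_mem_baseCycle hF hfit hA hC hAc hCc)
    (isSub_K.2.1 κ hκ)
  set N := translate κ⁻¹ (Vs (ID (-1) \ (C : Set (Idx q)))) with hN
  have hNle : N ≤ Vs (ID (-1)) := by
    rw [← K_fix (isSub_K.2.1 κ hκ) (Or.inr rfl)]
    exact translate_mono (Vs_mono Set.sdiff_subset)
  have horth : ∀ u ∈ N, B (toLin g u) (toLin g x) = 0 := by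
    intro u hu
    have h1 : B u y = 0 := B_eq_zero_of_disjoint disjoint_ID.symm (hNle hu) hy
    have h2 : B u z = 0 := by
      rw [← SO_isometry (K_subset_SO hκ), hs, map_smul, B_e_right]
      rw [hN, mem_translate, inv_inv] at hu
      rw [mem_Vs.1 hu j fun h => h.2 hj, mul_zero, smul_zero]
    rw [hgdef, toLin_stage, B_extend, ← toLin_stage, ← hgdef, ← hyz, map_add, h1, h2, add_zero]
  obtain ⟨P, N', hPN, hP, -, hfd, hrank⟩ := ((hD.mem_iff hFD hfit).1 (hg ⟨_, hmem, rfl⟩)).2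
  set Q := translate g (translate κ⁻¹ (Vs ((A.erase i : Finset (Idx q)) : Set (Idx q)))) with hQ
  have hfd' : FiniteDimensional ℝ Q := by
    have := finiteDimensional_Vs (A.erase i)
    rw [hQ, ← translate_mul]
    exact inferInstanceAs (FiniteDimensional ℝ ((Vs _).map (toLin _)))
  have hQrank : finrank ℝ Q = posDim F - 1 := by
    rw [hQ, finrank_translate, finrank_translate, finrank_Vs, Finset.card_erase_of_mem hi, hAc]
  have hline : Vs {i} ≤ Submodule.span ℝ {toLin κ x} := by
    refine Vs_le.2 fun l hl => ?_
    obtain rfl : l = i := hl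
    have hr0 : r ≠ 0 := by
      rintro rfl
      rw [zero_smul] at hr
      have hx0' : x = 0 := toLin_injective κ (by rw [hr, map_zero])
      exact hx0 (by rw [hx0', map_zero])
    rw [hr]
    exact Submodule.mem_span_singleton.2 ⟨r⁻¹, by rw [smul_smul, inv_mul_cancel₀ hr0, one_smul]⟩
  have hcover : P ≤ Q ⊔ (Submodule.span ℝ {toLin g x} ⊔ translate g N) := by
    have h1 : (A : Set (Idx q)) ∪ (ID (-1) \ C) =
        ((A.erase i : Finset (Idx q)) : Set (Idx q)) ∪ ({i} ∪ (ID (-1) \ C)) := by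
      rw [← Set.union_assoc, Finset.coe_erase, Set.sdiff_union_self,
        Set.union_eq_self_of_subset_right (Set.singleton_subset_iff.2 hi)]
    have h2 : translate κ⁻¹ (Submodule.span ℝ {toLin κ x}) = Submodule.span ℝ {x} := by
      rw [RealCycle.translate, Submodule.map_span, Set.image_singleton, toLin_inv_apply]
    have h3 : translate g (Submodule.span ℝ {x}) = Submodule.span ℝ {toLin g x} := by
      rw [RealCycle.translate, Submodule.map_span, Set.image_singleton]
    refine (le_sup_left.trans hPN.le).trans ?_
    rw [h1, Vs_union, Vs_union, translate_sup, translate_sup, translate_sup, translate_sup, ← hN,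
      ← hQ, ← h3, ← h2]
    exact sup_le_sup_left (sup_le_sup_right (translate_mono (translate_mono hline)) _) _
  have hinf : P ⊓ (Submodule.span ℝ {toLin g x} ⊔ translate g N) = ⊥ := by
    rw [Submodule.eq_bot_iff]
    rintro w ⟨hwP, hw⟩
    obtain ⟨u, hu, v, hv, rfl⟩ := Submodule.mem_sup.1 hw
    obtain ⟨a, rfl⟩ := Submodule.mem_span_singleton.1 hu
    obtain ⟨v, hv, rfl⟩ := hv
    refine hP.eq_zero hwP ?_
    have h1 := horth v hv
    have h2 := hgneg.nonneg (apply_mem_translate.2 (hNle hv))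
    simp only [map_add, map_smul, LinearMap.add_apply, LinearMap.smul_apply, smul_eq_mul, h1,
      B_comm (toLin g x) (toLin g v)]
    nlinarith [sq_nonneg a]
  have := finrank_le_of_le_sup hcover hinf
  omega

theorem translateCycle_subset_iff {D : Set (Submodule ℝ (V q))} (hD : IsOpenOrbit D)
    (hFD : F ∈ D) (hfit : Fits F) (hneg : F ⊓ Vs (ID (-1)) ≠ ⊥) (hpos : posDim F ≠ 0)
    {g : SL q} :
    translateCycle (baseCycle F) g ⊆ D ↔
      CDef 1 (translate g (Vs (ID 1))) ∧ CDef (-1) (translate g (Vs (ID (-1)))) := by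
  constructor
  · exact fun h => ⟨cdef_pos_of_translateCycle_subset hD hFD hfit hneg hpos h,
      cdef_neg_of_translateCycle_subset hD hFD hfit hneg h⟩
  · rintro ⟨h1, h2⟩ _ ⟨F', hF', rfl⟩
    obtain ⟨ho, hf, hd⟩ := (mem_baseCycle_iff (hD.inOrbit hFD) hfit).1 hF'
    have hfd := ho.finiteDimensional
    refine (hD.mem_iff hFD hfit).2 ⟨ho.translate g, translate g (F' ⊓ Vs (ID 1)),
      translate g (F' ⊓ Vs (ID (-1))), ?_, h1.mono (translate_mono inf_le_right),
      h2.mono (translate_mono inf_le_right),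
      inferInstanceAs (FiniteDimensional ℝ ((F' ⊓ Vs (ID 1)).map (toLin g))), ?_⟩
    · rw [← translate_sup]
      congr 1
      have := fitsSplitting_iff.2 hf
      rw [FitsSplitting, Vplus_eq, Vminus_eq] at this
      exact this.symm
    · rw [finrank_translate, ← hd, posDim]

/-- Members of the cycle are characterized by the splitting and the dimension k, so preserving both
summands is sufficient. For necessity, V₋ is treated first with fixed positive basis vectors, then
V₊ with a member that avoids a prescribed negative direction. -/
theorem translateCycle_eq_iff_fix (hF : InOrbit F) (hfit : Fits F)
    (hneg : F ⊓ Vs (ID (-1)) ≠ ⊥) (hpos : posDim F ≠ 0) {m : SL q} :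
    translateCycle (baseCycle F) m = baseCycle F ↔
      translate m (Vs (ID 1)) = Vs (ID 1) ∧ translate m (Vs (ID (-1))) = Vs (ID (-1)) := by
  classical
  obtain ⟨C, hC, hCc, j, hj, hjC⟩ := exists_exchange hF hfit hneg
  constructor
  · have key : ∀ m : SL q, translateCycle (baseCycle F) m = baseCycle F →
        translate m (Vs (ID (-1))) ≤ Vs (ID (-1)) := by
      rintro m hm _ ⟨x, hx, rfl⟩
      obtain ⟨T, hT⟩ := exists_suppIn m
      obtain ⟨A, hA, hAc, hAT⟩ := exists_disjoint_finset (posDim F) T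
      obtain ⟨F', hF', hxF', hAF'⟩ :=
        exists_mem_baseCycle_of_neg hF hfit hA hC hAc hCc hj hjC hx
      obtain ⟨ho, hf, hd⟩ :=
        (mem_baseCycle_iff hF hfit).1 (translate_mem_of_translateCycle hm hF')
      have hfd := ho.finiteDimensional
      -- The span of A is fixed by m and already has dimension k, so it is the whole positive part
      -- of mF'. But mx has no coordinates in A, hence its positive component vanishes.
      have hEq : Vs (A : Set (Idx q)) = translate m F' ⊓ Vs (ID 1) :=
        Submodule.eq_of_le_of_finrank_eq
          (le_inf (Vs_le_translate hT hAT hAF') (Vs_mono hA)) (by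
            rw [finrank_Vs, hAc, ← hd, posDim])
      obtain ⟨y, hy, z, hz, hyz⟩ := hf _ (apply_mem_translate.2 hxF')
      rw [← hEq] at hy
      have hy0 : y ∈ Vs (A : Set (Idx q))ᶜ := by
        have h1 := mem_Vs_compl_of_suppIn hT hA hAT hx
        have h2 : z ∈ Vs (A : Set (Idx q))ᶜ :=
          Vs_mono (disjoint_ID.mono_left hA).symm.subset_compl_right hz.2
        rw [← hyz] at h1
        simpa using Submodule.sub_mem _ h1 h2
      have : y ∈ Vs (A : Set (Idx q)) ⊓ Vs (A : Set (Idx q))ᶜ := ⟨hy, hy0⟩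
      rw [← Vs_inter, Set.inter_compl_self, Vs_empty, Submodule.mem_bot] at this
      rw [← hyz, this, zero_add]
      exact hz.2
    have key' : ∀ m : SL q, translateCycle (baseCycle F) m = baseCycle F →
        translate m (Vs (ID 1)) ≤ Vs (ID 1) := by
      rintro m hm _ ⟨x, hx, rfl⟩
      obtain ⟨A, hA, hAc, -⟩ := exists_disjoint_finset (q := q) (posDim F) ∅
      obtain ⟨i, hi⟩ := Finset.card_pos.1 (Nat.pos_of_ne_zero (hAc ▸ hpos))
      obtain ⟨l, hl⟩ := Finset.card_pos.1 (Nat.pos_of_ne_zero (hCc ▸ hpos))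
      obtain ⟨y, hy, z, hz, hyz⟩ := exists_add_of_sign (toLin m x)
      -- Pull the negative component z of mx back to V₋ and choose a member that contains x but no
      -- nonzero multiple of m⁻¹z. Its image under m fits the splitting and contains mx, so it
      -- contains z, which forces z = 0.
      have hw : toLin m⁻¹ z ∈ Vs (ID (-1)) := key m⁻¹ (translateCycle_inv hm) ⟨z, hz, rfl⟩
      obtain ⟨κ, hκ, ⟨r, hr⟩, s, hs⟩ := exists_rotate_pair (hA hi) (hC hl) hx hw
      have hmem := translate_mem_baseCycle (exchange_mem_baseCycle hF hfit hA hC hAc hCc)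
        (isSub_K.2.1 κ hκ)
      obtain ⟨-, hf, -⟩ := (mem_baseCycle_iff hF hfit).1 (translate_mem_of_translateCycle hm hmem)
      have hxF : x ∈ translate κ⁻¹ (Vs ((A : Set (Idx q)) ∪ (ID (-1) \ C))) := by
        rw [mem_translate, inv_inv, hr]
        exact Submodule.smul_mem _ _ (e_mem_Vs.2 (Or.inl hi))
      obtain ⟨y', hy', z', hz', hyz'⟩ := hf _ (apply_mem_translate.2 hxF)
      have hzz : z = z' := by
        have h1 : z - z' ∈ Vs (ID 1) ⊓ Vs (ID (-1)) := by
          refine ⟨?_, Submodule.sub_mem _ hz hz'.2⟩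
          have h2 : z - z' = y' - y := by
            rw [← hyz'] at hyz
            rw [sub_eq_sub_iff_add_eq_add, add_comm z y]
            exact hyz
          rw [h2]
          exact Submodule.sub_mem _ hy'.2 hy
        rw [← Vs_inter, disjoint_ID.inter_eq, Vs_empty, Submodule.mem_bot] at h1
        exact sub_eq_zero.1 h1
      have h3 := SetLike.mem_coe.1 hz'.1
      rw [← hzz, mem_translate, mem_translate, inv_inv, hs] at h3
      have h4 := mem_Vs.1 h3 l fun h => h.elim
        (fun h => Set.disjoint_left.1 disjoint_ID (hA h) (hC hl)) fun h => h.2 hl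
      rw [map_smul, co_e_self, smul_eq_mul, mul_one] at h4
      rw [h4, zero_smul] at hs
      have h5 : z = 0 := toLin_injective m⁻¹ (toLin_injective κ (by rw [hs, map_zero, map_zero]))
      rw [← hyz, h5, add_zero]
      exact hy
    exact fun h => ⟨translate_eq_of_le (key' m h) (key' m⁻¹ (translateCycle_inv h)),
      translate_eq_of_le (key m h) (key m⁻¹ (translateCycle_inv h))⟩
  · have key : ∀ m : SL q, translate m (Vs (ID 1)) = Vs (ID 1) →
        translate m (Vs (ID (-1))) = Vs (ID (-1)) →
        ∀ F' ∈ baseCycle F, translate m F' ∈ baseCycle F := by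
      intro m h1 h2 F' hF'
      obtain ⟨ho, hf, hd⟩ := (mem_baseCycle_iff hF hfit).1 hF'
      refine (mem_baseCycle_iff hF hfit).2 ⟨ho.translate m, hf.translate h1 h2, ?_⟩
      conv_lhs => rw [posDim, ← h1, ← translate_inf, finrank_translate]
      exact hd
    rintro ⟨h1, h2⟩
    exact translateCycle_eq_of_forall (key m h1 h2)
      (key m⁻¹ (translate_inv_eq h1) (translate_inv_eq h2))

end Indefinite

/-! ### Definite subspaces as graphs, and paths -/

/-- A definite translate is the graph of a map of finite rank. -/
theorem CDef.exists_graph {c : ℝ} (hc : c = 1 ∨ c = -1) {g : SL q} {T : Finset (Idx q)}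
    (hT : SuppIn (T : Set (Idx q)) (toLin g)) (h : CDef c (RealCycle.translate g (Vs (ID c)))) :
    ∃ u : V q →ₗ[ℝ] V q, (∀ i ∉ T, u (e i) = 0) ∧ (∀ i, u (e i) ∈ Vs (T : Set (Idx q))) ∧
      (∀ x, u x ∈ Vs (ID c)ᶜ) ∧
      (Vs (ID c)).map (LinearMap.id + u) = RealCycle.translate g (Vs (ID c)) := by
  classical
  -- Decompose eᵢ = gx + v along the translate and the opposite coordinate subspace; then z = -v. It
  -- is supported in T because gx - x and eᵢ are.
  have key : ∀ i ∈ ID c, i ∈ T → ∃ z ∈ Vs (T : Set (Idx q)), z ∈ Vs (ID c : Set (Idx q))ᶜ ∧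
      e i + z ∈ RealCycle.translate g (Vs (ID c)) := by
    intro i hi hiT
    obtain ⟨_, ⟨x, hx, rfl⟩, v, hv, hwv⟩ := h.exists_add hc (e i)
    have h1 : x + v ∈ Vs (T : Set (Idx q)) := by
      have : x + v = e i - (toLin g x - x) := by rw [← hwv]; abel
      rw [this]
      exact Submodule.sub_mem _ (e_mem_Vs.2 hiT) (hT.sub_mem x)
    refine ⟨-v, Submodule.neg_mem _ (mem_Vs_of_add hx hv h1).2, Submodule.neg_mem _ hv, ?_⟩
    rw [← hwv, add_neg_cancel_right]
    exact apply_mem_translate.2 hx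
  choose! z hz using key
  -- Outside T the basis vectors of sign c are fixed by g and already lie in the translate, so their
  -- graph value is 0.
  set u : V q →ₗ[ℝ] V q := (E q).constr ℝ fun i => if i ∈ ID c ∧ i ∈ T then z i else 0 with hu
  have hue : ∀ i, u (e i) = if i ∈ ID c ∧ i ∈ T then z i else 0 := fun i =>
    (E q).constr_basis ℝ _ i
  have hcompl : ∀ x, u x ∈ Vs (ID c : Set (Idx q))ᶜ := by
    intro x
    have h1 : Vs (Set.univ : Set (Idx q)) ≤ (Vs (ID c : Set (Idx q))ᶜ).comap u := by
      refine Vs_le.2 fun i _ => ?_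
      rw [Submodule.mem_comap, hue]
      split_ifs with hi
      · exact (hz i hi.1 hi.2).2.1
      · exact Submodule.zero_mem _
    rw [Vs_univ] at h1
    exact h1 (Submodule.mem_top (x := x))
  have hmap : (Vs (ID c)).map (LinearMap.id + u) ≤ RealCycle.translate g (Vs (ID c)) := by
    rw [Submodule.map_le_iff_le_comap]
    refine Vs_le.2 fun i hi => ?_
    rw [Submodule.mem_comap, LinearMap.add_apply, LinearMap.id_apply, hue]
    by_cases hiT : i ∈ T
    · rw [if_pos ⟨hi, hiT⟩]
      exact (hz i hi hiT).2.2
    · rw [if_neg fun h => hiT h.2, add_zero, ← hT.1 i hiT]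
      exact apply_mem_translate.2 (e_mem_Vs.2 hi)
  refine ⟨u, fun i hi => ?_, fun i => ?_, hcompl, le_antisymm hmap fun w hw => ?_⟩
  · rw [hue, if_neg fun h => hi h.2]
  · rw [hue]
    split_ifs with hi
    · exact (hz i hi.1 hi.2).1
    · exact Submodule.zero_mem _
  · obtain ⟨y, hy, v, hv, rfl⟩ := exists_add_of_compl (ID c) w
    have h1 : (LinearMap.id + u : V q →ₗ[ℝ] V q) y ∈ (Vs (ID c)).map (LinearMap.id + u) := ⟨y, hy, rfl⟩
    have h2 : v - u y ∈ RealCycle.translate g (Vs (ID c)) ⊓ Vs (ID c : Set (Idx q))ᶜ := by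
      refine ⟨?_, Submodule.sub_mem _ hv (hcompl y)⟩
      have h3 : v - u y = (y + v) - (LinearMap.id + u : V q →ₗ[ℝ] V q) y := by
        rw [LinearMap.add_apply, LinearMap.id_apply]; abel
      rw [h3]
      exact Submodule.sub_mem _ hw (hmap h1)
    rw [h.inf_eq_bot (cdef_Vs_compl hc), Submodule.mem_bot, sub_eq_zero] at h2
    rw [h2]
    exact h1

/-- Since x ⊥ u(x), the value is cB(x, x) + t²cB(ux, ux) with second term at most 0. It is smallest
at t = 1, where it is positive by assumption. -/
theorem CDef.segment {c : ℝ} (hc : c = 1 ∨ c = -1) {u : V q →ₗ[ℝ] V q}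
    (hu : ∀ x, u x ∈ Vs (ID c)ᶜ) (h : CDef c ((Vs (ID c)).map (LinearMap.id + u))) {t : ℝ}
    (ht : t ∈ Set.Icc (0 : ℝ) 1) {x : V q} (hx : x ∈ Vs (ID c)) (hx0 : x ≠ 0) :
    0 < c * B (x + t • u x) (x + t • u x) := by
  have h0 : B x (u x) = 0 := B_eq_zero_of_disjoint disjoint_compl_right hx (hu x)
  have h1 := (cdef_Vs_compl hc).nonneg (hu x)
  have hne : (LinearMap.id + u : V q →ₗ[ℝ] V q) x ≠ 0 := by
    rw [LinearMap.add_apply, LinearMap.id_apply]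
    intro hcon
    have h2 : x ∈ Vs (ID c : Set (Idx q)) ⊓ Vs (ID c)ᶜ := by
      refine ⟨hx, ?_⟩
      rw [eq_neg_of_add_eq_zero_left hcon]
      exact Submodule.neg_mem _ (hu x)
    rw [← Vs_inter, Set.inter_compl_self, Vs_empty] at h2
    exact hx0 h2
  have h2 := h _ ⟨x, hx, rfl⟩ hne
  simp only [LinearMap.add_apply, LinearMap.id_apply, map_add, map_smul, LinearMap.smul_apply,
    smul_eq_mul, h0, B_comm (u x) x] at h2 ⊢
  have h3 : t * t ≤ 1 := by nlinarith [ht.1, ht.2]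
  nlinarith

/-- Write gV₊ and g'V₋ as graphs of u and u' and scale both by t. The two graphs stay definite of
opposite signs, so id + t(u on V₊, u' on V₋) is injective for t in [0, 1], and its normalization is
a continuous path in one SL(T). -/
theorem exists_path {g g' : SL q} (h : CDef 1 (translate g (Vs (ID 1))))
    (h' : CDef (-1) (translate g' (Vs (ID (-1))))) :
    ∃ (T : Finset (Idx q)) (γ : ℝ → Matrix.SpecialLinearGroup T ℝ),
      ContinuousOn γ (Set.Icc 0 1) ∧ γ 0 = 1 ∧
      translate (stage T (γ 1)) (Vs (ID 1)) = translate g (Vs (ID 1)) ∧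
      translate (stage T (γ 1)) (Vs (ID (-1))) = translate g' (Vs (ID (-1))) ∧
      ∀ t ∈ Set.Icc (0 : ℝ) 1, CDef 1 (translate (stage T (γ t)) (Vs (ID 1))) ∧
        CDef (-1) (translate (stage T (γ t)) (Vs (ID (-1)))) := by
  classical
  obtain ⟨T₀, hT₀, hT₀'⟩ := exists_suppIn₂ g g'
  set T := insert (Sum.inl 0) T₀ with hTdef
  have hsub : (T₀ : Set (Idx q)) ⊆ T := Finset.coe_subset.2 (Finset.subset_insert _ _)
  set i₀ : T := ⟨Sum.inl 0, Finset.mem_insert_self _ _⟩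
  obtain ⟨u, hu1, hu2, hu3, hu4⟩ := h.exists_graph (Or.inl rfl) (hT₀.mono hsub)
  obtain ⟨u', hu1', hu2', hu3', hu4'⟩ := h'.exists_graph (Or.inr rfl) (hT₀'.mono hsub)
  rw [← hu4] at h ⊢
  rw [← hu4'] at h' ⊢
  set f : ℝ → V q →ₗ[ℝ] V q := fun t => LinearMap.id + t • mix (ID 1) u u' with hf
  have hf1 : ∀ t, ∀ x ∈ Vs (ID 1), f t x = x + t • u x := by
    intro t x hx
    simp only [hf, LinearMap.add_apply, LinearMap.id_apply, LinearMap.smul_apply,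
      mix_eq_left _ _ hx]
  have hf2 : ∀ t, ∀ x ∈ Vs (ID (-1)), f t x = x + t • u' x := by
    intro t x hx
    have hx' : x ∈ Vs (ID 1 : Set (Idx q))ᶜ := by rw [ID_compl (Or.inl rfl)]; exact hx
    simp only [hf, LinearMap.add_apply, LinearMap.id_apply, LinearMap.smul_apply,
      mix_eq_right _ _ hx']
  have hd1 : ∀ t ∈ Set.Icc (0 : ℝ) 1, ∀ x ∈ Vs (ID 1), x ≠ 0 → 0 < 1 * B (f t x) (f t x) := by
    intro t ht x hx hx0
    rw [hf1 t x hx]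
    exact CDef.segment (Or.inl rfl) hu3 h ht hx hx0
  have hd2 : ∀ t ∈ Set.Icc (0 : ℝ) 1, ∀ x ∈ Vs (ID (-1)), x ≠ 0 →
      0 < -1 * B (f t x) (f t x) := by
    intro t ht x hx hx0
    rw [hf2 t x hx]
    exact CDef.segment (Or.inr rfl) hu3' h' ht hx hx0
  have hsupp : ∀ t, SuppIn (T : Set (Idx q)) (f t) := by
    intro t
    constructor
    · intro i hi
      simp only [hf, LinearMap.add_apply, LinearMap.id_apply, LinearMap.smul_apply, mix_e,
        hu1 i hi, hu1' i hi, ite_self, smul_zero, add_zero]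
    · intro i hi
      simp only [hf, LinearMap.add_apply, LinearMap.id_apply, LinearMap.smul_apply, mix_e]
      refine Submodule.add_mem _ (e_mem_Vs.2 hi) (Submodule.smul_mem _ _ ?_)
      split_ifs
      · exact hu2 i
      · exact hu2' i
  have hinj : ∀ t ∈ Set.Icc (0 : ℝ) 1, Function.Injective (f t) := by
    intro t ht
    rw [injective_iff_map_eq_zero]
    intro x hx
    obtain ⟨y, hy, z, hz, rfl⟩ := exists_add_of_sign x
    rw [map_add] at hx
    have h1 : B (f t y) (f t y) = B (f t z) (f t z) := by
      rw [eq_neg_of_add_eq_zero_left hx]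
      simp only [map_neg, LinearMap.neg_apply, neg_neg]
    have hy0 : y = 0 := by
      by_contra hne
      have h2 := hd1 t ht y hy hne
      have h3 : z ≠ 0 := by
        rintro rfl
        simp only [map_zero] at h1
        rw [h1] at h2
        simp at h2
      have h4 := hd2 t ht z hz h3
      linarith
    have hz0 : z = 0 := by
      by_contra hne
      have h2 := hd2 t ht z hz hne
      rw [← h1, hy0] at h2
      simp at h2
    rw [hy0, hz0, add_zero]
  have hdet : ∀ t ∈ Set.Icc (0 : ℝ) 1, (matOf T (f t)).det ≠ 0 := fun t ht =>
    det_ne_zero_of_injective (by rw [extend_matOf (hsupp t)]; exact hinj t ht)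
  have htr : ∀ t ∈ Set.Icc (0 : ℝ) 1, ∀ s : Set (Idx q),
      translate (stage T (normalize i₀ (matOf T (f t)))) (Vs s) = (Vs s).map (f t) := by
    intro t ht s
    rw [translate_normalize i₀ (hdet t ht), extend_matOf (hsupp t)]
  refine ⟨T, fun t => normalize i₀ (matOf T (f t)), ?_, ?_, ?_, ?_, fun t ht => ⟨?_, ?_⟩⟩
  · refine continuousOn_normalize i₀ (fun i j => ?_) hdet
    have : ∀ t, matOf T (f t) i j =
        co (i : Idx q) (e (j : Idx q)) + t * co (i : Idx q) (mix (ID 1) u u' (e (j : Idx q))) := by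
      intro t
      simp [matOf, hf]
    simp only [this]
    fun_prop
  · have h1 : matOf T (f 0) = ((1 : Matrix.SpecialLinearGroup T ℝ) : Matrix T T ℝ) := by
      rw [hf]
      simp only [zero_smul, add_zero]
      rw [Matrix.SpecialLinearGroup.coe_one, ← matOf_extend T 1, extend_one]
      rfl
    simp only [h1, normalize_of_det_eq_one]
  · rw [htr 1 (by simp)]
    exact SetLike.coe_injective (Set.image_congr fun x hx => by rw [hf1 1 x hx, one_smul]; rfl)
  · rw [htr 1 (by simp)]
    exact SetLike.coe_injective (Set.image_congr fun x hx => by rw [hf2 1 x hx, one_smul]; rfl)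
  · rw [htr t ht]
    rintro _ ⟨x, hx, rfl⟩ hx0
    exact hd1 t ht x hx fun h0 => hx0 (by rw [h0, map_zero])
  · rw [htr t ht]
    rintro _ ⟨x, hx, rfl⟩ hx0
    exact hd2 t ht x hx fun h0 => hx0 (by rw [h0, map_zero])

/-! ### Smooth maps between orbits -/

theorem isPlot_orbit_iff {X : Type} {a : SL q → X} {S : Set X} {n : ℕ}
    {p : EuclideanSpace ℝ (Fin n) → S} :
    @Diffeology.IsPlot _ (orbitDiffeology a S) n p ↔
      SmoothOn a (fun x => (p x : X)) Set.univ := Iff.rfl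

theorem dSmooth_orbit {X X' : Type} {a : SL q → X} {a' : SL q → X'} {S : Set X} {S' : Set X'}
    (f : S → S')
    (hf : ∀ (T : Finset (Idx q)) (n : ℕ) (w : Set (EuclideanSpace ℝ (Fin n)))
      (M : EuclideanSpace ℝ (Fin n) → Matrix.SpecialLinearGroup T ℝ),
      (∀ i j, ContDiffOn ℝ ∞ (fun y => (M y : Matrix T T ℝ) i j) w) →
      ∃ M' : EuclideanSpace ℝ (Fin n) → Matrix.SpecialLinearGroup T ℝ,
        (∀ i j, ContDiffOn ℝ ∞ (fun y => (M' y : Matrix T T ℝ) i j) w) ∧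
        ∀ y, ∀ s : S, (s : X) = a (stage T (M y)) → (f s : X') = a' (stage T (M' y))) :
    @Diffeology.DSmooth _ _ (orbitDiffeology a S) (orbitDiffeology a' S') f := by
  intro n p hp
  rw [isPlot_orbit_iff] at hp ⊢
  intro x hx
  obtain ⟨w, hw, hxw, ⟨c, hc⟩ | ⟨T, M, hM, hc⟩⟩ := hp x hx
  · refine ⟨w, hw, hxw, Or.inl ⟨f (p x), fun y hy => ?_⟩⟩
    have : p y = p x := Subtype.ext ((hc y hy).trans (hc x hxw).symm)
    change ((f (p y) : S') : X') = f (p x)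
    rw [this]
  · obtain ⟨M', hM', h⟩ := hf T n w M hM
    exact ⟨w, hw, hxw, Or.inr ⟨T, M', hM', fun y hy => h y (p y) (hc y hy)⟩⟩

/-- Equal fibres make a(g) ↔ a'(g) a well defined bijection, and the same matrix lift M serves for
both orbit maps. -/
theorem diffeomorphic_orbit {X X' : Type} {a : SL q → X} {a' : SL q → X'} {S : Set X}
    {S' : Set X'} (h : ∀ g g', a g = a g' ↔ a' g = a' g') (hS : ∀ g, a g ∈ S ↔ a' g ∈ S')
    (hr : S ⊆ Set.range a) (hr' : S' ⊆ Set.range a') :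
    @Diffeomorphic S S' (orbitDiffeology a S) (orbitDiffeology a' S') := by
  have h1 : ∀ s : S, ∃ g, a g = s := fun s => hr s.2
  have h2 : ∀ s : S', ∃ g, a' g = s := fun s => hr' s.2
  choose γ hγ using h1
  choose γ' hγ' using h2
  let f : S → S' := fun s => ⟨a' (γ s), (hS _).1 (by rw [hγ]; exact s.2)⟩
  let f' : S' → S := fun s => ⟨a (γ' s), (hS _).2 (by rw [hγ']; exact s.2)⟩
  have hf : ∀ (s : S) g, (s : X) = a g → (f s : X') = a' g := fun s g hs =>
    (h _ _).1 ((hγ s).trans hs)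
  have hf' : ∀ (s : S') g, (s : X') = a' g → (f' s : X) = a g := fun s g hs =>
    (h _ _).2 ((hγ' s).trans hs)
  refine ⟨⟨f, f', fun s => Subtype.ext ?_, fun s => Subtype.ext ?_⟩, ?_, ?_⟩
  · exact (hf' (f s) (γ s) rfl).trans (hγ s)
  · exact (hf (f' s) (γ' s) rfl).trans (hγ' s)
  · exact dSmooth_orbit f fun T n w M hM => ⟨M, hM, fun y s hs => hf s _ hs⟩
  · exact dSmooth_orbit f' fun T n w M hM => ⟨M, hM, fun y s hs => hf' s _ hs⟩

theorem Diffeomorphic.trans {X Y Z : Type} [DiffeologicalSpace X] [DiffeologicalSpace Y]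
    [DiffeologicalSpace Z] (h : Diffeomorphic X Y) (h' : Diffeomorphic Y Z) :
    Diffeomorphic X Z := by
  obtain ⟨f, hf, hf'⟩ := h
  obtain ⟨g, hg, hg'⟩ := h'
  exact ⟨f.trans g, hg.comp hf, hf'.comp hg'⟩

/-- A constant value in the range of a lifts to a constant matrix, so both alternatives in the
definition of a plot yield a lift. -/
theorem SmoothOn.exists_lift {X : Type} {a : SL q → X} {n : ℕ}
    {p : EuclideanSpace ℝ (Fin n) → X} {u : Set (EuclideanSpace ℝ (Fin n))}
    (hp : SmoothOn a p u) {x : EuclideanSpace ℝ (Fin n)} (hx : x ∈ u) (hr : p x ∈ Set.range a) :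
    ∃ w, IsOpen w ∧ x ∈ w ∧ ∃ (T : Finset (Idx q))
      (M : EuclideanSpace ℝ (Fin n) → Matrix.SpecialLinearGroup T ℝ),
      (∀ i j, ContDiffOn ℝ ∞ (fun y => (M y : Matrix T T ℝ) i j) w) ∧
        ∀ y ∈ w, p y = a (stage T (M y)) := by
  obtain ⟨w, hw, hxw, ⟨c, hc⟩ | h⟩ := hp x hx
  · obtain ⟨g, hg⟩ := hr
    obtain ⟨T, M, rfl⟩ := exists_stage g
    exact ⟨w, hw, hxw, T, fun _ => M, fun _ _ => contDiffOn_const, fun y hy => by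
      rw [hc y hy, ← hc x hxw, hg]⟩
  · exact ⟨w, hw, hxw, h⟩

/-! ### The cycle space as a domain in another orbit -/

/-- The path in SL(T) from 1 to a representative of the same cycle projects to a path of cycles
inside D from Y, so all cycles lie in the component of Y. -/
theorem cycleSpace_eq_allCycles {X : Type} {a : SL q → X} {S : Set X}
    {D Y : Set (Submodule ℝ (V q))}
    (h1 : ∀ g g', translateCycle Y g = translateCycle Y g' ↔ a g = a g')
    (h2 : ∀ g, translateCycle Y g ⊆ D ↔ a g ∈ S)
    (hpath : ∀ g, a g ∈ S → ∃ (T : Finset (Idx q)) (γ : ℝ → Matrix.SpecialLinearGroup T ℝ),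
      ContinuousOn γ (Set.Icc 0 1) ∧ γ 0 = 1 ∧ a (stage T (γ 1)) = a g ∧
      ∀ t ∈ Set.Icc (0 : ℝ) 1, a (stage T (γ t)) ∈ S) :
    cycleSpace D Y = allCycles D Y := by
  let _ := cycleTopology Y
  refine Set.Subset.antisymm (connectedComponentIn_subset _ _) ?_
  rintro _ ⟨⟨g, rfl⟩, hg⟩
  obtain ⟨T, γ, hγ, h0, hend, hmem⟩ := hpath g ((h2 g).1 hg)
  have hcont : Continuous (translateCycle Y) := continuous_coinduced_rng
  have hpre := (isPreconnected_Icc (a := (0 : ℝ)) (b := 1)).image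
    (fun t => translateCycle Y (stage T (γ t)))
    (hcont.comp_continuousOn ((continuous_stage T).comp_continuousOn hγ))
  have hsub := hpre.subset_connectedComponentIn (F := allCycles D Y)
    (x := Y) ⟨0, by simp, by simp only [h0, stage_one, translateCycle_one]⟩ (by
      rintro _ ⟨t, ht, rfl⟩
      exact ⟨⟨_, rfl⟩, (h2 _).2 (hmem t ht)⟩)
  exact hsub ⟨1, by simp, (h1 _ _).2 hend⟩

theorem diffeomorphic_cycleSpace {X : Type} {a : SL q → X} {S : Set X}
    {D Y : Set (Submodule ℝ (V q))}
    (h1 : ∀ g g', translateCycle Y g = translateCycle Y g' ↔ a g = a g')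
    (h2 : ∀ g, translateCycle Y g ⊆ D ↔ a g ∈ S) (hr : S ⊆ Set.range a)
    (hpath : ∀ g, a g ∈ S → ∃ (T : Finset (Idx q)) (γ : ℝ → Matrix.SpecialLinearGroup T ℝ),
      ContinuousOn γ (Set.Icc 0 1) ∧ γ 0 = 1 ∧ a (stage T (γ 1)) = a g ∧
      ∀ t ∈ Set.Icc (0 : ℝ) 1, a (stage T (γ t)) ∈ S) :
    @Diffeomorphic (cycleSpace D Y) S _ (orbitDiffeology a S) := by
  have hEq := cycleSpace_eq_allCycles h1 h2 hpath
  refine diffeomorphic_orbit h1 (fun g => ?_) ?_ hr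
  · rw [← h2, hEq]
    exact ⟨fun h => h.2, fun h => ⟨⟨g, rfl⟩, h⟩⟩
  · rw [hEq]
    rintro _ ⟨⟨g, rfl⟩, -⟩
    exact ⟨g, rfl⟩

theorem mem_Bplus_translate {g : SL q} :
    translate g (Vplus q) ∈ Bplus q ↔ CDef 1 (translate g (Vs (ID 1))) := by
  rw [Vplus_eq, mem_Bplus_iff]
  exact and_iff_right ⟨g, rfl⟩

theorem mem_Bminus_translate {g : SL q} :
    translate g (Vminus q) ∈ Bminus q ↔ CDef (-1) (translate g (Vs (ID (-1)))) := by
  rw [Vminus_eq, mem_Bminus_iff]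
  exact and_iff_right ⟨g, rfl⟩

theorem Bplus_subset_range :
    Bplus q ⊆ Set.range fun g : SL q => translate g (Vplus q) := by
  intro W hW
  obtain ⟨⟨g, rfl⟩, -⟩ := mem_Bplus_iff.1 hW
  exact ⟨g, by simp only [Vplus_eq]⟩

theorem Bminus_subset_range :
    Bminus q ⊆ Set.range fun g : SL q => translate g (Vminus q) := by
  intro W hW
  obtain ⟨⟨g, rfl⟩, -⟩ := mem_Bminus_iff.1 hW
  exact ⟨g, by simp only [Vminus_eq]⟩

theorem translate_eq_iff {g g' : SL q} {W : Submodule ℝ (V q)} :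
    translate g W = translate g' W ↔ translate (g'⁻¹ * g) W = W := by
  rw [translate_mul]
  constructor
  · intro h
    rw [h, translate_inv_translate]
  · intro h
    conv_rhs => rw [← h]
    rw [translate_translate_inv]

theorem cdef_translate_one {c : ℝ} (hc : c = 1 ∨ c = -1) :
    CDef c (translate (1 : SL q) (Vs (ID c))) := by
  rw [translate_one]
  exact cdef_Vs hc

variable {D : Set (Submodule ℝ (V q))} {F : Submodule ℝ (V q)}

theorem diffeomorphic_of_posDef (hq : 2 < q) (hD : IsOpenOrbit D) (hFD : F ∈ D)
    (hle : F ≤ Vs (ID 1)) : Diffeomorphic (cycleSpace D (baseCycle F)) (Bplus q) := by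
  refine diffeomorphic_cycleSpace (a := fun g => translate g (Vplus q)) (fun g g' => ?_)
    (fun g => ?_) Bplus_subset_range fun g hg => ?_
  · rw [translateCycle_eq_iff, translateCycle_eq_iff_of_le hq (hD.inOrbit hFD) hle, Vplus_eq,
      translate_eq_iff]
  · rw [translateCycle_subset_iff_of_le hq hD hFD hle, mem_Bplus_translate]
  -- Only V₊ has to be moved; the negative graph is kept at V₋ itself.
  · obtain ⟨T, γ, h1, h2, h3, -, h4⟩ := exists_path (mem_Bplus_translate.1 hg)
      (cdef_translate_one (Or.inr rfl))
    exact ⟨T, γ, h1, h2, by simpa only [Vplus_eq] using h3,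
      fun t ht => mem_Bplus_translate.2 (h4 t ht).1⟩

theorem diffeomorphic_of_negDef (hD : IsOpenOrbit D) (hFD : F ∈ D) (hfit : Fits F)
    (hle : F ≤ Vs (ID (-1))) : Diffeomorphic (cycleSpace D (baseCycle F)) (Bminus q) := by
  obtain rfl := eq_Vs_of_le (hD.inOrbit hFD) hfit hle
  rw [baseCycle_Vs]
  refine diffeomorphic_cycleSpace (a := fun g => translate g (Vminus q)) (fun g g' => ?_)
    (fun g => ?_) Bminus_subset_range fun g hg => ?_
  · rw [translateCycle_singleton, translateCycle_singleton, Set.singleton_eq_singleton_iff,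
      Vminus_eq]
  · rw [mem_orbit_iff_cdef hD hFD, mem_Bminus_translate]
  · obtain ⟨T, γ, h1, h2, -, h3, h4⟩ := exists_path (cdef_translate_one (Or.inl rfl))
      (mem_Bminus_translate.1 hg)
    exact ⟨T, γ, h1, h2, by simpa only [Vminus_eq] using h3,
      fun t ht => mem_Bminus_translate.2 (h4 t ht).2⟩

/-- The simultaneous orbit map for both summands. -/
def pairOrbit (g : SL q) : Submodule ℝ (V q) × Submodule ℝ (V q) :=
  (translate g (Vplus q), translate g (Vminus q))

/-- Take the columns with positive-square index from M₁ and the others from M₂. The resulting matrix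
is invertible because a positive definite and a negative definite subspace meet in 0, and
normalization is smooth there. -/
theorem exists_common_lift {n : ℕ} {w : Set (EuclideanSpace ℝ (Fin n))} {T₁ T₂ : Finset (Idx q)}
    {M₁ : EuclideanSpace ℝ (Fin n) → Matrix.SpecialLinearGroup T₁ ℝ}
    {M₂ : EuclideanSpace ℝ (Fin n) → Matrix.SpecialLinearGroup T₂ ℝ}
    (h₁ : ∀ i j, ContDiffOn ℝ ∞ (fun y => (M₁ y : Matrix T₁ T₁ ℝ) i j) w)
    (h₂ : ∀ i j, ContDiffOn ℝ ∞ (fun y => (M₂ y : Matrix T₂ T₂ ℝ) i j) w)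
    (hd₁ : ∀ y ∈ w, CDef 1 (translate (stage T₁ (M₁ y)) (Vs (ID 1))))
    (hd₂ : ∀ y ∈ w, CDef (-1) (translate (stage T₂ (M₂ y)) (Vs (ID (-1))))) :
    ∃ (T : Finset (Idx q)) (M : EuclideanSpace ℝ (Fin n) → Matrix.SpecialLinearGroup T ℝ),
      (∀ i j, ContDiffOn ℝ ∞ (fun y => (M y : Matrix T T ℝ) i j) w) ∧
      ∀ y ∈ w, translate (stage T (M y)) (Vs (ID 1)) = translate (stage T₁ (M₁ y)) (Vs (ID 1)) ∧
        translate (stage T (M y)) (Vs (ID (-1))) =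
          translate (stage T₂ (M₂ y)) (Vs (ID (-1))) := by
  classical
  set T : Finset (Idx q) := insert (Sum.inl 0) (T₁ ∪ T₂) with hT
  have hT₁ : T₁ ⊆ T := Finset.subset_union_left.trans (Finset.subset_insert _ _)
  have hT₂ : T₂ ⊆ T := Finset.subset_union_right.trans (Finset.subset_insert _ _)
  set i₀ : T := ⟨Sum.inl 0, Finset.mem_insert_self _ _⟩
  set N : EuclideanSpace ℝ (Fin n) → Matrix T T ℝ := fun y => Matrix.of fun i j =>
    if (j : Idx q) ∈ ID 1 then (raise hT₁ (M₁ y) : Matrix T T ℝ) i j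
    else (raise hT₂ (M₂ y) : Matrix T T ℝ) i j with hN
  have hmix : ∀ y, extend T (N y) =
      mix (ID 1) (toLin (stage T₁ (M₁ y))) (toLin (stage T₂ (M₂ y))) := by
    intro y
    rw [← stage_raise hT₁, ← stage_raise hT₂, toLin_stage, toLin_stage]
    refine hom_ext fun j => ?_
    rw [mix_e]
    by_cases hj : j ∈ T
    · rw [extend_apply_mem T _ hj, extend_apply_mem T _ hj, extend_apply_mem T _ hj]
      by_cases hjc : j ∈ ID 1 <;> simp [hN, hjc]
    · rw [extend_e, extend_e, extend_e, dif_neg hj, dif_neg hj, dif_neg hj, ite_self]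
  have hdet : ∀ y ∈ w, (N y).det ≠ 0 := by
    intro y hy
    refine det_ne_zero_of_injective ?_
    rw [hmix]
    refine mix_injective (toLin_injective _) (toLin_injective _) ?_
    rw [ID_compl (Or.inl rfl)]
    exact (hd₁ y hy).inf_eq_bot (hd₂ y hy)
  refine ⟨T, fun y => normalize i₀ (N y), contDiffOn_normalize i₀ (fun i j => ?_) hdet,
    fun y hy => ⟨?_, ?_⟩⟩
  · by_cases hjc : (j : Idx q) ∈ ID 1
    · simp only [hN, Matrix.of_apply, if_pos hjc]
      exact contDiffOn_raise hT₁ h₁ i j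
    · simp only [hN, Matrix.of_apply, if_neg hjc]
      exact contDiffOn_raise hT₂ h₂ i j
  · rw [translate_normalize i₀ (hdet y hy), hmix, map_mix_left _ _ le_rfl]
    rfl
  · rw [translate_normalize i₀ (hdet y hy), hmix,
      map_mix_right _ _ (ID_compl (Or.inl rfl)).ge]
    rfl

/-- A lift of a pair is a lift of each component; the converse needs the common lift, since the
components come with unrelated matrices. -/
theorem diffeomorphic_prod :
    @Diffeomorphic ↥(Bplus q ×ˢ Bminus q) (Bplus q × Bminus q)
      (orbitDiffeology pairOrbit (Bplus q ×ˢ Bminus q)) _ := by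
  let _ := orbitDiffeology (q := q) pairOrbit (Bplus q ×ˢ Bminus q)
  refine ⟨⟨fun s => (⟨s.1.1, s.2.1⟩, ⟨s.1.2, s.2.2⟩), fun s => ⟨(s.1, s.2), s.1.2, s.2.2⟩,
    fun s => rfl, fun s => rfl⟩, ?_, ?_⟩
  · intro n p hp
    rw [isPlot_orbit_iff] at hp
    constructor
    · refine isPlot_orbit_iff.2 fun x hx => ?_
      obtain ⟨w, hw, hxw, ⟨c, hc⟩ | ⟨T, M, hM, hc⟩⟩ := hp x hx
      · exact ⟨w, hw, hxw, Or.inl ⟨c.1, fun y hy => congrArg Prod.fst (hc y hy)⟩⟩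
      · exact ⟨w, hw, hxw, Or.inr ⟨T, M, hM, fun y hy => congrArg Prod.fst (hc y hy)⟩⟩
    · refine isPlot_orbit_iff.2 fun x hx => ?_
      obtain ⟨w, hw, hxw, ⟨c, hc⟩ | ⟨T, M, hM, hc⟩⟩ := hp x hx
      · exact ⟨w, hw, hxw, Or.inl ⟨c.2, fun y hy => congrArg Prod.snd (hc y hy)⟩⟩
      · exact ⟨w, hw, hxw, Or.inr ⟨T, M, hM, fun y hy => congrArg Prod.snd (hc y hy)⟩⟩
  · rintro n p ⟨hp1, hp2⟩
    rw [isPlot_orbit_iff] at hp1 hp2 ⊢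
    intro x hx
    obtain ⟨w₁, hw₁, hxw₁, T₁, M₁, hM₁, hc₁⟩ := hp1.exists_lift hx (Bplus_subset_range (p x).1.2)
    obtain ⟨w₂, hw₂, hxw₂, T₂, M₂, hM₂, hc₂⟩ := hp2.exists_lift hx (Bminus_subset_range (p x).2.2)
    obtain ⟨T, M, hM, hc⟩ := exists_common_lift (w := w₁ ∩ w₂)
      (fun i j => (hM₁ i j).mono Set.inter_subset_left)
      (fun i j => (hM₂ i j).mono Set.inter_subset_right)
      (fun y hy => by
        have h := (p y).1.2
        rw [hc₁ y hy.1] at h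
        exact mem_Bplus_translate.1 h)
      (fun y hy => by
        have h := (p y).2.2
        rw [hc₂ y hy.2] at h
        exact mem_Bminus_translate.1 h)
    refine ⟨w₁ ∩ w₂, hw₁.inter hw₂, ⟨hxw₁, hxw₂⟩, Or.inr ⟨T, M, hM, fun y hy => Prod.ext ?_ ?_⟩⟩
    · have h := (hc y hy).1
      rw [← Vplus_eq] at h
      exact (hc₁ y hy.1).trans h.symm
    · have h := (hc y hy).2
      rw [← Vminus_eq] at h
      exact (hc₂ y hy.2).trans h.symm

theorem pair_subset_range : Bplus q ×ˢ Bminus q ⊆ Set.range (pairOrbit (q := q)) := by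
  rintro ⟨W, W'⟩ ⟨h, h'⟩
  obtain ⟨⟨g, rfl⟩, hW⟩ := mem_Bplus_iff.1 h
  obtain ⟨⟨g', rfl⟩, hW'⟩ := mem_Bminus_iff.1 h'
  obtain ⟨k, hk, hk'⟩ := exists_translate_pair (g := g) (g' := g') (s := ID 1) (by
    rw [ID_compl (Or.inl rfl)]
    exact hW.inf_eq_bot hW')
  rw [ID_compl (Or.inl rfl)] at hk'
  exact ⟨k, by rw [pairOrbit, Vplus_eq, Vminus_eq, hk, hk']⟩

theorem diffeomorphic_of_indefinite (hD : IsOpenOrbit D) (hFD : F ∈ D) (hfit : Fits F)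
    (hneg : F ⊓ Vs (ID (-1)) ≠ ⊥) (hpos : posDim F ≠ 0) :
    Diffeomorphic (cycleSpace D (baseCycle F)) (Bplus q × Bminus q) := by
  let _ := orbitDiffeology (q := q) pairOrbit (Bplus q ×ˢ Bminus q)
  refine Diffeomorphic.trans (Y := ↥(Bplus q ×ˢ Bminus q)) ?_ diffeomorphic_prod
  refine diffeomorphic_cycleSpace (a := pairOrbit) (fun g g' => ?_) (fun g => ?_)
    pair_subset_range fun g hg => ?_
  · rw [translateCycle_eq_iff, translateCycle_eq_iff_fix (hD.inOrbit hFD) hfit hneg hpos,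
      pairOrbit, pairOrbit, Prod.mk.injEq, Vplus_eq, Vminus_eq, translate_eq_iff,
      translate_eq_iff]
  · rw [translateCycle_subset_iff hD hFD hfit hneg hpos]
    exact and_congr mem_Bplus_translate.symm mem_Bminus_translate.symm
  · obtain ⟨T, γ, h1, h2, h3, h3', h4⟩ := exists_path (mem_Bplus_translate.1 hg.1)
      (mem_Bminus_translate.1 hg.2)
    refine ⟨T, γ, h1, h2, ?_, fun t ht =>
      ⟨mem_Bplus_translate.2 (h4 t ht).1, mem_Bminus_translate.2 (h4 t ht).2⟩⟩
    rw [pairOrbit, pairOrbit, Vplus_eq, Vminus_eq, h3, h3']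

/-! ### The two domains -/

/-- Double complements are not automatic in infinite dimension. Here they reduce to coordinate
subspaces, because M and (M*)⁻¹ are dual to each other. -/
theorem perp_perp_translate (g : SL q) (s : Set (Idx q)) :
    perp (perp (translate g (Vs s))) = translate g (Vs s) := by
  obtain ⟨T, M, rfl⟩ := exists_stage g
  have h := B_stage_coadj M
  rw [perp_translate h, perp_Vs, perp_translate (fun x y => by rw [B_comm, h, B_comm]), perp_Vs,
    compl_compl]

theorem perp_stage {T : Finset (Idx q)} (M : Matrix.SpecialLinearGroup T ℝ) {c : ℝ}
    (hc : c = 1 ∨ c = -1) :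
    perp (translate (stage T M) (Vs (ID c))) = translate (stage T (coadj M)) (Vs (ID (-c))) := by
  rw [perp_translate (B_stage_coadj M), perp_Vs, ID_compl hc]

theorem perp_mem_Bminus {W : Submodule ℝ (V q)} (hW : W ∈ Bplus q) : perp W ∈ Bminus q := by
  obtain ⟨⟨g, rfl⟩, hd⟩ := mem_Bplus_iff.1 hW
  refine mem_Bminus_iff.2 ⟨?_, hd.perp (Or.inl rfl)⟩
  obtain ⟨T, M, rfl⟩ := exists_stage g
  exact ⟨_, perp_stage M (Or.inl rfl)⟩

theorem perp_mem_Bplus {W : Submodule ℝ (V q)} (hW : W ∈ Bminus q) : perp W ∈ Bplus q := by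
  obtain ⟨⟨g, rfl⟩, hd⟩ := mem_Bminus_iff.1 hW
  have h := hd.perp (Or.inr rfl)
  rw [neg_neg] at h
  refine mem_Bplus_iff.2 ⟨?_, h⟩
  obtain ⟨T, M, rfl⟩ := exists_stage g
  refine ⟨stage T (coadj M), ?_⟩
  rw [perp_stage M (Or.inr rfl), neg_neg]

/-- The map is W ↦ W⊥ in both directions, lifted to matrices by M ↦ (M*)⁻¹. -/
theorem diffeomorphic_Bplus_Bminus : Diffeomorphic (Bplus q) (Bminus q) := by
  refine ⟨⟨fun W => ⟨perp W, perp_mem_Bminus W.2⟩, fun W => ⟨perp W, perp_mem_Bplus W.2⟩,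
    fun W => Subtype.ext ?_, fun W => Subtype.ext ?_⟩, ?_, ?_⟩
  · obtain ⟨⟨g, hg⟩, -⟩ := mem_Bplus_iff.1 W.2
    change perp (perp (W : Submodule ℝ (V q))) = W
    rw [hg, perp_perp_translate]
  · obtain ⟨⟨g, hg⟩, -⟩ := mem_Bminus_iff.1 W.2
    change perp (perp (W : Submodule ℝ (V q))) = W
    rw [hg, perp_perp_translate]
  · refine dSmooth_orbit _ fun T n w M hM =>
      ⟨fun y => coadj (M y), contDiffOn_coadj hM, fun y s hs => ?_⟩
    change perp (s : Submodule ℝ (V q)) = _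
    rw [hs, Vplus_eq, Vminus_eq, perp_stage _ (Or.inl rfl)]
  · refine dSmooth_orbit _ fun T n w M hM =>
      ⟨fun y => coadj (M y), contDiffOn_coadj hM, fun y s hs => ?_⟩
    change perp (s : Submodule ℝ (V q)) = _
    rw [hs, Vplus_eq, Vminus_eq, perp_stage _ (Or.inr rfl), neg_neg]

/-! ### The three kinds of base points -/

theorem posDim_ne_zero (hF : InOrbit F) {x : V q} (hx : x ∈ F ⊓ Vs (ID 1)) (hx0 : x ≠ 0) :
    posDim F ≠ 0 := by
  have := hF.finiteDimensional
  intro h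
  rw [posDim, Submodule.finrank_eq_zero] at h
  rw [h] at hx
  exact hx0 hx

theorem Fits.trichotomy {F : Submodule ℝ (V q)} (hfit : Fits F) :
    PosDef F ∨ NegDef F ∨ Indefinite F := by
  by_cases h1 : F ⊓ Vs (ID 1) = ⊥
  · refine Or.inr (Or.inl (negDef_iff.2 ((cdef_Vs (Or.inr rfl)).mono fun x hx => ?_)))
    obtain ⟨y, hy, z, hz, rfl⟩ := hfit x hx
    rw [h1, Submodule.mem_bot] at hy
    rw [hy, zero_add]
    exact hz.2
  by_cases h2 : F ⊓ Vs (ID (-1)) = ⊥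
  · refine Or.inl (posDef_iff.2 ((cdef_Vs (Or.inl rfl)).mono fun x hx => ?_))
    obtain ⟨y, hy, z, hz, rfl⟩ := hfit x hx
    rw [h2, Submodule.mem_bot] at hz
    rw [hz, add_zero]
    exact hy.2
  · obtain ⟨x, hx, hx0⟩ := Submodule.exists_mem_ne_zero_of_ne_bot h1
    obtain ⟨y, hy, hy0⟩ := Submodule.exists_mem_ne_zero_of_ne_bot h2
    refine Or.inr (Or.inr ⟨⟨x, hx.1, ?_⟩, y, hy.1, ?_⟩)
    · exact posDef_iff.2 (cdef_Vs (Or.inl rfl)) x hx.2 hx0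
    · exact negDef_iff.2 (cdef_Vs (Or.inr rfl)) y hy.2 hy0

/-- If one of the two parts were zero, F would lie in a single summand, where the form does not
change sign. -/
theorem Fits.of_indefinite {F : Submodule ℝ (V q)} (hfit : Fits F) (hF : InOrbit F)
    (h : Indefinite F) : F ⊓ Vs (ID (-1)) ≠ ⊥ ∧ posDim F ≠ 0 := by
  obtain ⟨⟨x, hx, hxp⟩, y, hy, hyn⟩ := h
  constructor
  · intro hbot
    obtain ⟨u, hu, v, hv, rfl⟩ := hfit y hy
    rw [hbot, Submodule.mem_bot] at hv
    subst hv
    have := (cdef_Vs (Or.inl rfl)).nonneg hu.2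
    rw [add_zero, form_eq] at hyn
    linarith
  · obtain ⟨u, hu, v, hv, rfl⟩ := hfit x hx
    refine posDim_ne_zero hF hu ?_
    rintro rfl
    have := (cdef_Vs (Or.inr rfl)).nonneg hv.2
    rw [zero_add, form_eq] at hxp
    linarith

end

end RealCycle

/-! ### The domains, their diffeomorphism and the three types of cycle space. -/

theorem theorem6p3 (q : ℕ∞) (hq : 2 < q) :
    RealCycle.Bplus q =
        {W | (∃ g : RealCycle.SL q, W = RealCycle.translate g (RealCycle.Vplus q)) ∧
          RealCycle.PosDef W} ∧
    RealCycle.Bminus q =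
        {W | (∃ g : RealCycle.SL q, W = RealCycle.translate g (RealCycle.Vminus q)) ∧
          RealCycle.NegDef W} ∧
    RealCycle.Diffeomorphic (RealCycle.Bplus q) (RealCycle.Bminus q) ∧
    ∀ D : Set (Submodule ℝ (RealCycle.V q)), RealCycle.IsOpenOrbit D →
      (∃ F ∈ D, RealCycle.Compatible F) ∧
      ∀ F ∈ D, RealCycle.FitsSplitting F →
        (RealCycle.PosDef F ∨ RealCycle.NegDef F ∨ RealCycle.Indefinite F) ∧
        (RealCycle.PosDef F →
          RealCycle.Diffeomorphic (RealCycle.cycleSpace D (RealCycle.baseCycle F))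
            (RealCycle.Bplus q)) ∧
        (RealCycle.NegDef F →
          RealCycle.Diffeomorphic (RealCycle.cycleSpace D (RealCycle.baseCycle F))
            (RealCycle.Bminus q)) ∧
        (RealCycle.Indefinite F →
          RealCycle.Diffeomorphic (RealCycle.cycleSpace D (RealCycle.baseCycle F))
            (RealCycle.Bplus q × RealCycle.Bminus q)) := by
  refine ⟨RealCycle.Bplus_eq, RealCycle.Bminus_eq, RealCycle.diffeomorphic_Bplus_Bminus,
    fun D hD => ⟨hD.exists_compatible, fun F hFD hsplit => ?_⟩⟩
  have hfit := RealCycle.fitsSplitting_iff.1 hsplit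
  refine ⟨hfit.trichotomy, fun h => ?_, fun h => ?_, fun h => ?_⟩
  · exact RealCycle.diffeomorphic_of_posDef hq hD hFD
      (hfit.le_of_cdef (RealCycle.posDef_iff.1 h))
  · exact RealCycle.diffeomorphic_of_negDef hD hFD hfit
      (hfit.le_of_cdef_neg (RealCycle.negDef_iff.1 h))
  · obtain ⟨hneg, hpos⟩ := hfit.of_indefinite (hD.inOrbit hFD) h
    exact RealCycle.diffeomorphic_of_indefinite hD hFD hfit hneg hpos
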